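/- **Setting.** Fix integers $e,\ell\ge 2$ and $s\in\mathbb Z$. Let $\Pi$ be the set of partitions and let $B_s$ be the set of charged $\ell$-partitions $|\boldsymbol\lambda,\mathbf s\rangle$, where $\boldsymbol\lambda=(\lambda^1,\dots,\lambda^\ell)\in\Pi^\ell$, $\mathbf s=(s_1,\dots,s_\ell)\in\mathbb Z^\ell$ and $s_1+\dots+s_\ell=s$. For an $\ell$-charge $\mathbf s$ with sum $s$, let $B_{\mathbf s}\subset B_s$ be the subset of elements of charge $\mathbf s$. Let $\mathcal F_s$ be the $\mathbb Q(q)$-vector space with basis $B_s$, and let $\mathcal F_{\mathbf s}$ be the span of $B_{\mathbf s}$ (the level $\ell$ Fock space). *Kashiwara crystals.* The box in row $a$ and column $b$ of $\lambda^j$ has content $b-a+s_j$ and residue $b-a+s_j \bmod e$. Put $\gamma<\gamma'$ if $\gamma'$ has larger content, or equal content and smaller $j$. For $i\in\mathbb Z/e$ write the addable (A) and removable (R) boxes of residue $i$ in increasing order and delete factors $RA$ repeatedly. The rightmost remaining $A$ is the good addable $i$-box. The operator $\tilde f_i$ adds it (with value $0$ if there is none), and $\tilde e_i$ is the partial inverse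 of $\tilde f_i$ (with value $0$ where undefined). This is the $\mathcal U_q(\widehat{\mathfrak{sl}}_e)$-crystal. The $\mathcal U_p(\widehat{\mathfrak{sl}}_\ell)$-crystal on $B_s$, with operators $\dot f_j,\dot e_j$ for $j\in\mathbb Z/\ell$, is given by the same rule, with $e$ and $\ell$ exchanged, applied to the level-rank dual charged $e$-partition. To define the latter, let the abacus of a charged multipartition be the set of beads $(j,\lambda^j_k+s_j-k+1)$, $k\ge1$. For $c\in\mathbb Z$ write $-c=-ze\ell+ye+x$ with $0\le x<e$, $0\le y<\ell$, and put $\tau(c)=(y+1,-x+ez)$ and $\dot\tau(c)=(x+1,-y+\ell z)$. The dual has abacus $\{\dot\tau(c) : \tau(1-c)\text{ is not a bead of the abacus of }|\boldsymbol\lambda,\mathbf s\rangle\}$. A vertex is *doubly highest weight* if all $\tilde e_i$ and all $\dot e_j$ send it to $0$. *Periods.* The first period of an abacus consists of beads $(j_1,d),(j_2,d-1),\dots,(j_e,d-e+1)$ with $d$ the largest occupied column, $j_1\ge j_2\ge\dots\ge j_e$, and each $j_i$ the smallest possible given the previous ones. The $k$-th period is the first period of what remains after the first $k-1$ periods are removed.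 *Heisenberg crystal operators.* These are maps $\tilde b_\sigma:B_s\to B_s$ and $\tilde b_{-\sigma}:B_s\to B_s\sqcup\{0\}$, for $\sigma\in\Pi$, which preserve the charge, commute with all $\tilde e_i,\tilde f_i,\dot e_j,\dot f_j$ (every operator sends $0$ to $0$), and act as follows on a doubly highest weight vertex: $\tilde b_\sigma$ shifts the $k$-th period by $\sigma_k$ steps to the right for every $k$, and $\tilde b_{-\sigma}$ shifts the $k$-th period by $\sigma_k$ steps to the left for every $k$ when possible, that is, when the result is a doubly highest weight vertex whose $k$-th period is the shifted $k$-th period for every $k$; otherwise its value is $0$. The map $\kappa:B_s\to\Pi$ is constant along the arrows of both Kashiwara crystals and, on a doubly highest weight vertex, all beads of the $k$-th period encode parts equal to $\kappa_k$. A vertex $v$ is a *highest weight vertex for $\mathcal H$* if $\tilde b_{-\sigma}v=0$ for all $\sigma\neq\emptyset$. *Heisenberg crystal.* $\mathcal C_s$ is the graph with vertex set $B_s$ and an arrow $v\xrightarrow{c}w$ ($c\in\mathbb Z$) whenever $\kappa(v)$ has an addable box $\gamma$ of content $c$ and $w=\tilde b_{\eta}\tilde b_{-\kappa(v)}v$ with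 $\eta=\kappa(v)\sqcup\{\gamma\}$. The Young graph has vertex set $\Pi$ and an arrow $\mu\xrightarrow{c}\nu$ whenever $\nu$ is $\mu$ plus one box of content $c$. **Proposition.** The operators $\tilde b_{\pm\sigma}$ ($\sigma\in\Pi$) and the map $\kappa$ exist and are uniquely determined by the properties above, and: 1. $\mathcal F_s=\bigoplus_{|\mathbf s|=s}\mathcal F_{\mathbf s}$, and this decomposition induces a decomposition of $\mathcal C_s$: all vertices of a connected component of $\mathcal C_s$ lie in the same $\mathcal F_{\mathbf s}$. 2. Each connected component of $\mathcal C_s$ is isomorphic, as a directed graph with coloured arrows, to the Young graph. 3. A vertex is a source of $\mathcal C_s$ if and only if it is a highest weight vertex for $\mathcal H$. 4. The depth of $|\boldsymbol\lambda,\mathbf s\rangle$ in $\mathcal C_s$ is $|\kappa|\boldsymbol\lambda,\mathbf s\rangle|$: there is a directed path with $n$ arrows from a source to $|\boldsymbol\lambda,\mathbf s\rangle$ if and only if $n=|\kappa|\boldsymbol\lambda,\mathbf s\rangle|$. -/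

import Mathlib

namespace HeisenbergCrystal

/-! ### Partitions and charged multipartitions

A partition is a `YoungDiagram`; the box `(a, b)` lies in row `a` and column `b`, both counted
from `0`, and the `k`-th part (`k = 0, 1, 2, …`) is `μ.rowLen k`. -/

/-- `ν` is obtained from the partition `μ` by adding the box `x`. -/
def AddsBox (μ : YoungDiagram) (x : ℕ × ℕ) (ν : YoungDiagram) : Prop :=
  x ∉ μ ∧ ν.cells = insert x μ.cells

/-- The arrow `μ → ν` of colour `c` in the Young graph: `ν` is `μ` plus one box, of content `c`. -/
def YoungArrow (c : ℤ) (μ ν : YoungDiagram) : Prop :=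
  ∃ a b : ℕ, AddsBox μ (a, b) ν ∧ (b : ℤ) - (a : ℤ) = c

/-- A charged `n`-partition: an `n`-tuple of partitions together with an `n`-tuple of integers.
The coordinates are numbered `0, …, n - 1`. -/
@[ext]
structure ChargedMultipartition (n : ℕ) where
  part : Fin n → YoungDiagram
  charge : Fin n → ℤ

section Multipartitions

variable {n : ℕ}

/-- A position `(j, (a, b))`: row `a` and column `b` in the coordinate `j`. -/
abbrev Box (n : ℕ) : Type := Fin n × (ℕ × ℕ)

/-- The content of a box, shifted by the charge. -/
def content (v : ChargedMultipartition n) (γ : Box n) : ℤ :=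
  (γ.2.2 : ℤ) - (γ.2.1 : ℤ) + v.charge γ.1

/-- The total order on addable and removable boxes: `γ < γ'` when `γ'` has the larger content, or
the same content and the smaller coordinate. -/
def BoxLT (v : ChargedMultipartition n) (γ γ' : Box n) : Prop :=
  content v γ < content v γ' ∨ (content v γ = content v γ' ∧ γ'.1 < γ.1)

/-- `w` is obtained from `v` by adding the box `γ`; the charge does not change. -/
def AddsBoxAt (v : ChargedMultipartition n) (γ : Box n) (w : ChargedMultipartition n) : Prop :=
  w.charge = v.charge ∧ AddsBox (v.part γ.1) γ.2 (w.part γ.1) ∧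
    ∀ j, j ≠ γ.1 → w.part j = v.part j

/-- `γ` is an addable `i`-box of `v`, where residues are contents modulo `m`. -/
def IsAddable (m : ℕ) (i : ZMod m) (v : ChargedMultipartition n) (γ : Box n) : Prop :=
  ((content v γ : ℤ) : ZMod m) = i ∧ ∃ w, AddsBoxAt v γ w

/-- `γ` is a removable `i`-box of `v`, where residues are contents modulo `m`. -/
def IsRemovable (m : ℕ) (i : ZMod m) (v : ChargedMultipartition n) (γ : Box n) : Prop :=
  ((content v γ : ℤ) : ZMod m) = i ∧ ∃ w, AddsBoxAt w γ v

/-- The addable `i`-box `γ` survives the cancellation in the `i`-word. The `i`-word lists the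
addable (A) and removable (R) `i`-boxes in increasing order, and factors RA are deleted
repeatedly. The letter A at `γ` survives exactly when no segment of the word that starts at an R
and ends just before `γ` contains more letters R than letters A. -/
def SurvivesAddable (m : ℕ) (i : ZMod m) (v : ChargedMultipartition n) (γ : Box n) : Prop :=
  IsAddable m i v γ ∧
    ∀ δ, IsRemovable m i v δ → BoxLT v δ γ →
      {β | IsRemovable m i v β ∧ ¬ BoxLT v β δ ∧ BoxLT v β γ}.ncard ≤
        {β | IsAddable m i v β ∧ ¬ BoxLT v β δ ∧ BoxLT v β γ}.ncard

/-- The good addable `i`-box: the greatest (rightmost) surviving one. -/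
def IsGoodAddable (m : ℕ) (i : ZMod m) (v : ChargedMultipartition n) (γ : Box n) : Prop :=
  SurvivesAddable m i v γ ∧ ∀ δ, SurvivesAddable m i v δ → ¬ BoxLT v γ δ

/-- The arrow `v → w` of colour `i` in the Kashiwara crystal of the level `n` Fock space, for the
quantum affine algebra of type `A` with `m` nodes: `w` is `v` plus its good addable `i`-box. -/
def KashiwaraArrow (m : ℕ) (i : ZMod m) (v w : ChargedMultipartition n) : Prop :=
  ∃ γ, IsGoodAddable m i v γ ∧ AddsBoxAt v γ w

/-- The abacus: the part `λ^j_k` gives a bead at position `λ^j_k + s_j - k + 1` of row `j`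
(here `k` is counted from `0`). -/
def abacus (v : ChargedMultipartition n) : Set (Fin n × ℤ) :=
  {x | ∃ k : ℕ, x.2 = ((v.part x.1).rowLen k : ℤ) + v.charge x.1 - (k : ℤ)}

end Multipartitions

/-- The set `B_s`: charged `l`-partitions whose charge has sum `s`. -/
abbrev FockVertex (l : ℕ) (s : ℤ) : Type :=
  {v : ChargedMultipartition l // ∑ j, v.charge j = s}

/-! ### Level-rank duality

Each integer is written as `n = - z e l + y e + x` with `0 ≤ x < e` and `0 ≤ y < l`. -/

/-- The remainder `x`. -/
def divX (e : ℕ) (n : ℤ) : ℤ := n % (e : ℤ)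

/-- The intermediate digit `y`. -/
def divY (e l : ℕ) (n : ℤ) : ℤ := (n / (e : ℤ)) % (l : ℤ)

/-- The integer `z`. -/
def divZ (e l : ℕ) (n : ℤ) : ℤ := -(n / ((e : ℤ) * (l : ℤ)))

theorem divX_lt (e : ℕ) [NeZero e] (n : ℤ) : (divX e n).toNat < e := by
  have h0 : (e : ℤ) ≠ 0 := by exact_mod_cast NeZero.ne e
  have h1 := Int.emod_nonneg n h0
  have h2 := Int.emod_lt_of_pos n (b := (e : ℤ)) (by have := NeZero.pos e; omega)
  unfold divX
  omega

theorem divY_lt (e l : ℕ) [NeZero l] (n : ℤ) : (divY e l n).toNat < l :=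
  divX_lt l (n / (e : ℤ))

/-- The bijection from the positions of the `1`-abacus to the positions of the `l`-abacus. -/
def tau (e l : ℕ) [NeZero l] (c : ℤ) : Fin l × ℤ :=
  (⟨(divY e l (-c)).toNat, divY_lt e l (-c)⟩, -(divX e (-c)) + (e : ℤ) * divZ e l (-c))

/-- The bijection from the positions of the `1`-abacus to the positions of the `e`-abacus. -/
def tauDot (e l : ℕ) [NeZero e] (c : ℤ) : Fin e × ℤ :=
  (⟨(divX e (-c)).toNat, divX_lt e (-c)⟩, -(divY e l (-c)) + (l : ℤ) * divZ e l (-c))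

/-- The beads of the `1`-abacus that `tau` sends to the beads of the `l`-abacus of `v`. -/
def oneAbacus (e : ℕ) {l : ℕ} [NeZero l] (v : ChargedMultipartition l) : Set ℤ :=
  {c | tau e l c ∈ abacus v}

/-- Conjugation on `1`-abaci: rotate about `1/2` and exchange beads and empty positions. -/
def conjugateAbacus (S : Set ℤ) : Set ℤ := {c | 1 - c ∉ S}

/-- `v'` is the charged `e`-partition that is the (twisted) level-rank dual of `v`: its abacus is
the image under `tauDot` of the conjugate of the `1`-abacus of `v`. -/
def IsLevelRankDual {e l : ℕ} [NeZero e] [NeZero l]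
    (v : ChargedMultipartition l) (v' : ChargedMultipartition e) : Prop :=
  abacus v' = tauDot e l '' conjugateAbacus (oneAbacus e v)

section Crystals

variable (e l : ℕ) [NeZero e] [NeZero l] (s : ℤ)

/-! ### The two Kashiwara crystals on `B_s` -/

/-- Arrows of the crystal of the quantum affine algebra with `e` nodes. -/
def arrowE (i : ZMod e) (v w : FockVertex l s) : Prop :=
  KashiwaraArrow e i v.1 w.1

/-- Arrows of the crystal of the quantum affine algebra with `l` nodes, which acts through the
level-rank dual charged `e`-partitions. -/
def arrowL (j : ZMod l) (v w : FockVertex l s) : Prop :=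
  ∃ v' w' : ChargedMultipartition e,
    IsLevelRankDual v.1 v' ∧ IsLevelRankDual w.1 w' ∧ KashiwaraArrow l j v' w'

open Classical in
/-- The operator with values in `α ⊔ {0}` that follows the arrows `R`; `none` stands for `0`. -/
noncomputable def follow {α : Type*} (R : α → α → Prop) (v : α) : Option α :=
  if h : ∃ w, R v w then some h.choose else none

/-- The Kashiwara crystal operators of both algebras: the lowering operators follow the arrows,
the raising operators follow the reversed arrows. -/
inductive IsKashiwaraOperator : (FockVertex l s → Option (FockVertex l s)) → Prop
  | lowerE (i : ZMod e) : IsKashiwaraOperator (follow (arrowE e l s i))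
  | raiseE (i : ZMod e) : IsKashiwaraOperator (follow (fun v w => arrowE e l s i w v))
  | lowerL (j : ZMod l) : IsKashiwaraOperator (follow (arrowL e l s j))
  | raiseL (j : ZMod l) : IsKashiwaraOperator (follow (fun v w => arrowL e l s j w v))

/-- A doubly highest weight vertex: a source in both Kashiwara crystals. -/
def IsDoublyHighest (v : FockVertex l s) : Prop :=
  (∀ i w, ¬ arrowE e l s i w v) ∧ (∀ j w, ¬ arrowL e l s j w v)

/-! ### Periods -/

/-- A candidate for an `e`-period: a starting column and, for each of the `e` consecutive columns
`start, start - 1, …, start - e + 1`, the row of a bead in that column. -/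
structure Period where
  start : ℤ
  row : Fin e → Fin l

variable {e l}

/-- The `i`-th position of a period that is shifted by `t` steps to the right. -/
def Period.pos (P : Period e l) (t : ℤ) (i : Fin e) : Fin l × ℤ :=
  (P.row i, P.start - (i : ℤ) + t)

/-- `P` is the first `e`-period of the set of beads `S`: it starts in the last nonempty column,
its rows weakly decrease, and each bead is in the smallest row that these conditions allow. -/
def IsFirstPeriod (S : Set (Fin l × ℤ)) (P : Period e l) : Prop :=
  (∀ i, P.pos 0 i ∈ S) ∧ (∀ x ∈ S, x.2 ≤ P.start) ∧ Antitone P.row ∧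
    ∀ (i : Fin e) (j : Fin l), (j, P.start - (i : ℤ)) ∈ S → (∀ i' < i, j ≤ P.row i') → P.row i ≤ j

/-- `P 0, P 1, …` are the successive periods of `S`: each is the first period of what remains of
`S` when the earlier ones are removed. In particular `S` is totally `e`-periodic. -/
def IsPeriodSequence (S : Set (Fin l × ℤ)) (P : ℕ → Period e l) : Prop :=
  ∀ k, IsFirstPeriod (S \ {x | ∃ k' < k, ∃ i, x = (P k').pos 0 i}) (P k)

variable (e l)

/-! ### The Heisenberg crystal operators -/

/-- A candidate for the operators `b_σ : B_s → B_s` and `b_{-σ} : B_s → B_s ⊔ {0}`. -/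
structure Operators where
  pos : YoungDiagram → FockVertex l s → FockVertex l s
  neg : YoungDiagram → FockVertex l s → Option (FockVertex l s)

instance : Nonempty (Operators l s) := ⟨⟨fun _ v => v, fun _ v => some v⟩⟩

/-- On a doubly highest weight vertex `v`, the vertex `w` is obtained by shifting the `k`-th period
by `σ_k` steps to the right. -/
def IsRightShift (σ : YoungDiagram) (v w : FockVertex l s) : Prop :=
  ∃ P : ℕ → Period e l, IsPeriodSequence (abacus v.1) P ∧
    abacus w.1 = {x | ∃ k i, x = (P k).pos (σ.rowLen k) i}

/-- On a doubly highest weight vertex `v`, the vertex `w` is obtained by shifting the `k`-th period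
by `σ_k` steps to the left; the shift is possible when it yields a doubly highest weight vertex
of which the `k`-th shifted period is again the `k`-th period. -/
def IsLeftShift (σ : YoungDiagram) (v w : FockVertex l s) : Prop :=
  IsDoublyHighest e l s w ∧
    ∃ P Q : ℕ → Period e l, IsPeriodSequence (abacus v.1) P ∧ IsPeriodSequence (abacus w.1) Q ∧
      ∀ k i, (Q k).pos 0 i = (P k).pos (-(σ.rowLen k : ℤ)) i

/-- The properties that determine the Heisenberg crystal operators. -/
structure IsHeisenberg (b : Operators l s) : Prop where
  pos_charge : ∀ σ v, (b.pos σ v).1.charge = v.1.charge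
  neg_charge : ∀ σ v w, b.neg σ v = some w → w.1.charge = v.1.charge
  pos_shift : ∀ σ v, IsDoublyHighest e l s v → IsRightShift e l s σ v (b.pos σ v)
  neg_shift : ∀ σ v, IsDoublyHighest e l s v →
    ∀ w, b.neg σ v = some w ↔ (w.1.charge = v.1.charge ∧ IsLeftShift e l s σ v w)
  pos_comm : ∀ σ op, IsKashiwaraOperator e l s op →
    ∀ v, (op v).map (b.pos σ) = op (b.pos σ v)
  neg_comm : ∀ σ op, IsKashiwaraOperator e l s op →
    ∀ v, (op v).bind (b.neg σ) = (b.neg σ v).bind op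

/-- The Heisenberg crystal operators: the operators determined by `IsHeisenberg`. -/
noncomputable def heisenberg : Operators l s := Classical.epsilon (IsHeisenberg e l s)

/-- The properties that determine the map `κ`: on a doubly highest weight vertex, all beads of the
`k`-th period encode the part `κ_k`, and `κ` is constant along both Kashiwara crystals. -/
structure IsKappa (κ : FockVertex l s → YoungDiagram) : Prop where
  doublyHighest : ∀ v, IsDoublyHighest e l s v →
    ∃ P : ℕ → Period e l, IsPeriodSequence (abacus v.1) P ∧
      ∀ k i, ∃ a : ℕ, (v.1.part ((P k).row i)).rowLen a = (κ v).rowLen k ∧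
        (P k).start - (i : ℤ) = ((κ v).rowLen k : ℤ) + v.1.charge ((P k).row i) - (a : ℤ)
  invariant : ∀ op, IsKashiwaraOperator e l s op → ∀ v w, op v = some w → κ w = κ v

/-- The map `κ : B_s → Π`. -/
noncomputable def kappa : FockVertex l s → YoungDiagram := Classical.epsilon (IsKappa e l s)

/-- The operator `b_{1,c} = b_η b_{-κ}` as a relation: `η` is `κ` plus its addable box of content
`c`; when `κ` has no such box there is no arrow. These are the arrows of colour `c` of the
Heisenberg crystal. -/
def heisenbergArrow (c : ℤ) (v w : FockVertex l s) : Prop :=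
  ∃ η, YoungArrow c (kappa e l s v) η ∧
    ((heisenberg e l s).neg (kappa e l s v) v).map ((heisenberg e l s).pos η) = some w

/-- `v` and `w` lie in the same connected component of the Heisenberg crystal. -/
def Connected (v w : FockVertex l s) : Prop :=
  Relation.EqvGen (fun v w => ∃ c, heisenbergArrow e l s c v w) v w

/-- `v` is a source of the Heisenberg crystal: no arrow ends in `v`. -/
def IsSource (v : FockVertex l s) : Prop :=
  ∀ c w, ¬ heisenbergArrow e l s c w v

/-- `v` is a highest weight vertex for the Heisenberg algebra: `b_{-σ} v = 0` for every nonempty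
partition `σ`. -/
def IsHeisenbergHighest (v : FockVertex l s) : Prop :=
  ∀ σ : YoungDiagram, σ ≠ ⊥ → (heisenberg e l s).neg σ v = none

/-- There is a directed path with `n` arrows from `u` to `v` in the Heisenberg crystal. -/
def HasPath (n : ℕ) (u v : FockVertex l s) : Prop :=
  ∃ p : ℕ → FockVertex l s, p 0 = u ∧ p n = v ∧
    ∀ k < n, ∃ c, heisenbergArrow e l s c (p k) (p (k + 1))

/-! ### Fock spaces -/

/-- The wedge space over `ℚ(q)`, with basis `B_s`. -/
abbrev WedgeSpace : Type := FockVertex l s →₀ RatFunc ℚ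

/-- The basis vector of a charged multipartition. -/
noncomputable def ket (v : FockVertex l s) : WedgeSpace l s := Finsupp.single v 1

/-- The level `l` Fock space of an `l`-charge `t`, spanned by the charged `l`-partitions with
charge `t`. -/
noncomputable def fockSpace (t : {t : Fin l → ℤ // ∑ j, t j = s}) :
    Submodule (RatFunc ℚ) (WedgeSpace l s) :=
  Submodule.span (RatFunc ℚ) (ket l s '' {v | v.1.charge = t.1})

end Crystals

end HeisenbergCrystal

open HeisenbergCrystal

/-! Continue the abacus periodically under translation by `(e, l)`: it becomes a 0/1 configuration
on the plane (`conf`) with columns `u` and rows `t`. Adding a box moves an orbit of beads from a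
column `U` to `U + 1`, and the signature rule compares these two columns. Level-rank duality
becomes, up to a translation, the transposed complement `dual` (`isLevelRankDual_iff`). The second
crystal is therefore the same construction on pairs of rows, and a statement about one crystal gives
one about the other.

A good box is certified by a nonnegative potential, the partial sums of the difference of two lines
(`Lowers`, `Raises`). Following the certificates of one crystal through an arrow of the other shows
that the two crystals commute (`square_lower_lower` and its companions).

A configuration is a source for the columns exactly when, for each `k`, the height of the `k`-th
bead of a column is monotone in the column (`isHighest_iff`). If it is a source for the rows as
well, a telescoping sum over one period forces the `k`-th layer to be `F (u - κ k) + k`, for a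
staircase `F`, which is equivalent to the charge, and a partition `κ`
(`IsDoublyHighestConf.exists_vertex`). The layers are the periods, and their beads encode the parts
of `κ`.

The main point is that for a given charge the crystal component does not depend on `κ`. Moving the
layers `0, …, n` one column to the right (`IsShift`) is compatible with all row arrows, and such
shifts build every `κ` from the empty partition, column by column. So the row components agree. The
row charges are adjoint to `F` and do not see `κ`, so by duality the column components agree too.
The squares, together with the fact that a component contains only one doubly highest vertex,
combine both statements (`IsVertex.twin`, `eq_of_reach_confArrow`).

Hence a vertex amounts to the charge of its root, the partition `κ`, and its position relative to
the root, where the possible positions depend only on the charge. The operators add `σ` to `κ` or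
subtract it and keep the rest (`ShiftRel`); a Heisenberg arrow adds one box to `κ`
(`heisenbergArrow_iff`). The components are the classes of `Similar`, each in bijection with the set
of partitions, and all assertions are read off from `κ`. -/

namespace HeisenbergCrystal

/-! ### Periodic bead configurations

A configuration is a function `M : ℤ → ℤ → ℤ` with values `0` and `1` (a bead at `(u, t)` when
`M u t = 1`) which is invariant under translation by `(e, l)`. -/

open Classical in
/-- The indicator function of the orbit of `(u, t)` under translation by `(e, l)`. -/
noncomputable def orb (e l u t u' t' : ℤ) : ℤ :=
  if ∃ m : ℤ, u' = u + m * e ∧ t' = t + m * l then 1 else 0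

theorem orb_eq_one {e l u t u' t' : ℤ} :
    orb e l u t u' t' = 1 ↔ ∃ m : ℤ, u' = u + m * e ∧ t' = t + m * l := by
  unfold orb; split_ifs with h <;> simp [h]

theorem orb_zero_or_one (e l u t u' t' : ℤ) : orb e l u t u' t' = 0 ∨ orb e l u t u' t' = 1 := by
  unfold orb; split_ifs <;> simp

theorem orb_self (e l u t : ℤ) : orb e l u t u t = 1 := orb_eq_one.2 ⟨0, by simp, by simp⟩

theorem orb_add (e l u t u' t' i j : ℤ) :
    orb e l (u + i) (t + j) (u' + i) (t' + j) = orb e l u t u' t' := by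
  unfold orb
  congr 1
  apply propext
  constructor <;> rintro ⟨m, h1, h2⟩ <;> exact ⟨m, by linarith, by linarith⟩

theorem orb_swap (e l u t u' t' : ℤ) : orb l e t u t' u' = orb e l u t u' t' := by
  unfold orb
  congr 1
  apply propext
  constructor <;> rintro ⟨m, h1, h2⟩ <;> exact ⟨m, h2, h1⟩

theorem orb_neg (e l u t u' t' : ℤ) : orb e l (-u) (-t) (-u') (-t') = orb e l u t u' t' := by
  unfold orb
  congr 1
  apply propext
  constructor <;> rintro ⟨m, h1, h2⟩ <;> exact ⟨-m, by linarith, by linarith⟩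

theorem orb_period (e l u t u' t' : ℤ) : orb e l u t (u' + e) (t' + l) = orb e l u t u' t' := by
  unfold orb
  congr 1
  apply propext
  constructor
  · rintro ⟨m, h1, h2⟩; exact ⟨m - 1, by linarith, by linarith⟩
  · rintro ⟨m, h1, h2⟩; exact ⟨m + 1, by linarith, by linarith⟩

theorem orb_congr {e l u t u₀ t₀ : ℤ} (h : orb e l u t u₀ t₀ = 1) (u' t' : ℤ) :
    orb e l u t u' t' = orb e l u₀ t₀ u' t' := by
  obtain ⟨n, h1, h2⟩ := orb_eq_one.1 h
  unfold orb
  congr 1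
  apply propext
  constructor
  · rintro ⟨m, h3, h4⟩; exact ⟨m - n, by subst h1; linarith, by subst h2; linarith⟩
  · rintro ⟨m, h3, h4⟩; exact ⟨m + n, by subst h1; linarith, by subst h2; linarith⟩

theorem orb_symm {e l u t u₀ t₀ : ℤ} (h : orb e l u t u₀ t₀ = 1) : orb e l u₀ t₀ u t = 1 := by
  rw [← orb_congr h]; exact orb_self ..

theorem orb_same_row {e l u t u' : ℤ} (hl : 2 ≤ l) : orb e l u t u' t = 1 ↔ u' = u := by
  rw [orb_eq_one]
  constructor
  · rintro ⟨m, h1, h2⟩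
    have : m * l = 0 := by linarith
    rcases mul_eq_zero.1 this with h | h
    · simp [h1, h]
    · omega
  · rintro rfl; exact ⟨0, by simp, by simp⟩

theorem orb_next_row {e l u t u' t' : ℤ} (hl : 2 ≤ l) (h : t' = t + 1 ∨ t' = t - 1) :
    orb e l u t u' t' = 0 := by
  rcases orb_zero_or_one e l u t u' t' with h0 | h1
  · exact h0
  · obtain ⟨m, -, h2⟩ := orb_eq_one.1 h1
    exfalso
    have h3 : m * l = 1 ∨ m * l = -1 := by omega
    have h4 : l ∣ 1 := by
      rcases h3 with h3 | h3
      · exact ⟨m, by linarith⟩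
      · exact ⟨-m, by linarith⟩
    have := Int.le_of_dvd one_pos h4
    omega

/-! ### Certificates of the signature rule, and how an arrow of one crystal changes those of the
other -/

/-- The potential `D` shows that the bead at position `a` of the line `A` is the one that the
signature rule moves to the line `B`. -/
structure Lowers (A B D : ℤ → ℤ) (a : ℤ) : Prop where
  step : ∀ t, D t - D (t - 1) = A t - B t
  zero : D (a - 1) = 0
  nonneg : ∀ t, 0 ≤ D t
  pos : ∀ t, a ≤ t → 0 < D t

/-- The potential `D` shows that the bead at position `a` of the line `B` is the one that the
signature rule moves back to the line `A`. -/
structure Raises (A B D : ℤ → ℤ) (a : ℤ) : Prop where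
  step : ∀ t, D t - D (t - 1) = A t - B t
  zero : D a = 0
  nonneg : ∀ t, 0 ≤ D t
  pos : ∀ t, t < a → 0 < D t

/-- The transposed complement. -/
def dual (M : ℤ → ℤ → ℤ) : ℤ → ℤ → ℤ := fun t u => 1 - M u t

theorem dual_dual (M : ℤ → ℤ → ℤ) : dual (dual M) = M := by
  funext u t; simp [dual]

/-- Values in `{0, 1}` and periodicity. -/
structure IsBits (e l : ℤ) (M : ℤ → ℤ → ℤ) : Prop where
  zero_or_one : ∀ u t, M u t = 0 ∨ M u t = 1
  period : ∀ u t, M (u + e) (t + l) = M u t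

theorem IsBits.dual {e l : ℤ} {M : ℤ → ℤ → ℤ} (h : IsBits e l M) : IsBits l e (dual M) :=
  ⟨fun t u => by have := h.zero_or_one u t; unfold HeisenbergCrystal.dual; omega,
   fun t u => by unfold HeisenbergCrystal.dual; rw [h.period]⟩

theorem IsBits.period_mul {e l : ℤ} {M : ℤ → ℤ → ℤ} (h : IsBits e l M) (m u t : ℤ) :
    M (u + m * e) (t + m * l) = M u t := by
  induction m using Int.induction_on with
  | zero => simp
  | succ i ih =>
    rw [← ih, ← h.period (u + i * e) (t + i * l)]; congr 1 <;> ring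
  | pred i ih =>
    rw [← ih, ← h.period (u + (-(i : ℤ) - 1) * e) (t + (-(i : ℤ) - 1) * l)]; congr 1 <;> ring

theorem IsBits.orb_eq {e l : ℤ} {M : ℤ → ℤ → ℤ} (h : IsBits e l M) {u t u' t' : ℤ}
    (ho : orb e l u t u' t' = 1) : M u' t' = M u t := by
  obtain ⟨m, rfl, rfl⟩ := orb_eq_one.1 ho
  exact h.period_mul m u t

/-- `N` is obtained from `M` by moving the bead at `(U, a)` to `(U + 1, a)`. -/
def Moves (e l U a : ℤ) (M N : ℤ → ℤ → ℤ) : Prop :=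
  ∀ u t, N u t = M u t - orb e l U a u t + orb e l (U + 1) a u t

/-- The arrow of the crystal of the columns `U` and `U + 1`. -/
def Arr (e l U : ℤ) (M N : ℤ → ℤ → ℤ) : Prop :=
  ∃ D a, Lowers (M U) (M (U + 1)) D a ∧ Moves e l U a M N

theorem Lowers.bits {A B D : ℤ → ℤ} {a : ℤ} (h : Lowers A B D a)
    (hA : A a = 0 ∨ A a = 1) (hB : B a = 0 ∨ B a = 1) : A a = 1 ∧ B a = 0 ∧ D a = 1 := by
  have h1 := h.step a
  have h2 := h.zero
  have h3 := h.pos a le_rfl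
  omega

theorem Raises.bits {A B D : ℤ → ℤ} {a : ℤ} (h : Raises A B D a)
    (hA : A a = 0 ∨ A a = 1) (hB : B a = 0 ∨ B a = 1) : A a = 0 ∧ B a = 1 ∧ D (a - 1) = 1 := by
  have h1 := h.step a
  have h2 := h.zero
  have h3 := h.pos (a - 1) (by omega)
  omega

/-- A certificate is given at one point of an orbit; periodicity carries it to every other point, in
particular to the one that meets the rows under consideration. -/
theorem Lowers.translate {e l : ℤ} {M : ℤ → ℤ → ℤ} (hM : IsBits e l M) {D : ℤ → ℤ} {U a u t : ℤ}
    (h : Lowers (M U) (M (U + 1)) D a) (ho : orb e l U a u t = 1) :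
    ∃ D', Lowers (M u) (M (u + 1)) D' t := by
  obtain ⟨m, rfl, rfl⟩ := orb_eq_one.1 ho
  refine ⟨fun s => D (s - m * l), ⟨fun s => ?_, ?_, fun s => h.nonneg _, fun s hs => h.pos _ (by omega)⟩⟩
  · have h1 := h.step (s - m * l)
    have h2 := hM.period_mul m U (s - m * l)
    have h3 := hM.period_mul m (U + 1) (s - m * l)
    rw [sub_add_cancel] at h2 h3
    rw [show U + m * e + 1 = U + 1 + m * e by ring, h2, h3, ← h1]
    congr 2; ring
  · rw [← h.zero]; congr 1; ring

theorem Raises.translate {e l : ℤ} {M : ℤ → ℤ → ℤ} (hM : IsBits e l M) {D : ℤ → ℤ} {U a u t : ℤ}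
    (h : Raises (M U) (M (U + 1)) D a) (ho : orb e l U a u t = 1) :
    ∃ D', Raises (M u) (M (u + 1)) D' t := by
  obtain ⟨m, rfl, rfl⟩ := orb_eq_one.1 ho
  refine ⟨fun s => D (s - m * l), ⟨fun s => ?_, ?_, fun s => h.nonneg _, fun s hs => h.pos _ (by omega)⟩⟩
  · have h1 := h.step (s - m * l)
    have h2 := hM.period_mul m U (s - m * l)
    have h3 := hM.period_mul m (U + 1) (s - m * l)
    rw [sub_add_cancel] at h2 h3
    rw [show U + m * e + 1 = U + 1 + m * e by ring, h2, h3, ← h1]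
    congr 2; ring
  · rw [← h.zero]; congr 1; ring

/-- A move in the columns changes the row potentials by orbit indicators. -/
theorem potential_step {e l U a T : ℤ} {M N : ℤ → ℤ → ℤ} (hN : Moves e l U a M N) {D : ℤ → ℤ}
    (hD : ∀ u, D u - D (u - 1) = dual M T u - dual M (T + 1) u) (u : ℤ) :
    (D u + orb e l U a u T - orb e l U a u (T + 1)) -
      (D (u - 1) + orb e l U a (u - 1) T - orb e l U a (u - 1) (T + 1)) =
      dual N T u - dual N (T + 1) u := by
  have h1 := hD u
  have h2 := hN u T
  have h3 := hN u (T + 1)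
  have h4 := orb_add e l U a (u - 1) T 1 0
  have h5 := orb_add e l U a (u - 1) (T + 1) 1 0
  simp only [sub_add_cancel, add_zero] at h4 h5
  unfold dual at *
  omega

/-- The effect of a lowering move in the columns on a lowering certificate of the rows. -/
theorem Lowers.after_lower {e l U a T c : ℤ} (hl : 2 ≤ l) {M N : ℤ → ℤ → ℤ}
    (hM : IsBits e l M) {Δ D : ℤ → ℤ} (h1 : Lowers (M U) (M (U + 1)) Δ a)
    (h2 : Lowers (dual M T) (dual M (T + 1)) D c) (hN : Moves e l U a M N) :
    ∃ D' c', Lowers (dual N T) (dual N (T + 1)) D' c' ∧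
      ((c' = c ∧ orb e l U a c (T + 1) = 0 ∧ orb e l U a (c - 1) T = 0) ∨
        (c' = c + 1 ∧ orb e l U a c (T + 1) = 1) ∨ (c' = c - 1 ∧ orb e l U a (c - 1) T = 1)) := by
  have hst := potential_step hN h2.step
  obtain ⟨r1, r2, r3⟩ := h2.bits (hM.dual.zero_or_one _ _) (hM.dual.zero_or_one _ _)
  have hz := h2.zero
  -- Only a moved bead in row `T + 1` can decrease the row potential, and then in the single column
  -- `v`; since `l ≥ 2`, the orbit does not meet row `T` as well.
  by_cases hx : ∃ u₀, orb e l U a u₀ (T + 1) = 1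
  · obtain ⟨v, hv⟩ := hx
    obtain ⟨Δ', g⟩ := h1.translate hM hv
    obtain ⟨b1, b2, b3⟩ := g.bits (hM.zero_or_one _ _) (hM.zero_or_one _ _)
    have o1 : ∀ u, orb e l U a u T = 0 := fun u => by
      rw [orb_congr hv]; exact orb_next_row hl (by omega)
    have o2 : ∀ u, orb e l U a u (T + 1) = 1 ↔ u = v := fun u => by
      rw [orb_congr hv]; exact orb_same_row hl
    have o3 : ∀ u, u ≠ v → orb e l U a u (T + 1) = 0 := fun u hu =>
      (orb_zero_or_one e l U a u (T + 1)).resolve_right (fun h => hu ((o2 u).1 h))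
    have s1 := h2.step v
    have s2 := h2.step (v + 1)
    have s3 := h2.step c
    -- The column certificate vanishes at `T` and is nonnegative at `T - 1`, so `M v T ≤ M (v + 1)
    -- T`. This makes `D` smaller at a neighbour of `v`, so that `D v` can be decreased by one.
    have g1 := g.step T
    have g2 := g.zero
    have g3 := g.nonneg (T - 1)
    simp only [dual, add_sub_cancel_right] at *
    have m1 := hM.zero_or_one v T
    have m2 := hM.zero_or_one (v + 1) T
    have m3 := hM.zero_or_one (v + 1) (T + 1)
    by_cases hc : v = c
    · subst hc
      refine ⟨_, v + 1, ⟨hst, ?_, fun u => ?_, fun u hu => ?_⟩, Or.inr (Or.inl ⟨rfl, hv⟩)⟩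
      · simp only [add_sub_cancel_right, o1, hv]; omega
      · by_cases hu : u = v
        · subst hu; simp only [o1, hv]; omega
        · have := h2.nonneg u; rw [o1, o3 u hu]; omega
      · have := h2.pos u (by omega); rw [o1, o3 u (by omega)]; omega
    · have hvc : v ≠ c - 1 := by
        rintro rfl
        simp only [sub_add_cancel] at *
        omega
      refine ⟨_, c, ⟨hst, ?_, fun u => ?_, fun u hu => ?_⟩,
        Or.inl ⟨rfl, o3 c (Ne.symm hc), o1 _⟩⟩
      · rw [o1, o3 _ (Ne.symm hvc)]; omega
      · by_cases hu : u = v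
        · subst hu
          have n1 := h2.nonneg (u - 1)
          have n2 := h2.nonneg (u + 1)
          rw [o1, hv]; omega
        · have := h2.nonneg u; rw [o1, o3 u hu]; omega
      · by_cases huv : u = v
        · subst huv
          have n1 := h2.pos (u - 1) (by omega)
          have n2 := h2.pos (u + 1) (by omega)
          rw [o1, hv]; omega
        · have := h2.pos u hu; rw [o1, o3 u huv]; omega
  · have o1 : ∀ u, orb e l U a u (T + 1) = 0 := fun u =>
      (orb_zero_or_one e l U a u (T + 1)).resolve_right (fun h => hx ⟨u, h⟩)
    -- A moved bead in row `T` increases the potential. This matters only at `c - 1`, the last zero;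
    -- the column certificate then gives `M (c - 1) (T + 1) = 1`, so `D (c - 2) = 0` and the last
    -- zero moves back by one.
    by_cases hb : orb e l U a (c - 1) T = 1
    · obtain ⟨Δ', g⟩ := h1.translate hM hb
      obtain ⟨b1, b2, b3⟩ := g.bits (hM.zero_or_one _ _) (hM.zero_or_one _ _)
      have o2 : ∀ u, orb e l U a u T = 1 ↔ u = c - 1 := fun u => by
        rw [orb_congr hb]; exact orb_same_row hl
      have s1 := h2.step (c - 1)
      have g1 := g.step (T + 1)
      have g2 := g.pos (T + 1) (by omega)
      have m1 := hM.zero_or_one (c - 1) (T + 1)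
      simp only [dual, add_sub_cancel_right, sub_add_cancel] at *
      refine ⟨_, c - 1, ⟨hst, ?_, fun u => ?_, fun u hu => ?_⟩, Or.inr (Or.inr ⟨rfl, hb⟩)⟩
      · have := (orb_zero_or_one e l U a (c - 1 - 1) T).resolve_right
          (fun h => by have := (o2 _).1 h; omega)
        rw [o1, this]; omega
      · have := h2.nonneg u
        have := orb_zero_or_one e l U a u T
        rw [o1]; omega
      · have h5 := o2 u
        have := orb_zero_or_one e l U a u T
        have := h2.nonneg u
        by_cases huc : u = c - 1
        · have := h5.2 huc
          rw [o1]; omega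
        · have := h2.pos u (by omega)
          rw [o1]; omega
    · have hb' := (orb_zero_or_one e l U a (c - 1) T).resolve_right hb
      refine ⟨_, c, ⟨hst, ?_, fun u => ?_, fun u hu => ?_⟩, Or.inl ⟨rfl, o1 _, hb'⟩⟩
      · rw [o1, hb']; omega
      · have := h2.nonneg u
        have := orb_zero_or_one e l U a u T
        rw [o1]; omega
      · have := h2.pos u hu
        have := orb_zero_or_one e l U a u T
        rw [o1]; omega

/-- The effect of a lowering move in the columns on a raising certificate of the rows. -/
theorem Raises.after_lower {e l U a T c : ℤ} (hl : 2 ≤ l) {M N : ℤ → ℤ → ℤ}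
    (hM : IsBits e l M) {Δ D : ℤ → ℤ} (h1 : Lowers (M U) (M (U + 1)) Δ a)
    (h2 : Raises (dual M T) (dual M (T + 1)) D c) (hN : Moves e l U a M N) :
    ∃ D' c', Raises (dual N T) (dual N (T + 1)) D' c' ∧
      ((c' = c ∧ orb e l U a c T = 0 ∧ orb e l U a (c - 1) (T + 1) = 0) ∨
        (c' = c + 1 ∧ orb e l U a c T = 1) ∨
        (c' = c - 1 ∧ orb e l U a (c - 1) (T + 1) = 1)) := by
  have hst := potential_step hN h2.step
  obtain ⟨r1, r2, r3⟩ := h2.bits (hM.dual.zero_or_one _ _) (hM.dual.zero_or_one _ _)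
  have hz := h2.zero
  by_cases hx : ∃ u₀, orb e l U a u₀ (T + 1) = 1
  · obtain ⟨v, hv⟩ := hx
    obtain ⟨Δ', g⟩ := h1.translate hM hv
    obtain ⟨b1, b2, b3⟩ := g.bits (hM.zero_or_one _ _) (hM.zero_or_one _ _)
    have o1 : ∀ u, orb e l U a u T = 0 := fun u => by
      rw [orb_congr hv]; exact orb_next_row hl (by omega)
    have o2 : ∀ u, orb e l U a u (T + 1) = 1 ↔ u = v := fun u => by
      rw [orb_congr hv]; exact orb_same_row hl
    have o3 : ∀ u, u ≠ v → orb e l U a u (T + 1) = 0 := fun u hu =>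
      (orb_zero_or_one e l U a u (T + 1)).resolve_right (fun h => hu ((o2 u).1 h))
    have s1 := h2.step v
    have s2 := h2.step (v + 1)
    have s3 := h2.step c
    have g1 := g.step T
    have g2 := g.zero
    have g3 := g.nonneg (T - 1)
    simp only [dual, add_sub_cancel_right] at *
    have m1 := hM.zero_or_one v T
    have m2 := hM.zero_or_one (v + 1) T
    have m3 := hM.zero_or_one (v + 1) (T + 1)
    have hvc : v ≠ c := by rintro rfl; omega
    by_cases hc : v = c - 1
    · subst hc
      refine ⟨_, c - 1, ⟨hst, ?_, fun u => ?_, fun u hu => ?_⟩, Or.inr (Or.inr ⟨rfl, hv⟩)⟩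
      · rw [o1, hv]; omega
      · by_cases hu : u = c - 1
        · subst hu; rw [o1, hv]; omega
        · have := h2.nonneg u; rw [o1, o3 u hu]; omega
      · have := h2.pos u (by omega); rw [o1, o3 u (by omega)]; omega
    · refine ⟨_, c, ⟨hst, ?_, fun u => ?_, fun u hu => ?_⟩,
        Or.inl ⟨rfl, o1 _, o3 _ (Ne.symm hc)⟩⟩
      · rw [o1, o3 _ (Ne.symm hvc)]; omega
      · by_cases hu : u = v
        · subst hu
          have n1 := h2.nonneg (u - 1)
          have n2 := h2.nonneg (u + 1)
          rw [o1, hv]; omega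
        · have := h2.nonneg u; rw [o1, o3 u hu]; omega
      · by_cases huv : u = v
        · subst huv
          have n1 := h2.pos (u - 1) (by omega)
          have n2 := h2.pos (u + 1) (by omega)
          rw [o1, hv]; omega
        · have := h2.pos u hu; rw [o1, o3 u huv]; omega
  · have o1 : ∀ u, orb e l U a u (T + 1) = 0 := fun u =>
      (orb_zero_or_one e l U a u (T + 1)).resolve_right (fun h => hx ⟨u, h⟩)
    by_cases hb : orb e l U a c T = 1
    · obtain ⟨Δ', g⟩ := h1.translate hM hb
      obtain ⟨b1, b2, b3⟩ := g.bits (hM.zero_or_one _ _) (hM.zero_or_one _ _)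
      have o2 : ∀ u, orb e l U a u T = 1 ↔ u = c := fun u => by
        rw [orb_congr hb]; exact orb_same_row hl
      -- The zero at `c` is destroyed. Positivity of the column certificate at `T + 1` makes both
      -- rows empty in column `c + 1`, so `D (c + 1) = 0` takes over.
      have s1 := h2.step (c + 1)
      have g1 := g.step (T + 1)
      have g2 := g.pos (T + 1) (by omega)
      have m1 := hM.zero_or_one (c + 1) (T + 1)
      simp only [dual, add_sub_cancel_right, sub_add_cancel] at *
      refine ⟨_, c + 1, ⟨hst, ?_, fun u => ?_, fun u hu => ?_⟩, Or.inr (Or.inl ⟨rfl, hb⟩)⟩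
      · have := (orb_zero_or_one e l U a (c + 1) T).resolve_right
          (fun h => by have := (o2 _).1 h; omega)
        rw [o1, this]; omega
      · have := h2.nonneg u
        have := orb_zero_or_one e l U a u T
        rw [o1]; omega
      · have h5 := o2 u
        have := orb_zero_or_one e l U a u T
        have := h2.nonneg u
        by_cases huc : u = c
        · have := h5.2 huc
          rw [o1]; omega
        · have := h2.pos u (by omega)
          rw [o1]; omega
    · have hb' := (orb_zero_or_one e l U a c T).resolve_right hb
      have hd : orb e l U a c (T + 1) = 0 := o1 _
      refine ⟨_, c, ⟨hst, ?_, fun u => ?_, fun u hu => ?_⟩, Or.inl ⟨rfl, hb', o1 _⟩⟩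
      · rw [o1, hb']; omega
      · have := h2.nonneg u
        have := orb_zero_or_one e l U a u T
        rw [o1]; omega
      · have := h2.pos u hu
        have := orb_zero_or_one e l U a u T
        rw [o1]; omega


/-- The effect of a raising move in the columns on a lowering certificate of the rows. -/
theorem Lowers.after_raise {e l U a T c : ℤ} (hl : 2 ≤ l) {M N : ℤ → ℤ → ℤ}
    (hM : IsBits e l M) {Δ D : ℤ → ℤ} (h1 : Raises (M U) (M (U + 1)) Δ a)
    (h2 : Lowers (dual M T) (dual M (T + 1)) D c) (hN : Moves e l U a N M) :
    ∃ D' c', Lowers (dual N T) (dual N (T + 1)) D' c' ∧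
      ((c' = c ∧ orb e l U a c T = 0 ∧ orb e l U a (c - 1) (T + 1) = 0) ∨
        (c' = c + 1 ∧ orb e l U a c T = 1) ∨
        (c' = c - 1 ∧ orb e l U a (c - 1) (T + 1) = 1)) := by
  have hst : ∀ u, (D u - orb e l U a u T + orb e l U a u (T + 1)) -
      (D (u - 1) - orb e l U a (u - 1) T + orb e l U a (u - 1) (T + 1)) =
      dual N T u - dual N (T + 1) u := by
    intro u
    have h1 := h2.step u
    have h2 := hN u T
    have h3 := hN u (T + 1)
    have h4 := orb_add e l U a (u - 1) T 1 0
    have h5 := orb_add e l U a (u - 1) (T + 1) 1 0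
    simp only [sub_add_cancel, add_zero] at h4 h5
    unfold dual at *
    omega
  obtain ⟨r1, r2, r3⟩ := h2.bits (hM.dual.zero_or_one _ _) (hM.dual.zero_or_one _ _)
  have hz := h2.zero
  -- For a raising move the correction has the opposite sign: a bead in row `T` now lowers the
  -- potential and one in row `T + 1` raises it.
  by_cases hx : ∃ u₀, orb e l U a u₀ T = 1
  · obtain ⟨v, hv⟩ := hx
    obtain ⟨Δ', g⟩ := h1.translate hM hv
    obtain ⟨b1, b2, b3⟩ := g.bits (hM.zero_or_one _ _) (hM.zero_or_one _ _)
    have o1 : ∀ u, orb e l U a u (T + 1) = 0 := fun u => by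
      rw [orb_congr hv]; exact orb_next_row hl (by omega)
    have o2 : ∀ u, orb e l U a u T = 1 ↔ u = v := fun u => by
      rw [orb_congr hv]; exact orb_same_row hl
    have o3 : ∀ u, u ≠ v → orb e l U a u T = 0 := fun u hu =>
      (orb_zero_or_one e l U a u T).resolve_right (fun h => hu ((o2 u).1 h))
    have s1 := h2.step v
    have s2 := h2.step (v + 1)
    have g1 := g.step (T + 1)
    have g2 := g.zero
    have g3 := g.nonneg (T + 1)
    simp only [dual, add_sub_cancel_right] at *
    have m1 := hM.zero_or_one v (T + 1)
    have m2 := hM.zero_or_one (v + 1) (T + 1)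
    have hvc : v ≠ c - 1 := by
      rintro rfl
      simp only [sub_add_cancel] at *
      omega
    by_cases hc : v = c
    · subst hc
      refine ⟨_, v + 1, ⟨hst, ?_, fun u => ?_, fun u hu => ?_⟩, Or.inr (Or.inl ⟨rfl, hv⟩)⟩
      · rw [add_sub_cancel_right, o1, hv]; omega
      · by_cases hu : u = v
        · subst hu; rw [o1, hv]; omega
        · have := h2.nonneg u; rw [o1, o3 u hu]; omega
      · have := h2.pos u (by omega); rw [o1, o3 u (by omega)]; omega
    · refine ⟨_, c, ⟨hst, ?_, fun u => ?_, fun u hu => ?_⟩,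
        Or.inl ⟨rfl, o3 _ (Ne.symm hc), o1 _⟩⟩
      · rw [o1, o3 _ (Ne.symm hvc)]; omega
      · by_cases hu : u = v
        · subst hu
          have n1 := h2.nonneg (u - 1)
          have n2 := h2.nonneg (u + 1)
          rw [o1, hv]; omega
        · have := h2.nonneg u; rw [o1, o3 u hu]; omega
      · by_cases huv : u = v
        · subst huv
          have n1 := h2.pos (u - 1) (by omega)
          have n2 := h2.pos (u + 1) (by omega)
          rw [o1, hv]; omega
        · have := h2.pos u hu; rw [o1, o3 u huv]; omega
  · have o1 : ∀ u, orb e l U a u T = 0 := fun u =>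
      (orb_zero_or_one e l U a u T).resolve_right (fun h => hx ⟨u, h⟩)
    by_cases hb : orb e l U a (c - 1) (T + 1) = 1
    · obtain ⟨Δ', g⟩ := h1.translate hM hb
      obtain ⟨b1, b2, b3⟩ := g.bits (hM.zero_or_one _ _) (hM.zero_or_one _ _)
      have o2 : ∀ u, orb e l U a u (T + 1) = 1 ↔ u = c - 1 := fun u => by
        rw [orb_congr hb]; exact orb_same_row hl
      have s1 := h2.step (c - 1)
      have g1 := g.step T
      have g2 := g.pos (T - 1) (by omega)
      have m1 := hM.zero_or_one (c - 1) T
      simp only [dual, add_sub_cancel_right, sub_add_cancel] at *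
      refine ⟨_, c - 1, ⟨hst, ?_, fun u => ?_, fun u hu => ?_⟩, Or.inr (Or.inr ⟨rfl, hb⟩)⟩
      · have := (orb_zero_or_one e l U a (c - 1 - 1) (T + 1)).resolve_right
          (fun h => by have := (o2 _).1 h; omega)
        rw [o1, this]; omega
      · have := h2.nonneg u
        have := orb_zero_or_one e l U a u (T + 1)
        rw [o1]; omega
      · have h5 := o2 u
        have := orb_zero_or_one e l U a u (T + 1)
        have := h2.nonneg u
        by_cases huc : u = c - 1
        · have := h5.2 huc
          rw [o1]; omega
        · have := h2.pos u (by omega)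
          rw [o1]; omega
    · have hb' := (orb_zero_or_one e l U a (c - 1) (T + 1)).resolve_right hb
      refine ⟨_, c, ⟨hst, ?_, fun u => ?_, fun u hu => ?_⟩, Or.inl ⟨rfl, o1 _, hb'⟩⟩
      · rw [o1, hb']; omega
      · have := h2.nonneg u
        have := orb_zero_or_one e l U a u (T + 1)
        rw [o1]; omega
      · have := h2.pos u hu
        have := orb_zero_or_one e l U a u (T + 1)
        rw [o1]; omega

/-- Row differences within orbits are multiples of `l ≥ 2`, so two of them cannot add up to `1` or
`-1`. This discards incompatible cases in the commuting squares. -/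
theorem orb_not_both {e l u t u' t' v s v' s' : ℤ} (hl : 2 ≤ l)
    (h : t' - t + (s' - s) = 1 ∨ t' - t + (s' - s) = -1)
    (h1 : orb e l u t u' t' = 1) (h2 : orb e l v s v' s' = 1) : False := by
  obtain ⟨m, -, h3⟩ := orb_eq_one.1 h1
  obtain ⟨n, -, h4⟩ := orb_eq_one.1 h2
  have h5 := orb_next_row (e := e) (l := l) (u := 0) (t := 0) (u' := (m + n) * e)
    (t' := (m + n) * l) hl (by rw [add_mul]; omega)
  rw [orb_eq_one.2 ⟨m + n, by ring, by ring⟩] at h5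
  omega

theorem orb_same_col {e l u t t' : ℤ} (he : 2 ≤ e) : orb e l u t u t' = 1 ↔ t' = t := by
  rw [← orb_swap]; exact orb_same_row he

theorem orb_next_col {e l u t u' t' : ℤ} (he : 2 ≤ e) (h : u' = u + 1 ∨ u' = u - 1) :
    orb e l u t u' t' = 0 := by
  rw [← orb_swap]; exact orb_next_row he h

theorem Moves.col {e l U a : ℤ} (he : 2 ≤ e) {M N : ℤ → ℤ → ℤ} (h : Moves e l U a M N) (t : ℤ) :
    N U t = M U t - orb e l U a U t := by
  rw [h U t, orb_next_col (u := U + 1) he (by omega)]; ring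

theorem Moves.next_col {e l U a : ℤ} (he : 2 ≤ e) {M N : ℤ → ℤ → ℤ} (h : Moves e l U a M N)
    (t : ℤ) : N (U + 1) t = M (U + 1) t + orb e l U a U t := by
  rw [h (U + 1) t, orb_next_col (u := U) he (by omega)]
  have := orb_add e l U a U t 1 0
  simp only [add_zero] at this
  rw [this]; ring

theorem Lowers.raises {e l U a : ℤ} (he : 2 ≤ e) {M N : ℤ → ℤ → ℤ} {D : ℤ → ℤ}
    (h : Lowers (M U) (M (U + 1)) D a) (hb : M U a - M (U + 1) a = 1) (hN : Moves e l U a M N) :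
    ∃ D', Raises (N U) (N (U + 1)) D' a := by
  have hz := h.zero
  have h1 := h.step a
  -- The move decreases the step at `a` by two. Splitting this evenly turns the last zero at `a - 1`
  -- into a first zero at `a`.
  refine ⟨fun t => if t < a then D t + 1 else D t - 1, ⟨fun t => ?_, ?_, fun t => ?_,
    fun t ht => ?_⟩⟩
  · have h2 := h.step t
    have h3 := hN.col he t
    have h4 := hN.next_col he t
    have h5 := orb_same_col (e := e) (l := l) (u := U) (t := a) (t' := t) he
    have h6 := orb_zero_or_one e l U a U t
    rcases lt_trichotomy t a with ht | rfl | ht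
    · simp only [ht, show t - 1 < a by omega, if_true]; omega
    · simp only [lt_irrefl, show t - 1 < t by omega, if_true, if_false]; omega
    · simp only [not_lt.2 ht.le, show ¬ t - 1 < a by omega, if_false]; omega
  · simp only [lt_irrefl, if_false]; omega
  · have := h.nonneg t
    by_cases ht : t < a
    · simp only [ht, if_true]; omega
    · have := h.pos t (by omega)
      simp only [ht, if_false]; omega
  · have := h.nonneg t
    simp only [ht, if_true]; omega

theorem Raises.lowers {e l U a : ℤ} (he : 2 ≤ e) {M N : ℤ → ℤ → ℤ} {D : ℤ → ℤ}
    (h : Raises (M U) (M (U + 1)) D a) (hb : M (U + 1) a - M U a = 1) (hN : Moves e l U a N M) :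
    ∃ D', Lowers (N U) (N (U + 1)) D' a := by
  have hz := h.zero
  have h1 := h.step a
  refine ⟨fun t => if t < a then D t - 1 else D t + 1, ⟨fun t => ?_, ?_, fun t => ?_,
    fun t ht => ?_⟩⟩
  · have h2 := h.step t
    have h3 := hN.col he t
    have h4 := hN.next_col he t
    have h5 := orb_same_col (e := e) (l := l) (u := U) (t := a) (t' := t) he
    have h6 := orb_zero_or_one e l U a U t
    rcases lt_trichotomy t a with ht | rfl | ht
    · simp only [ht, show t - 1 < a by omega, if_true]; omega
    · simp only [lt_irrefl, show t - 1 < t by omega, if_true, if_false]; omega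
    · simp only [not_lt.2 ht.le, show ¬ t - 1 < a by omega, if_false]; omega
  · simp only [show a - 1 < a by omega, if_true]; omega
  · have := h.nonneg t
    by_cases ht : t < a
    · have := h.pos t (by omega)
      simp only [ht, if_true]; omega
    · simp only [ht, if_false]; omega
  · have := h.nonneg t
    simp only [not_lt.2 ht, if_false]; omega

theorem Moves.isBits {e l U a : ℤ} {M N : ℤ → ℤ → ℤ} (hM : IsBits e l M)
    (h0 : M U a = 1) (h1 : M (U + 1) a = 0) (hN : Moves e l U a M N) : IsBits e l N := by
  refine ⟨fun u t => ?_, fun u t => ?_⟩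
  · have := hN u t
    have := hM.zero_or_one u t
    rcases orb_zero_or_one e l U a u t with h2 | h2 <;>
    rcases orb_zero_or_one e l (U + 1) a u t with h3 | h3
    · omega
    · have := hM.orb_eq h3; omega
    · have := hM.orb_eq h2; omega
    · have := hM.orb_eq h2; have := hM.orb_eq h3; omega
  · rw [hN, hN, hM.period, orb_period, orb_period]

theorem Moves.isBits_left {e l U a : ℤ} {M N : ℤ → ℤ → ℤ} (hM : IsBits e l M)
    (h0 : M U a = 0) (h1 : M (U + 1) a = 1) (hN : Moves e l U a N M) : IsBits e l N := by
  refine ⟨fun u t => ?_, fun u t => ?_⟩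
  · have := hN u t
    have := hM.zero_or_one u t
    rcases orb_zero_or_one e l U a u t with h2 | h2 <;>
    rcases orb_zero_or_one e l (U + 1) a u t with h3 | h3
    · omega
    · have := hM.orb_eq h3; omega
    · have := hM.orb_eq h2; omega
    · have := hM.orb_eq h2; have := hM.orb_eq h3; omega
  · have h2 := hN u t
    have h3 := hN (u + e) (t + l)
    rw [hM.period, orb_period, orb_period] at h3
    omega

theorem Arr.isBits {e l U : ℤ} {M N : ℤ → ℤ → ℤ} (hM : IsBits e l M)
    (h : Arr e l U M N) : IsBits e l N := by
  obtain ⟨D, a, h1, h2⟩ := h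
  obtain ⟨b1, b2, -⟩ := h1.bits (hM.zero_or_one _ _) (hM.zero_or_one _ _)
  exact Moves.isBits hM b1 b2 h2

theorem Arr.raises {e l U : ℤ} (he : 2 ≤ e) {M N : ℤ → ℤ → ℤ} (hM : IsBits e l M)
    (h : Arr e l U M N) : ∃ D a, Raises (N U) (N (U + 1)) D a ∧ Moves e l U a M N := by
  obtain ⟨D, a, h1, h2⟩ := h
  obtain ⟨b1, b2, -⟩ := h1.bits (hM.zero_or_one _ _) (hM.zero_or_one _ _)
  obtain ⟨D', h3⟩ := h1.raises he (by omega) h2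
  exact ⟨D', a, h3, h2⟩

theorem arr_of_raises {e l U a : ℤ} (he : 2 ≤ e) {M N : ℤ → ℤ → ℤ} (hN : IsBits e l N)
    {D : ℤ → ℤ} (h : Raises (N U) (N (U + 1)) D a) (hm : Moves e l U a M N) :
    IsBits e l M ∧ Arr e l U M N := by
  obtain ⟨b1, b2, -⟩ := h.bits (hN.zero_or_one _ _) (hN.zero_or_one _ _)
  obtain ⟨D', h3⟩ := h.lowers he (by omega) hm
  exact ⟨Moves.isBits_left hN b1 b2 hm, D', a, h3, hm⟩

/-- Potentials of the same pair of lines differ by a constant, and `a - 1` is the last place where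
the minimum is attained. -/
theorem Lowers.unique {A B D D' : ℤ → ℤ} {a a' : ℤ} (h : Lowers A B D a)
    (h' : Lowers A B D' a') : a = a' := by
  have key : ∀ t, D t - D' t = D 0 - D' 0 := by
    intro t
    induction t using Int.induction_on with
    | zero => rfl
    | succ i ih =>
      have h1 := h.step (i + 1)
      have h2 := h'.step (i + 1)
      simp only [add_sub_cancel_right] at h1 h2
      omega
    | pred i ih =>
      have h1 := h.step (-i)
      have h2 := h'.step (-i)
      omega
  have k1 := key (a - 1)
  have k2 := key (a' - 1)
  have := h.zero
  have := h'.zero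
  have := h.nonneg (a' - 1)
  have := h'.nonneg (a - 1)
  by_contra hne
  rcases lt_or_gt_of_ne hne with hlt | hlt
  · have := h.pos (a' - 1) (by omega); omega
  · have := h'.pos (a - 1) (by omega); omega

theorem Moves.unique {e l U a : ℤ} {M N N' : ℤ → ℤ → ℤ} (h : Moves e l U a M N)
    (h' : Moves e l U a M N') : N = N' := by
  funext u t; rw [h, h']

theorem Arr.functional {e l U : ℤ} {M N N' : ℤ → ℤ → ℤ} (h : Arr e l U M N)
    (h' : Arr e l U M N') : N = N' := by
  obtain ⟨D, a, h1, h2⟩ := h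
  obtain ⟨D', a', h1', h2'⟩ := h'
  obtain rfl := h1.unique h1'
  exact h2.unique h2'

/-- The half-turn. -/
def rev (M : ℤ → ℤ → ℤ) : ℤ → ℤ → ℤ := fun u t => M (-u) (-t)

theorem rev_rev (M : ℤ → ℤ → ℤ) : rev (rev M) = M := by funext u t; simp [rev]

theorem IsBits.rev {e l : ℤ} {M : ℤ → ℤ → ℤ} (h : IsBits e l M) : IsBits e l (rev M) :=
  ⟨fun u t => h.zero_or_one _ _, fun u t => by
    have := h.period (-(u + e)) (-(t + l))
    simp only [HeisenbergCrystal.rev]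
    rw [← this]; congr 1 <;> ring⟩

/-- The half-turn exchanges the two columns and reverses arrows, so statements about raising follow
from statements about lowering. -/
theorem Arr.rev {e l U : ℤ} (he : 2 ≤ e) {M N : ℤ → ℤ → ℤ} (hM : IsBits e l M)
    (h : Arr e l U M N) : Arr e l (-U - 1) (rev N) (rev M) := by
  obtain ⟨D, a, h1, h2⟩ := h.raises he hM
  refine ⟨fun t => D (-t - 1), -a, ⟨fun t => ?_, ?_, fun t => h1.nonneg _,
    fun t ht => h1.pos _ (by omega)⟩, fun u t => ?_⟩
  · have := h1.step (-t)
    simp only [HeisenbergCrystal.rev]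
    rw [show -(t - 1) - 1 = -t by ring, show -(-U - 1) = U + 1 by ring,
      show -(-U - 1 + 1) = U by ring]
    omega
  · rw [← h1.zero]; congr 1; ring
  · have h3 := h2 (-u) (-t)
    have h4 := orb_neg e l U a (-u) (-t)
    have h5 := orb_neg e l (U + 1) a (-u) (-t)
    simp only [neg_neg] at h4 h5
    simp only [HeisenbergCrystal.rev]
    rw [show -U - 1 + 1 = -U by ring, show -U - 1 = -(U + 1) by ring, h4, h5]
    omega

theorem Arr.injective {e l U : ℤ} (he : 2 ≤ e) {M M' N : ℤ → ℤ → ℤ} (hM : IsBits e l M)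
    (hM' : IsBits e l M') (h : Arr e l U M N) (h' : Arr e l U M' N) : M = M' := by
  have := (h.rev he hM).functional (h'.rev he hM')
  rw [← rev_rev M, this, rev_rev]

/-! ### Commuting squares -/

/-- Lowering arrows of the two crystals commute. -/
theorem square_lower_lower {e l U T : ℤ} (he : 2 ≤ e) (hl : 2 ≤ l) {M N P : ℤ → ℤ → ℤ}
    (hM : IsBits e l M) (h1 : Arr e l U M N) (h2 : Arr l e T (dual M) (dual P)) :
    ∃ K, Arr l e T (dual N) (dual K) ∧ Arr e l U P K := by
  obtain ⟨Δ, a, c1, m1⟩ := h1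
  obtain ⟨D, c, c2, m2⟩ := h2
  obtain ⟨D', c', d1, k1⟩ := Lowers.after_lower hl hM c1 c2 m1
  have c1' : Lowers (dual (dual M) U) (dual (dual M) (U + 1)) Δ a := by rwa [dual_dual]
  obtain ⟨Δ', a', d2, k2⟩ := Lowers.after_lower he hM.dual c2 c1' m2
  rw [dual_dual] at d2
  refine ⟨dual (fun t u => dual N t u - orb l e T c' t u + orb l e (T + 1) c' t u),
    ⟨D', c', d1, fun t u => by rw [dual_dual]⟩, Δ', a', d2, fun u t => ?_⟩
  have n1 := m1 u t
  have n2 := m2 t u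
  simp only [orb_swap, dual] at *
  -- The two ways in which the moves can interfere are mirrored in both computations. Either both
  -- move the same bead, and each then moves it from its new place; or both would fill the same
  -- hole, and the second move is displaced by one. The mixed cases contradict the orbit relations.
  rcases k1 with ⟨rfl, x1, x2⟩ | ⟨rfl, x1⟩ | ⟨rfl, x1⟩ <;>
  rcases k2 with ⟨rfl, y1, y2⟩ | ⟨rfl, y1⟩ | ⟨rfl, y1⟩
  · omega
  · rw [← orb_add _ _ _ _ _ _ (-1) 0] at y1
    have := orb_symm y1
    simp only [add_neg_cancel_right, add_zero] at this
    exact absurd (this.symm.trans x2) (by norm_num)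
  · rw [← orb_add _ _ _ _ _ _ 0 1] at y1
    have := orb_symm y1
    simp only [sub_add_cancel, add_zero] at this
    exact absurd (this.symm.trans x1) (by norm_num)
  · have := orb_symm x1
    rw [← orb_add _ _ _ _ _ _ 0 (-1)] at this
    simp only [add_zero, ← sub_eq_add_neg, add_sub_cancel_right] at this
    exact absurd (this.symm.trans y2) (by norm_num)
  · exact (orb_not_both hl (by omega) x1 y1).elim
  · have q1 := orb_congr x1
    have q2 := fun i j => (orb_congr (by rw [orb_add]; exact x1) : ∀ u' t',
      orb e l (U + i) (a + j) u' t' = orb e l (c + i) (T + 1 + j) u' t')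
    have e1 := q1 u t
    have e2 := q2 1 0 u t
    have e3 := q2 0 (-1) u t
    have e4 := q2 1 (-1) u t
    simp only [add_zero, ← sub_eq_add_neg, add_sub_cancel_right] at e2 e3 e4
    omega
  · have := orb_symm x1
    rw [← orb_add _ _ _ _ _ _ 1 0] at this
    simp only [sub_add_cancel, add_zero] at this
    exact absurd (this.symm.trans y1) (by norm_num)
  · have q2 := fun i j => (orb_congr (by rw [orb_add]; exact x1) : ∀ u' t',
      orb e l (U + i) (a + j) u' t' = orb e l (c - 1 + i) (T + j) u' t')
    have e1 := q2 0 0 u t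
    have e2 := q2 1 0 u t
    have e3 := q2 0 1 u t
    have e4 := q2 1 1 u t
    simp only [sub_add_cancel, add_zero] at e1 e2 e3 e4
    omega
  · exact (orb_not_both hl (by omega) x1 y1).elim

/-- The same comparison as for two lowering arrows, with the row arrow followed backwards: a raising
row certificate is carried through the column move, and the lowering column certificate through the
row move. -/
theorem square_lower_raise {e l U T : ℤ} (he : 2 ≤ e) (hl : 2 ≤ l) {M N P : ℤ → ℤ → ℤ}
    (hM : IsBits e l M) (hP : IsBits e l P) (h1 : Arr e l U M N)
    (h2 : Arr l e T (dual P) (dual M)) :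
    ∃ K, IsBits e l K ∧ Arr l e T (dual K) (dual N) ∧ Arr e l U P K := by
  have hN := h1.isBits hM
  obtain ⟨Δ, a, c1, m1⟩ := h1
  obtain ⟨D, c, c2, m2⟩ := h2.raises hl hP.dual
  obtain ⟨D', c', d1, k1⟩ := c2.after_lower hl hM c1 m1
  have c1' : Lowers (dual (dual M) U) (dual (dual M) (U + 1)) Δ a := by rwa [dual_dual]
  obtain ⟨Δ', a', d2, k2⟩ := c1'.after_raise he hM.dual c2 m2
  rw [dual_dual] at d2
  have hK : Moves l e T c' (fun t u => dual N t u + orb l e T c' t u - orb l e (T + 1) c' t u)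
      (dual N) := fun t u => by ring
  obtain ⟨r1, r2⟩ := arr_of_raises hl hN.dual d1 hK
  refine ⟨_, r1.dual, by rw [dual_dual]; exact r2, Δ', a', d2, fun u t => ?_⟩
  have n1 := m1 u t
  have n2 := m2 t u
  simp only [orb_swap, dual] at *
  rcases k1 with ⟨rfl, x1, x2⟩ | ⟨rfl, x1⟩ | ⟨rfl, x1⟩ <;>
  rcases k2 with ⟨rfl, y1, y2⟩ | ⟨rfl, y1⟩ | ⟨rfl, y1⟩
  · omega
  · exact absurd ((orb_symm y1).symm.trans x1) (by norm_num)
  · rw [← orb_add _ _ _ _ _ _ (-1) 1] at y1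
    have := orb_symm y1
    simp only [sub_add_cancel, ← sub_eq_add_neg, add_sub_cancel_right] at this
    exact absurd (this.symm.trans x2) (by norm_num)
  · exact absurd ((orb_symm x1).symm.trans y1) (by norm_num)
  · have q2 := fun i j => (orb_congr (by rw [orb_add]; exact x1) : ∀ u' t',
      orb e l (U + i) (a + j) u' t' = orb e l (c + i) (T + j) u' t')
    have e1 := q2 0 0 u t
    have e2 := q2 1 0 u t
    have e3 := q2 0 1 u t
    have e4 := q2 1 1 u t
    simp only [add_zero] at e1 e2 e3 e4
    omega
  · exact (orb_not_both hl (by omega) x1 y1).elim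
  · have := orb_symm x1
    rw [← orb_add _ _ _ _ _ _ 1 (-1)] at this
    simp only [sub_add_cancel, ← sub_eq_add_neg, add_sub_cancel_right] at this
    exact absurd (this.symm.trans y2) (by norm_num)
  · exact (orb_not_both hl (by omega) x1 y1).elim
  · have q2 := fun i j => (orb_congr (by rw [orb_add]; exact x1) : ∀ u' t',
      orb e l (U + i) (a + j) u' t' = orb e l (c - 1 + i) (T + 1 + j) u' t')
    have e1 := q2 0 0 u t
    have e2 := q2 1 0 u t
    have e3 := q2 0 (-1) u t
    have e4 := q2 1 (-1) u t
    simp only [sub_add_cancel, add_zero, ← sub_eq_add_neg, add_sub_cancel_right] at e1 e2 e3 e4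
    omega

theorem square_raise_lower {e l U T : ℤ} (he : 2 ≤ e) (hl : 2 ≤ l) {M N P : ℤ → ℤ → ℤ}
    (hM : IsBits e l M) (hN : IsBits e l N) (h1 : Arr e l U N M)
    (h2 : Arr l e T (dual M) (dual P)) :
    ∃ K, IsBits e l K ∧ Arr l e T (dual N) (dual K) ∧ Arr e l U K P := by
  have h1' : Arr e l U (dual (dual N)) (dual (dual M)) := by simpa only [dual_dual] using h1
  obtain ⟨K, k0, k1, k2⟩ := square_lower_raise hl he hM.dual hN.dual h2 h1'
  refine ⟨dual K, k0.dual, by rwa [dual_dual], by simpa only [dual_dual] using k1⟩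

/-- The half-turn of the square of two lowering arrows. -/
theorem square_raise_raise {e l U T : ℤ} (he : 2 ≤ e) (hl : 2 ≤ l) {M N P : ℤ → ℤ → ℤ}
    (hM : IsBits e l M) (hN : IsBits e l N) (hP : IsBits e l P) (h1 : Arr e l U N M)
    (h2 : Arr l e T (dual P) (dual M)) :
    ∃ K, IsBits e l K ∧ Arr l e T (dual K) (dual N) ∧ Arr e l U K P := by
  have g1 := h1.rev he hN
  have g2 : Arr l e (-T - 1) (dual (rev M)) (dual (rev P)) := h2.rev hl hP.dual
  obtain ⟨K, k1, k2⟩ := square_lower_lower he hl hM.rev g1 g2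
  have hK := k2.isBits hP.rev
  refine ⟨rev K, hK.rev, ?_, ?_⟩
  · have := k1.rev hl hN.rev.dual
    rw [show - (-T - 1) - 1 = T by ring] at this
    simpa only [show ∀ M, rev (dual M) = dual (rev M) from fun _ => rfl, rev_rev] using this
  · have := k2.rev he hP.rev
    rw [show - (-U - 1) - 1 = U by ring] at this
    simpa only [rev_rev] using this


/-! ### Potentials, bead configurations and the enumeration of the beads of a column -/

theorem exists_potential (g : ℤ → ℤ) : ∃ D : ℤ → ℤ, ∀ t, D t - D (t - 1) = g t := by
  refine ⟨fun t => ∑ i ∈ Finset.Ioc 0 t, g i - ∑ i ∈ Finset.Ioc t 0, g i, fun t => ?_⟩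
  rcases lt_or_ge 0 t with h | h
  · have h1 : Finset.Ioc 0 t = insert t (Finset.Ioc 0 (t - 1)) := by ext; simp; omega
    have h2 : Finset.Ioc t 0 = ∅ := by ext; simp; omega
    have h3 : Finset.Ioc (t - 1) 0 = ∅ := by ext; simp; omega
    simp only [h1, h2, h3]
    rw [Finset.sum_insert (by simp)]; simp
  · have h1 : Finset.Ioc (t - 1) 0 = insert t (Finset.Ioc t 0) := by ext; simp; omega
    have h2 : Finset.Ioc 0 t = ∅ := by ext; simp; omega
    have h3 : Finset.Ioc 0 (t - 1) = ∅ := by ext; simp; omega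
    simp only [h1, h2, h3]
    rw [Finset.sum_insert (by simp)]; simp

theorem potential_sub {D D' : ℤ → ℤ} (h : ∀ t, D t - D (t - 1) = D' t - D' (t - 1)) (t s : ℤ) :
    D t - D' t = D s - D' s := by
  have key : ∀ t, D t - D' t = D 0 - D' 0 := by
    intro t
    induction t using Int.induction_on with
    | zero => rfl
    | succ i ih => have := h (i + 1); simp only [add_sub_cancel_right] at this; omega
    | pred i ih => have := h (-i); omega
  rw [key t, key s]

theorem const_above {D : ℤ → ℤ} {a : ℤ} (h : ∀ t, a < t → D t - D (t - 1) = 0) {t : ℤ}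
    (ht : a ≤ t) : D t = D a := by
  induction t, ht using Int.leInduction with
  | base => rfl
  | succ n hn ih => have := h (n + 1) (by omega); simp only [add_sub_cancel_right] at this; omega

theorem const_between {D : ℤ → ℤ} {a b : ℤ} (h : ∀ t, a < t → t ≤ b → D t - D (t - 1) = 0)
    (hab : a ≤ b) : D b = D a := by
  induction b, hab using Int.leInduction with
  | base => rfl
  | succ n hn ih =>
    have := h (n + 1) (by omega) le_rfl
    simp only [add_sub_cancel_right] at this
    have := ih fun t h1 h2 => h t h1 (by omega)
    omega

theorem const_below {D : ℤ → ℤ} {a : ℤ} (h : ∀ t, t ≤ a → D t - D (t - 1) = 0) {t : ℤ}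
    (ht : t ≤ a) : D t = D a := by
  induction t, ht using Int.leInductionDown with
  | base => rfl
  | pred n hn ih => have := h n hn; omega

/-- A function that is eventually constant on both sides attains its minimum. -/
theorem exists_min {D : ℤ → ℤ} {a b : ℤ} (ha : ∀ t ≤ a, D t = D a) (hb : ∀ t, b ≤ t → D t = D b) :
    ∃ m, ∀ t, D m ≤ D t := by
  obtain ⟨m, -, hm⟩ := Finset.exists_min_image (insert a (insert b (Finset.Icc a b))) D ⟨a, by simp⟩
  refine ⟨m, fun t => ?_⟩
  rcases le_or_gt t a with h | h
  · rw [ha t h]; exact hm a (by simp)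
  · rcases le_or_gt b t with h' | h'
    · rw [hb t h']; exact hm b (by simp)
    · exact hm t (by simp; omega)

theorem exists_first_min {D : ℤ → ℤ} {a b : ℤ} (ha : ∀ t ≤ a, D t = D a)
    (hb : ∀ t, b ≤ t → D t = D b) {x : ℤ} (hx : D x < D a) :
    ∃ m, (∀ t, D m ≤ D t) ∧ ∀ t < m, D m < D t := by
  obtain ⟨m, hm⟩ := exists_min ha hb
  obtain ⟨k, hk, hk'⟩ := Int.exists_least_of_bdd (P := fun t => D t = D m)
    ⟨a, fun z hz => by by_contra hza; have := ha z (by omega); have := hm x; omega⟩ ⟨m, rfl⟩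
  refine ⟨k, fun t => hk ▸ hm t, fun t ht => ?_⟩
  have h1 := hm t
  have h2 : D t ≠ D m := fun h => by have := hk' t h; omega
  omega

theorem exists_last_min {D : ℤ → ℤ} {a b : ℤ} (ha : ∀ t ≤ a, D t = D a)
    (hb : ∀ t, b ≤ t → D t = D b) {x : ℤ} (hx : D x < D b) :
    ∃ m, (∀ t, D m ≤ D t) ∧ ∀ t, m < t → D m < D t := by
  obtain ⟨m, hm⟩ := exists_min ha hb
  obtain ⟨k, hk, hk'⟩ := Int.exists_greatest_of_bdd (P := fun t => D t = D m)
    ⟨b, fun z hz => by by_contra hza; have := hb z (by omega); have := hm x; omega⟩ ⟨m, rfl⟩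
  refine ⟨k, fun t => hk ▸ hm t, fun t ht => ?_⟩
  have h1 := hm t
  have h2 : D t ≠ D m := fun h => by have := hk' t h; omega
  omega

/-- A bead configuration: periodic, with beads far to one side and no beads far to the other
side of the lines in the direction of the period. -/
structure IsConf (e l : ℤ) (M : ℤ → ℤ → ℤ) : Prop extends IsBits e l M where
  bounded : ∃ B, ∀ u t, (l * u + B ≤ e * t → M u t = 1) ∧ (e * t + B ≤ l * u → M u t = 0)

theorem IsConf.dual {e l : ℤ} {M : ℤ → ℤ → ℤ} (h : IsConf e l M) : IsConf l e (dual M) := by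
  obtain ⟨B, hB⟩ := h.bounded
  refine ⟨h.toIsBits.dual, B, fun t u => ⟨fun hq => ?_, fun hq => ?_⟩⟩
  · unfold HeisenbergCrystal.dual; rw [(hB u t).2 hq]; rfl
  · unfold HeisenbergCrystal.dual; rw [(hB u t).1 hq]; rfl

/-- A move only affects two lines parallel to the period, on which `l * u - e * t` is constant;
enlarging the bound passes both. -/
theorem IsConf.of_moves {e l U a : ℤ} {M N : ℤ → ℤ → ℤ} (h : IsConf e l M) (hN : IsBits e l N)
    (hm : Moves e l U a M N ∨ Moves e l U a N M) : IsConf e l N := by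
  obtain ⟨B, hB⟩ := h.bounded
  have ho : ∀ u v t, (l * v - e * a + 1 ≤ e * t - l * u + 2 * (l * v - e * a) ∨
      l * u - e * t ≠ l * v - e * a) → l * u - e * t ≠ l * v - e * a →
      orb e l v a u t = 0 := by
    intro u v t _ hne
    refine (orb_zero_or_one ..).resolve_right fun h1 => hne ?_
    obtain ⟨m, rfl, rfl⟩ := orb_eq_one.1 h1
    ring
  have key : ∀ u t, l * u - e * t ≠ l * U - e * a → l * u - e * t ≠ l * (U + 1) - e * a →
      N u t = M u t := by
    intro u t h1 h2
    have o1 := ho u U t (Or.inr h1) h1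
    have o2 := ho u (U + 1) t (Or.inr h2) h2
    rcases hm with hm | hm
    · have := hm u t; omega
    · have := hm u t; omega
  refine ⟨hN, |B| + |l * U - e * a| + |l * (U + 1) - e * a| + 1, fun u t => ?_⟩
  have a1 := le_abs_self B
  have a2 := abs_nonneg (l * U - e * a)
  have a3 := le_abs_self (l * U - e * a)
  have a4 := neg_abs_le (l * U - e * a)
  have a5 := abs_nonneg (l * (U + 1) - e * a)
  have a6 := le_abs_self (l * (U + 1) - e * a)
  have a7 := neg_abs_le (l * (U + 1) - e * a)
  have a8 := abs_nonneg B
  constructor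
  · intro hq
    rw [key u t (by intro h; linarith) (by intro h; linarith)]
    exact (hB u t).1 (by linarith)
  · intro hq
    rw [key u t (by intro h; linarith) (by intro h; linarith)]
    exact (hB u t).2 (by linarith)

theorem Arr.isConf {e l U : ℤ} {M N : ℤ → ℤ → ℤ} (h : Arr e l U M N) (hM : IsConf e l M) :
    IsConf e l N := by
  have hN := h.isBits hM.toIsBits
  obtain ⟨D, a, -, hm⟩ := h
  exact hM.of_moves hN (Or.inl hm)

theorem IsConf.col_zero {e l : ℤ} (he : 2 ≤ e) {M : ℤ → ℤ → ℤ} (h : IsConf e l M) (u : ℤ) :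
    ∃ t₀, ∀ t ≤ t₀, M u t = 0 := by
  obtain ⟨B, hB⟩ := h.bounded
  refine ⟨-|l * u - B|, fun t ht => (hB u t).2 ?_⟩
  have := neg_abs_le (l * u - B)
  nlinarith [abs_nonneg (l * u - B)]

theorem IsConf.col_one {e l : ℤ} (he : 2 ≤ e) {M : ℤ → ℤ → ℤ} (h : IsConf e l M) (u : ℤ) :
    ∃ t₁, ∀ t, t₁ ≤ t → M u t = 1 := by
  obtain ⟨B, hB⟩ := h.bounded
  refine ⟨|l * u + B|, fun t ht => (hB u t).1 ?_⟩
  have := le_abs_self (l * u + B)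
  nlinarith [abs_nonneg (l * u + B)]

/-- `τ k u` is the position of the `k`-th bead of the column `u`. -/
structure IsEnum (M : ℤ → ℤ → ℤ) (τ : ℕ → ℤ → ℤ) : Prop where
  strictMono : ∀ u, StrictMono fun k => τ k u
  mem : ∀ u t, M u t = 1 ↔ ∃ k, τ k u = t

theorem IsEnum.unique {M : ℤ → ℤ → ℤ} {τ τ' : ℕ → ℤ → ℤ} (h : IsEnum M τ) (h' : IsEnum M τ') :
    τ = τ' := by
  have key : ∀ u, (fun k => τ k u) = fun k => τ' k u := fun u => by
    refine ((h.strictMono u).range_inj (h'.strictMono u)).1 ?_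
    ext t
    simp only [Set.mem_range]
    rw [← h.mem, ← h'.mem]
  funext k u
  exact congrFun (key u) k

theorem IsEnum.bits_unique {e l e' l' : ℤ} {M M' : ℤ → ℤ → ℤ} {τ : ℕ → ℤ → ℤ} (hM : IsBits e l M)
    (hM' : IsBits e' l' M') (h : IsEnum M τ) (h' : IsEnum M' τ) : M = M' := by
  funext u t
  have h1 := h.mem u t
  rw [← h'.mem u t] at h1
  have := hM.zero_or_one u t
  have := hM'.zero_or_one u t
  omega

theorem IsEnum.one {M : ℤ → ℤ → ℤ} {τ : ℕ → ℤ → ℤ} (h : IsEnum M τ) (k : ℕ) (u : ℤ) :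
    M u (τ k u) = 1 := (h.mem u _).2 ⟨k, rfl⟩

theorem IsEnum.lt_iff {M : ℤ → ℤ → ℤ} {τ : ℕ → ℤ → ℤ} (h : IsEnum M τ) {j k : ℕ} {u : ℤ} :
    τ j u < τ k u ↔ j < k := (h.strictMono u).lt_iff_lt

theorem IsEnum.le_iff {M : ℤ → ℤ → ℤ} {τ : ℕ → ℤ → ℤ} (h : IsEnum M τ) {j k : ℕ} {u : ℤ} :
    τ j u ≤ τ k u ↔ j ≤ k := (h.strictMono u).le_iff_le

theorem IsConf.exists_enum {e l : ℤ} (he : 2 ≤ e) {M : ℤ → ℤ → ℤ} (h : IsConf e l M) :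
    ∃ τ, IsEnum M τ := by
  choose t₀ h₀ using h.col_zero he
  choose t₁ h₁ using h.col_one he
  have hinf : ∀ u, {n : ℕ | M u (t₀ u + n) = 1}.Infinite := by
    intro u
    refine Set.infinite_of_not_bddAbove fun ⟨b, hb⟩ => ?_
    have : (b + 1 + (t₁ u - t₀ u).toNat : ℕ) ≤ b :=
      hb (h₁ u _ (by push_cast; have := Int.self_le_toNat (t₁ u - t₀ u); omega))
    omega
  refine ⟨fun k u => t₀ u + Nat.nth (fun n : ℕ => M u (t₀ u + n) = 1) k, fun u j k hjk => ?_,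
    fun u t => ⟨fun ht => ?_, ?_⟩⟩
  · have := Nat.nth_strictMono (hinf u) hjk
    simp only
    omega
  · have htt : t₀ u < t := by
      by_contra hc
      have := h₀ u t (by omega)
      omega
    have : (t - t₀ u).toNat ∈ Set.range (Nat.nth (fun n : ℕ => M u (t₀ u + n) = 1)) := by
      rw [Nat.range_nth_of_infinite (hinf u)]
      simp only [Set.mem_ofPred_eq]
      rw [Int.toNat_of_nonneg (by omega)]
      simpa using ht
    obtain ⟨k, hk⟩ := this
    exact ⟨k, by simp only [hk]; omega⟩
  · rintro ⟨k, rfl⟩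
    exact Nat.nth_mem_of_infinite (hinf u) k

theorem IsEnum.period {e l : ℤ} {M : ℤ → ℤ → ℤ} {τ : ℕ → ℤ → ℤ} (hM : IsBits e l M)
    (h : IsEnum M τ) (k : ℕ) (u : ℤ) : τ k (u + e) = τ k u + l := by
  have h' : IsEnum M (fun k u => τ k (u + e) - l) := by
    refine ⟨fun u j k hjk => ?_, fun u t => ?_⟩
    · have := h.strictMono (u + e) hjk
      simp only at *
      omega
    · rw [← hM.period, h.mem]
      constructor <;> rintro ⟨k, hk⟩ <;> exact ⟨k, by omega⟩
  have := congrFun (congrFun (h.unique h') k) u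
  omega

theorem IsEnum.period_mul {e l : ℤ} {M : ℤ → ℤ → ℤ} {τ : ℕ → ℤ → ℤ} (hM : IsBits e l M)
    (h : IsEnum M τ) (k : ℕ) (u m : ℤ) : τ k (u + m * e) = τ k u + m * l := by
  induction m using Int.induction_on with
  | zero => simp
  | succ i ih =>
    have := h.period hM k (u + i * e)
    rw [show u + (i + 1) * e = u + i * e + e by ring, this, ih]; ring
  | pred i ih =>
    have := h.period hM k (u + (-(i : ℤ) - 1) * e)
    rw [show u + (-(i : ℤ) - 1) * e + e = u + -(i : ℤ) * e by ring, ih] at this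
    linarith

/-- Counting the beads of a column: `n t` is the number of beads up to `t`. -/
theorem IsEnum.count {M : ℤ → ℤ → ℤ} {τ : ℕ → ℤ → ℤ} (h : IsEnum M τ) {u : ℤ}
    (hb : ∀ t, M u t = 0 ∨ M u t = 1) {n : ℤ → ℤ} (hn : ∀ t, n t - n (t - 1) = M u t) {t₀ : ℤ}
    (h0 : n t₀ = 0) (ht₀ : ∀ t ≤ t₀, M u t = 0) (k : ℕ) (t : ℤ) : (k : ℤ) < n t ↔ τ k u ≤ t := by
  have hmono : Monotone n := by
    refine monotone_int_of_le_succ fun t => ?_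
    have := hn (t + 1)
    have := hb (t + 1)
    simp only [add_sub_cancel_right] at *
    omega
  have hτ : ∀ k, t₀ < τ k u := fun k => by
    by_contra hc
    have := ht₀ _ (not_lt.1 hc)
    have := h.one k u
    omega
  have key : ∀ k, n (τ k u - 1) = k := by
    intro k
    induction k with
    | zero =>
      rw [const_between (D := n) (a := t₀) (fun t ht ht' => ?_) (by have := hτ 0; omega)]
      · simpa using h0
      · rw [hn]
        refine (hb t).resolve_right fun h2 => ?_
        obtain ⟨j, hj⟩ := (h.mem u t).1 h2
        have := (h.le_iff (u := u)).2 (Nat.zero_le j)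
        omega
    | succ k ih =>
      have hlt := (h.lt_iff (u := u)).2 (Nat.lt_add_one k)
      have h3 := hn (τ k u)
      rw [h.one] at h3
      have h4 := const_between (D := n) (a := τ k u) (b := τ (k + 1) u - 1) (fun t ht ht' => ?_)
        (by omega)
      · push_cast
        omega
      · rw [hn]
        refine (hb t).resolve_right fun h2 => ?_
        obtain ⟨j, rfl⟩ := (h.mem u t).1 h2
        have h5 := h.lt_iff.1 ht
        have h6 := h.lt_iff.1 (show τ j u < τ (k + 1) u by omega)
        omega
  constructor
  · intro hk
    by_contra hc
    have := hmono (show t ≤ τ k u - 1 by omega)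
    rw [key] at this
    omega
  · intro hk
    have h1 := hmono hk
    have h2 := hn (τ k u)
    rw [h.one, key] at h2
    omega

/-- A source of the crystal of the columns. -/
def IsHighest (e l : ℤ) (M : ℤ → ℤ → ℤ) : Prop := ∀ U K, IsConf e l K → ¬ Arr e l U K M

theorem IsConf.exists_count {e l : ℤ} (he : 2 ≤ e) {M : ℤ → ℤ → ℤ} (h : IsConf e l M) (u : ℤ) :
    ∃ (n : ℤ → ℤ) (t₀ : ℤ), (∀ t, n t - n (t - 1) = M u t) ∧ (∀ t ≤ t₀, n t = 0) ∧
      ∀ t ≤ t₀, M u t = 0 := by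
  obtain ⟨t₀, h₀⟩ := h.col_zero he u
  obtain ⟨D, hD⟩ := exists_potential (M u)
  refine ⟨fun t => D t - D t₀, t₀, fun t => by rw [← hD]; ring, fun t ht => ?_, h₀⟩
  have := const_below (D := D) (a := t₀) (fun t ht => by rw [hD, h₀ t ht]) ht
  simp [this]

/-- Let `n - n'` be the difference of the bead counts of columns `U` and `U + 1`. A bead can be
moved back exactly when this difference takes a negative value, at its first minimum. It is
nonnegative everywhere exactly when each bead of column `U` lies no higher than the bead of the same
index in column `U + 1`. -/
theorem isHighest_iff {e l : ℤ} (he : 2 ≤ e) {M : ℤ → ℤ → ℤ} (hM : IsConf e l M)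
    {τ : ℕ → ℤ → ℤ} (h : IsEnum M τ) : IsHighest e l M ↔ ∀ k, Monotone (τ k) := by
  constructor
  · intro hh k
    refine monotone_int_of_le_succ fun u => ?_
    obtain ⟨n, a, n1, n2, n3⟩ := hM.exists_count he u
    obtain ⟨n', a', n1', n2', n3'⟩ := hM.exists_count he (u + 1)
    have hst : ∀ t, (n t - n' t) - (n (t - 1) - n' (t - 1)) = M u t - M (u + 1) t := fun t => by
      rw [← n1, ← n1']; ring
    by_contra hc
    have c1 := h.count (hM.zero_or_one u) n1 (n2 a le_rfl) n3 k (τ k (u + 1))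
    have c2 := h.count (hM.zero_or_one (u + 1)) n1' (n2' a' le_rfl) n3' k (τ k (u + 1))
    -- At this height column `u + 1` has reached its `k`-th bead and column `u` has not.
    have hx : n (τ k (u + 1)) - n' (τ k (u + 1)) < 0 := by
      have := c2.2 le_rfl
      have := fun h => hc (c1.1 h)
      omega
    have k0 : n (min a a') - n' (min a a') = 0 := by
      rw [n2 _ (min_le_left _ _), n2' _ (min_le_right _ _)]; rfl
    obtain ⟨b, hb⟩ := hM.col_one he u
    obtain ⟨b', hb'⟩ := hM.col_one he (u + 1)
    obtain ⟨m, hm1, hm2⟩ := exists_first_min (D := fun t => n t - n' t) (a := min a a')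
      (b := max b b') (x := τ k (u + 1))
      (fun t ht => by
        simp only [k0]
        rw [n2 _ (ht.trans (min_le_left _ _)), n2' _ (ht.trans (min_le_right _ _))]; rfl)
      (fun t ht => const_above (D := fun t => n t - n' t) (fun s hs => by
        rw [hst, hb s (le_trans (le_max_left _ _) hs.le), hb' s (le_trans (le_max_right _ _) hs.le)]
        rfl) ht)
      (by simp only [k0]; exact hx)
    have hr : Raises (M u) (M (u + 1)) (fun t => (n t - n' t) - (n m - n' m)) m :=
      ⟨fun t => by rw [← hst]; ring, by ring, fun t => by have := hm1 t; omega,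
        fun t ht => by have := hm2 t ht; omega⟩
    obtain ⟨b1, b2⟩ := arr_of_raises (e := e) (l := l) he hM.toIsBits hr
      (M := fun x t => M x t + orb e l u m x t - orb e l (u + 1) m x t) (fun x t => by ring)
    exact hh u _ (hM.of_moves (U := u) (a := m) b1 (Or.inr fun x t => by ring)) b2
  · intro hmono U K hK harr
    obtain ⟨D, a, hr, -⟩ := harr.raises he hK.toIsBits
    obtain ⟨n, b, n1, n2, n3⟩ := hM.exists_count he U
    obtain ⟨n', b', n1', n2', n3'⟩ := hM.exists_count he (U + 1)
    have c1 := h.count (hM.zero_or_one U) n1 (n2 b le_rfl) n3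
    have c2 := h.count (hM.zero_or_one (U + 1)) n1' (n2' b' le_rfl) n3'
    have hle : ∀ t, n' t ≤ n t := by
      intro t
      by_contra hc
      have hn0 : 0 ≤ n t := by
        by_contra hneg
        have hmon : Monotone n := by
          refine monotone_int_of_le_succ fun t => ?_
          have := n1 (t + 1)
          have := hM.zero_or_one U (t + 1)
          simp only [add_sub_cancel_right] at *
          omega
        have := n2 (min t b) (min_le_right _ _)
        have := hmon (min_le_left t b)
        omega
      have h1 := c1 (n t).toNat t
      have h2 := c2 (n t).toNat t
      rw [Int.toNat_of_nonneg hn0] at h1 h2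
      have h3 := h2.1 (by omega)
      have h4 := hmono (n t).toNat (show U ≤ U + 1 by omega)
      have h5 := h1.2 (h4.trans h3)
      omega
    -- The certificate is positive far down, where no beads are counted, and zero at `a`; so the
    -- difference of the counts would be negative at `a`.
    have hs := potential_sub (D := D) (D' := fun t => n t - n' t)
      (fun t => by rw [hr.step, ← n1, ← n1']; ring) a (min (a - 1) (min b b'))
    have h1 := hr.pos (min (a - 1) (min b b')) (by omega)
    have h2 := n2 (min (a - 1) (min b b')) (by omega)
    have h3 := n2' (min (a - 1) (min b b')) (by omega)
    have h4 := hle a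
    have h5 := hr.zero
    omega


/-! ### Shifting the first layers of a column source -/

/-- The enumeration in which the beads with index at most `n` are moved one column to the right. -/
def shiftEnum (n : ℕ) (τ : ℕ → ℤ → ℤ) : ℕ → ℤ → ℤ := fun k u => if k ≤ n then τ k (u - 1) else τ k u

/-- `M'` is obtained from the configuration `M`, whose columns are interlaced, by moving the beads
with index at most `n` one column to the right. -/
structure IsShift (n : ℕ) (M M' : ℤ → ℤ → ℤ) (τ : ℕ → ℤ → ℤ) : Prop where
  enum : IsEnum M τ
  mono : ∀ k, Monotone (τ k)
  enum' : IsEnum M' (shiftEnum n τ)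

/-- The path `u ↦ τ n u` cuts the plane. In column `u` the shifted configuration agrees with column
`u` of `M` for `t > τ n u`, agrees with column `u - 1` for `t ≤ τ n (u - 1)`, and is empty in
between. This lemma and the next two record the three regions. -/
theorem IsShift.below {n : ℕ} {M M' : ℤ → ℤ → ℤ} {τ : ℕ → ℤ → ℤ} (h : IsShift n M M' τ) {u t : ℤ}
    (ht : τ n u < t) : M' u t = 1 ↔ M u t = 1 := by
  rw [h.enum'.mem, h.enum.mem]
  simp only [shiftEnum]
  constructor
  · rintro ⟨k, hk⟩
    split_ifs at hk with hkn
    · have := h.enum.le_iff (u := u - 1) |>.2 hkn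
      have := h.mono n (show u - 1 ≤ u by omega)
      omega
    · exact ⟨k, hk⟩
  · rintro ⟨k, hk⟩
    refine ⟨k, ?_⟩
    rw [if_neg fun hkn => ?_, hk]
    have := h.enum.le_iff (u := u) |>.2 hkn
    omega

theorem IsShift.above {n : ℕ} {M M' : ℤ → ℤ → ℤ} {τ : ℕ → ℤ → ℤ} (h : IsShift n M M' τ) {u t : ℤ}
    (ht : t ≤ τ n (u - 1)) : M' u t = 1 ↔ M (u - 1) t = 1 := by
  rw [h.enum'.mem, h.enum.mem]
  simp only [shiftEnum]
  constructor
  · rintro ⟨k, hk⟩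
    split_ifs at hk with hkn
    · exact ⟨k, hk⟩
    · have := h.enum.lt_iff (u := u) |>.2 (not_le.1 hkn)
      have := h.mono n (show u - 1 ≤ u by omega)
      omega
  · rintro ⟨k, hk⟩
    refine ⟨k, ?_⟩
    rw [if_pos, hk]
    exact h.enum.le_iff (u := u - 1) |>.1 (by omega)

theorem IsShift.between {n : ℕ} {M M' : ℤ → ℤ → ℤ} {τ : ℕ → ℤ → ℤ} (h : IsShift n M M' τ) {u t : ℤ}
    (ht : τ n (u - 1) < t) (ht' : t ≤ τ n u) : M' u t ≠ 1 := by
  rw [Ne, h.enum'.mem]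
  simp only [shiftEnum]
  rintro ⟨k, hk⟩
  split_ifs at hk with hkn
  · have := h.enum.le_iff (u := u - 1) |>.2 hkn
    omega
  · have := h.enum.lt_iff (u := u) |>.2 (not_le.1 hkn)
    omega

theorem eq_of_one_iff {x y : ℤ} (hx : x = 0 ∨ x = 1) (hy : y = 0 ∨ y = 1) (h : x = 1 ↔ y = 1) :
    x = y := by omega

/-- The potential of two rows of a shifted configuration. -/
theorem IsShift.potential {e l e' l' : ℤ} {n : ℕ} {M M' : ℤ → ℤ → ℤ} {τ : ℕ → ℤ → ℤ}
    (h : IsShift n M M' τ) (hM : IsBits e l M) (hM' : IsBits e' l' M') {D : ℤ → ℤ} {T : ℤ}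
    (hD : ∀ u, D u - D (u - 1) = dual M T u - dual M (T + 1) u) (u : ℤ) :
    (if τ n u < T then D u else if τ n u = T then D u + 1 else D (u - 1)) -
      (if τ n (u - 1) < T then D (u - 1) else if τ n (u - 1) = T then D (u - 1) + 1
        else D (u - 1 - 1)) = dual M' T u - dual M' (T + 1) u := by
  have d1 := hD u
  have d2 := hD (u - 1)
  have hm := h.mono n (show u - 1 ≤ u by omega)
  have p := fun t ht => eq_of_one_iff (hM'.zero_or_one u t) (hM.zero_or_one u t) (h.below ht)
  have q := fun t ht => eq_of_one_iff (hM'.zero_or_one u t) (hM.zero_or_one (u - 1) t) (h.above ht)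
  have r := fun t ht ht' => (hM'.zero_or_one u t).resolve_right (h.between ht ht')
  have o1 := h.enum.one n u
  have o2 := h.enum.one n (u - 1)
  unfold dual at *
  rcases lt_trichotomy (τ n u) T with h1 | h1 | h1
  · rw [if_pos h1, if_pos (by omega), p T h1, p (T + 1) (by omega), d1]
  · rw [if_neg (by omega), if_pos h1, p (T + 1) (by omega)]
    rw [h1] at o1
    rcases lt_or_eq_of_le (hm.trans h1.le) with h2 | h2
    · rw [if_pos h2, r T h2 (by omega)]; omega
    · rw [h2] at o2
      rw [if_neg (by omega), if_pos h2, q T (by omega)]; omega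
  · rw [if_neg (by omega), if_neg (by omega)]
    rcases lt_trichotomy (τ n (u - 1)) T with h2 | h2 | h2
    · rw [if_pos h2, r T h2 (by omega), r (T + 1) (by omega) (by omega)]; omega
    · rw [h2] at o2
      rw [if_neg (by omega), if_pos h2, q T (by omega), r (T + 1) (by omega) (by omega)]; omega
    · rw [if_neg (by omega), if_neg (by omega), q T (by omega), q (T + 1) (by omega)]; omega

/-- The shifted rows have the old potential, unchanged before the path crosses row `T`, delayed by
one column after the crossing, and one larger on the columns where the path lies in row `T`. No new
zero appears, so the last zero stays or moves by one column. -/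
theorem IsShift.lowers {e l e' l' : ℤ} {n : ℕ} {M M' : ℤ → ℤ → ℤ} {τ : ℕ → ℤ → ℤ}
    (h : IsShift n M M' τ) (hM : IsBits e l M) (hM' : IsBits e' l' M') {D : ℤ → ℤ} {T c : ℤ}
    (hD : Lowers (dual M T) (dual M (T + 1)) D c) :
    ∃ D' c', Lowers (dual M' T) (dual M' (T + 1)) D' c' ∧
      ((c' = c ∧ τ n c ≤ T) ∨ (c' = c + 1 ∧ T < τ n c)) := by
  obtain ⟨b1, b2, b3⟩ := hD.bits (hM.dual.zero_or_one _ _) (hM.dual.zero_or_one _ _)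
  have hz := hD.zero
  have hstep := h.potential hM hM' hD.step
  have hne : τ n c ≠ T := fun hT => by
    have := h.enum.one n c
    rw [hT] at this
    unfold dual at b1
    omega
  have hnn : ∀ u, 0 ≤ (if τ n u < T then D u else if τ n u = T then D u + 1 else D (u - 1)) := by
    intro u
    have := hD.nonneg u
    have := hD.nonneg (u - 1)
    split_ifs <;> omega
  rcases lt_or_gt_of_ne hne with hlt | hlt
  · refine ⟨_, c, ⟨hstep, ?_, hnn, fun u hu => ?_⟩, Or.inl ⟨rfl, hlt.le⟩⟩
    · rw [if_pos (lt_of_le_of_lt (h.mono n (by omega)) hlt), hz]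
    · have h1 := hD.pos u hu
      by_cases huc : u = c
      · subst huc; rwa [if_pos hlt]
      · have h2 := hD.pos (u - 1) (by omega)
        split_ifs <;> omega
  · refine ⟨_, c + 1, ⟨hstep, ?_, hnn, fun u hu => ?_⟩, Or.inr ⟨rfl, hlt⟩⟩
    · rw [add_sub_cancel_right, if_neg (by omega), if_neg (by omega), hz]
    · have := h.mono n (show c ≤ u by omega)
      rw [if_neg (by omega), if_neg (by omega)]
      exact hD.pos _ (by omega)

theorem IsShift.raises {e l e' l' : ℤ} {n : ℕ} {M M' : ℤ → ℤ → ℤ} {τ : ℕ → ℤ → ℤ}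
    (h : IsShift n M M' τ) (hM : IsBits e l M) (hM' : IsBits e' l' M') {D : ℤ → ℤ} {T c : ℤ}
    (hD : Raises (dual M T) (dual M (T + 1)) D c) :
    ∃ D' c', Raises (dual M' T) (dual M' (T + 1)) D' c' ∧
      ((c' = c ∧ τ n c < T) ∨ (c' = c + 1 ∧ T ≤ τ n c)) := by
  obtain ⟨b1, b2, b3⟩ := hD.bits (hM.dual.zero_or_one _ _) (hM.dual.zero_or_one _ _)
  have hz := hD.zero
  have hstep := h.potential hM hM' hD.step
  have hnn : ∀ u, 0 ≤ (if τ n u < T then D u else if τ n u = T then D u + 1 else D (u - 1)) := by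
    intro u
    have := hD.nonneg u
    have := hD.nonneg (u - 1)
    split_ifs <;> omega
  rcases lt_or_ge (τ n c) T with hlt | hge
  · refine ⟨_, c, ⟨hstep, ?_, hnn, fun u hu => ?_⟩, Or.inl ⟨rfl, hlt⟩⟩
    · rw [if_pos hlt, hz]
    · have := h.mono n hu.le
      rw [if_pos (by omega)]
      exact hD.pos u hu
  · refine ⟨_, c + 1, ⟨hstep, ?_, hnn, fun u hu => ?_⟩, Or.inr ⟨rfl, hge⟩⟩
    · have hm := h.mono n (show c ≤ c + 1 by omega)
      -- Otherwise layer `n` lies in row `T` at both `c` and `c + 1`. Nonnegativity of `D` then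
      -- forces a bead at `(c + 1, T + 1)`, whose layer, being monotone and above layer `n`, also
      -- has a bead at `(c, T + 1)`, where the certificate requires a hole.
      have hne : τ n (c + 1) ≠ T := by
        intro hT
        have hT' : τ n c = T := by omega
        have e1 := h.enum.one n (c + 1)
        rw [hT] at e1
        have e2 := hD.step (c + 1)
        have e3 := hD.nonneg (c + 1)
        have e4 := hM.zero_or_one (c + 1) (T + 1)
        rw [add_sub_cancel_right, hz] at e2
        unfold dual at b1 b2 e2
        have e5 : M (c + 1) (T + 1) = 1 := by omega
        obtain ⟨k, hk⟩ := (h.enum.mem _ _).1 e5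
        have e6 := h.enum.lt_iff.1 (show τ n (c + 1) < τ k (c + 1) by omega)
        have e7 := h.enum.lt_iff (u := c) |>.2 e6
        have e8 := h.mono k (show c ≤ c + 1 by omega)
        have e9 : τ k c = T + 1 := by omega
        have := h.enum.one k c
        rw [e9] at this
        omega
      rw [if_neg (by omega), if_neg hne, add_sub_cancel_right, hz]
    · have h0 := hD.nonneg u
      have h1 := fun huc : u < c => hD.pos u huc
      have h2 := hD.pos (u - 1) (by omega)
      by_cases huc : u = c
      · subst huc; split_ifs <;> omega
      · split_ifs <;> omega

/-- The inverse of `IsShift.potential`. -/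
theorem IsShift.potential_inv {e l e' l' : ℤ} {n : ℕ} {M M' : ℤ → ℤ → ℤ} {τ : ℕ → ℤ → ℤ}
    (h : IsShift n M M' τ) (hM : IsBits e l M) (hM' : IsBits e' l' M') {D : ℤ → ℤ} {T : ℤ}
    (hD : ∀ u, D u - D (u - 1) = dual M' T u - dual M' (T + 1) u) (u : ℤ) :
    (if τ n u < T then D u else if τ n u = T then D u - 1 else D (u + 1)) -
      (if τ n (u - 1) < T then D (u - 1) else if τ n (u - 1) = T then D (u - 1) - 1
        else D (u - 1 + 1)) = dual M T u - dual M (T + 1) u := by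
  have d1 := hD u
  have d2 := hD (u + 1)
  have hm := h.mono n (show u - 1 ≤ u by omega)
  have hm' := h.mono n (show u ≤ u + 1 by omega)
  have p := fun t ht => eq_of_one_iff (hM'.zero_or_one u t) (hM.zero_or_one u t) (h.below ht)
  have q := fun t ht => eq_of_one_iff (hM'.zero_or_one u t) (hM.zero_or_one (u - 1) t) (h.above ht)
  have r := fun t ht ht' => (hM'.zero_or_one u t).resolve_right (h.between ht ht')
  have q' := fun t (ht : t ≤ τ n (u + 1 - 1)) => eq_of_one_iff (hM'.zero_or_one (u + 1) t)
    (hM.zero_or_one (u + 1 - 1) t) (h.above ht)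
  have o1 := h.enum.one n u
  have o2 := h.enum.one n (u - 1)
  simp only [add_sub_cancel_right, sub_add_cancel] at *
  unfold dual at *
  rcases lt_trichotomy (τ n u) T with h1 | h1 | h1
  · rw [if_pos h1, if_pos (by omega), ← p T h1, ← p (T + 1) (by omega), d1]
  · rw [if_neg (by omega), if_pos h1, ← p (T + 1) (by omega)]
    rw [h1] at o1
    rcases lt_or_eq_of_le (hm.trans h1.le) with h2 | h2
    · have := r T h2 (by omega)
      rw [if_pos h2]; omega
    · rw [h2] at o2
      have := q T (by omega)
      rw [if_neg (by omega), if_pos h2]; omega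
  · rw [if_neg (by omega), if_neg (by omega), ← q' T (by omega), ← q' (T + 1) (by omega)]
    rcases lt_trichotomy (τ n (u - 1)) T with h2 | h2 | h2
    · have := r T h2 (by omega)
      have := r (T + 1) (by omega) (by omega)
      rw [if_pos h2]; omega
    · rw [h2] at o2
      have := q T (by omega)
      have := r (T + 1) (by omega) (by omega)
      rw [if_neg (by omega), if_pos h2]; omega
    · rw [if_neg (by omega), if_neg (by omega)]; omega

section Inverse

variable {e l e' l' : ℤ} {n : ℕ} {M M' : ℤ → ℤ → ℤ} {τ : ℕ → ℤ → ℤ} {D : ℤ → ℤ} {T : ℤ}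

/-- Where layer `n` lies in row `T`, its bead reappears one column further in `M'`. So the potential
does not increase along this flat piece, and it drops by one at the end. This is what allows one to
be subtracted there when the shift is undone. -/
theorem IsShift.step_flat (h : IsShift n M M' τ) (hM' : IsBits e' l' M')
    (hD : ∀ u, D u - D (u - 1) = dual M' T u - dual M' (T + 1) u) {u : ℤ} (hu : τ n u = T) :
    D (u + 1) ≤ D u ∧ (T < τ n (u + 1) → D u = D (u + 1) + 1) := by
  have d := hD (u + 1)
  rw [add_sub_cancel_right] at d
  have q1 := h.above (u := u + 1) (t := T)
  have r2 := h.between (u := u + 1) (t := T + 1)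
  have o1 := h.enum.one n u
  have c3 := hM'.zero_or_one (u + 1) T
  have c4 := hM'.zero_or_one (u + 1) (T + 1)
  rw [hu] at o1
  simp only [add_sub_cancel_right] at *
  unfold dual at d
  constructor
  · omega
  · intro h'; omega

theorem IsShift.antitone_flat (h : IsShift n M M' τ) (hM' : IsBits e' l' M')
    (hD : ∀ u, D u - D (u - 1) = dual M' T u - dual M' (T + 1) u) {u w : ℤ} (hu : τ n u = T)
    (huw : u ≤ w) (hw : τ n w = T) : D w ≤ D u := by
  induction w, huw using Int.leInduction with
  | base => exact le_rfl
  | succ w huw ih =>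
    have h1 := h.mono n huw
    have h2 := h.mono n (show w ≤ w + 1 by omega)
    have h3 : τ n w = T := by omega
    exact (h.step_flat hM' hD h3).1.trans (ih h3)

theorem IsEnum.unbounded (hl : 2 ≤ l) (hM : IsBits e l M) (h : IsEnum M τ) (k : ℕ)
    (T : ℤ) : (∃ u, T < τ k u) ∧ ∃ u, τ k u < T := by
  constructor
  · refine ⟨0 + (|T| + |τ k 0| + 1) * e, ?_⟩
    rw [h.period_mul hM]
    have := le_abs_self T
    have := neg_abs_le (τ k 0)
    nlinarith [abs_nonneg T, abs_nonneg (τ k 0)]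
  · refine ⟨0 + (-(|T| + |τ k 0| + 1)) * e, ?_⟩
    rw [h.period_mul hM]
    have := neg_abs_le T
    have := le_abs_self (τ k 0)
    nlinarith [abs_nonneg T, abs_nonneg (τ k 0)]

theorem IsEnum.exists_last (hl : 2 ≤ l) (hM : IsBits e l M) (h : IsEnum M τ) {k : ℕ}
    (hm : Monotone (τ k)) (T : ℤ) : ∃ q, ∀ u, u ≤ q ↔ τ k u ≤ T := by
  obtain ⟨⟨a, ha⟩, ⟨b, hb⟩⟩ := h.unbounded hl hM k T
  obtain ⟨q, hq, hq'⟩ := Int.exists_greatest_of_bdd (P := fun u => τ k u ≤ T)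
    ⟨a, fun z hz => by by_contra hc; have := hm (show a ≤ z by omega); omega⟩ ⟨b, hb.le⟩
  exact ⟨q, fun u => ⟨fun hu => (hm hu).trans hq, hq' u⟩⟩

/-- Undoing the shift subtracts one on the columns where layer `n` lies in row `T`. There the
potential exceeds its value just after the flat piece by at least one, so it stays nonnegative, and
positive from `c` on. -/
theorem IsShift.lowers_inv (hl : 2 ≤ l) (h : IsShift n M M' τ) (hM : IsBits e l M)
    (hM' : IsBits e' l' M') {c : ℤ} (hD : Lowers (dual M' T) (dual M' (T + 1)) D c) :
    ∃ D' c', Lowers (dual M T) (dual M (T + 1)) D' c' := by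
  have hz := hD.zero
  have hstep := h.potential_inv hM hM' hD.step
  obtain ⟨q, hq⟩ := h.enum.exists_last hl hM (h.mono n) T
  have hflat : ∀ u, τ n u = T → u ≤ q ∧ D (q + 1) + 1 ≤ D u := by
    intro u hu
    have h1 := (hq u).2 hu.le
    have h2 := h.mono n h1
    have h3 := (hq q).1 le_rfl
    have h4 := fun hc => (hq (q + 1)).2 hc
    have h5 := h.antitone_flat hM' hD.step hu h1 (by omega)
    have h6 := (h.step_flat hM' hD.step (u := q) (by omega)).2 (by
      by_contra hc; have := h4 (by omega); omega)
    omega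
  have hqT : T < τ n (q + 1) := by
    by_contra hc
    have := (hq (q + 1)).2 (by omega)
    omega
  have hnn : ∀ u, 0 ≤ (if τ n u < T then D u else if τ n u = T then D u - 1 else D (u + 1)) := by
    intro u
    have := hD.nonneg u
    have := hD.nonneg (u + 1)
    have := hflat u
    have := hD.nonneg (q + 1)
    split_ifs <;> omega
  have hpos : ∀ u, c ≤ u →
      0 < (if τ n u < T then D u else if τ n u = T then D u - 1 else D (u + 1)) := by
    intro u hu
    have := hD.pos u hu
    have := hD.pos (u + 1) (by omega)
    have := hflat u
    have := fun hc => hD.pos (q + 1) hc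
    split_ifs <;> omega
  rcases lt_trichotomy (τ n (c - 1)) T with hlt | heq | hgt
  · exact ⟨_, c, hstep, by rw [if_pos hlt, hz], hnn, hpos⟩
  · exfalso
    have := hflat _ heq
    have := hD.nonneg (q + 1)
    omega
  · refine ⟨_, c - 1, hstep, ?_, hnn, fun u hu => ?_⟩
    · have d1 := hD.step (c - 1)
      have r1 := h.between (u := c - 1) (t := T)
      have r2 := h.between (u := c - 1) (t := T + 1)
      have s1 := h.step_flat hM' hD.step (u := c - 1 - 1)
      have c1 := hM'.zero_or_one (c - 1) T
      have c2 := hM'.zero_or_one (c - 1) (T + 1)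
      simp only [sub_add_cancel] at *
      unfold dual at d1
      split_ifs <;> omega
    · have := h.mono n hu
      rw [if_neg (by omega), if_neg (by omega)]
      exact hD.pos _ (by omega)

/-- As for lowering certificates, but positivity is needed before `c`. The delicate case is a flat
piece that ends at `c - 1`, where the potential must be at least two on the earlier flat columns. -/
theorem IsShift.raises_inv (hl : 2 ≤ l) (h : IsShift n M M' τ) (hM : IsBits e l M)
    (hM' : IsBits e' l' M') {c : ℤ} (hD : Raises (dual M' T) (dual M' (T + 1)) D c) :
    ∃ D' c', Raises (dual M T) (dual M (T + 1)) D' c' := by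
  have hz := hD.zero
  obtain ⟨b1, b2, b3⟩ := hD.bits (hM'.dual.zero_or_one _ _) (hM'.dual.zero_or_one _ _)
  have hstep := h.potential_inv hM hM' hD.step
  obtain ⟨q, hq⟩ := h.enum.exists_last hl hM (h.mono n) T
  have hqT : T < τ n (q + 1) := by
    by_contra hc
    have := (hq (q + 1)).2 (by omega)
    omega
  have hflat : ∀ u, τ n u = T → u ≤ q ∧ τ n q = T ∧ D q ≤ D u ∧ D (q + 1) + 1 ≤ D u := by
    intro u hu
    have h1 := (hq u).2 hu.le
    have h2 := h.mono n h1
    have h3 := (hq q).1 le_rfl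
    have h5 := h.antitone_flat hM' hD.step hu h1 (by omega)
    have h6 := (h.step_flat hM' hD.step (u := q) (by omega)).2 hqT
    omega
  have hnn : ∀ u, 0 ≤ (if τ n u < T then D u else if τ n u = T then D u - 1 else D (u + 1)) := by
    intro u
    have := hD.nonneg u
    have := hD.nonneg (u + 1)
    have := hflat u
    have := hD.nonneg (q + 1)
    split_ifs <;> omega
  rcases lt_trichotomy (τ n c) T with hlt | heq | hgt
  · refine ⟨_, c, hstep, by rw [if_pos hlt, hz], hnn, fun u hu => ?_⟩
    have := h.mono n hu.le
    rw [if_pos (by omega)]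
    exact hD.pos u hu
  · exfalso
    have := hflat _ heq
    have := hD.nonneg (q + 1)
    omega
  · have hprev : T ≤ τ n (c - 1) := by
      by_contra hc
      have := h.between (u := c) (t := T) (by omega) (by omega)
      unfold dual at b1
      omega
    refine ⟨_, c - 1, hstep, ?_, hnn, fun u hu => ?_⟩
    · have s1 := h.step_flat hM' hD.step (u := c - 1)
      simp only [sub_add_cancel] at *
      split_ifs <;> omega
    · have h1 := hD.pos u (by omega)
      have h2 := hD.pos (u + 1) (by omega)
      split_ifs with hu1 hu2
      · omega
      · obtain ⟨f1, f2, f3, f4⟩ := hflat u hu2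
        by_cases hqc : q + 1 < c
        · have := hD.pos _ hqc; omega
        · have hqc' : q = c - 1 := by
            have h3 := fun hc => (hq c).1 hc
            by_contra hc; have := h3 (by omega); omega
          subst hqc'
          have s1 := (h.step_flat hM' hD.step (u := c - 1) f2).2 hqT
          rw [sub_add_cancel, hz] at s1
          have hv : ∀ v, τ n v = T → v ≤ c - 1 → (∀ w, w ≤ c - 1 → v ≤ w → τ n w = T) := by
            intro v hv _ w hw hvw
            have := h.mono n hw; have := h.mono n hvw; omega
          have hbit := hM.zero_or_one (c - 1) (T + 1)
          -- With a hole at `(c - 1, T + 1)` the potential drops from two to one in the step to `c -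
          -- 1`, and it does not increase along the flat piece.
          rcases hbit with hbit | hbit
          · have d1 := hD.step (c - 1)
            have hp := hv u hu2 (by omega) (c - 1 - 1) (by omega) (by omega)
            have p2 := h.below (u := c - 1) (t := T + 1) (by omega)
            have q1 := h.above (u := c - 1) (t := T) (by omega)
            have o1 := h.enum.one n (c - 1 - 1)
            rw [hp] at o1
            have := hM'.zero_or_one (c - 1) (T + 1)
            have := h.antitone_flat hM' hD.step hu2 (show u ≤ c - 1 - 1 by omega) hp
            unfold dual at d1
            omega
          · exfalso
            obtain ⟨k, hk⟩ := (h.enum.mem _ _).1 hbit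
            have hnk := h.enum.lt_iff.1 (show τ n (c - 1) < τ k (c - 1) by omega)
            -- With a bead at `(c - 1, T + 1)`, monotonicity of its layer puts a bead in row `T + 1`
            -- above the whole flat piece, so the potential is constantly one there. It rises by one
            -- on entering the piece, hence vanishes just before it, against positivity before `c`.
            have down : ∀ v, v ≤ c - 1 → τ n v = T → D v = 1 := by
              intro v hvc
              induction v, hvc using Int.leInductionDown with
              | base => intro _; omega
              | pred v hvc ih =>
                intro hT
                have m1 := hv (v - 1) hT (by omega) v hvc (by omega)
                have m2 := ih m1
                have d1 := hD.step v
                have m3 := h.mono k hvc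
                have m4 := h.enum.lt_iff (u := v) |>.2 hnk
                have o1 := h.enum.one k v
                rw [show τ k v = T + 1 by omega] at o1
                have p2 := (h.below (u := v) (t := T + 1) (by omega)).2 o1
                have o2 := h.enum.one n (v - 1)
                rw [hT] at o2
                have q1 := (h.above (u := v) (t := T) (by omega)).2 o2
                unfold dual at d1
                omega
            obtain ⟨r, hr⟩ := h.enum.exists_last hl hM (h.mono n) (T - 1)
            have r1 := (hr r).1 le_rfl
            have r2 : T - 1 < τ n (r + 1) := by
              by_contra hc; have := (hr (r + 1)).2 (by omega); omega
            have r3 : r + 1 ≤ c - 1 := by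
              by_contra hc
              have := (hr (c - 1)).1 (by omega)
              omega
            have r4 := h.mono n r3
            have r5 : τ n (r + 1) = T := by omega
            have r6 := down (r + 1) r3 r5
            have d1 := hD.step (r + 1)
            rw [add_sub_cancel_right] at d1
            have m3 := h.mono k r3
            have m4 := h.enum.lt_iff (u := r + 1) |>.2 hnk
            have o1 := h.enum.one k (r + 1)
            rw [show τ k (r + 1) = T + 1 by omega] at o1
            have p2 := (h.below (u := r + 1) (t := T + 1) (by omega)).2 o1
            have q1 := h.between (u := r + 1) (t := T) (by rw [add_sub_cancel_right]; omega)
              (by omega)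
            have := hM'.zero_or_one (r + 1) T
            have := hD.pos r (by omega)
            unfold dual at d1
            omega
      · omega

end Inverse


/-! ### Shifts are compatible with the row crystal -/

/-- The arrow of the crystal of the rows `T` and `T + 1`. -/
def RowArr (e l T : ℤ) (M N : ℤ → ℤ → ℤ) : Prop := Arr l e T (dual M) (dual N)

section RowMoves

variable {e l T c : ℤ} {M N : ℤ → ℤ → ℤ} {τ : ℕ → ℤ → ℤ}

theorem moves_dual_iff : Moves l e T c (dual M) (dual N) ↔
    ∀ u t, N u t = M u t + orb e l c T u t - orb e l c (T + 1) u t := by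
  unfold Moves dual
  simp only [orb_swap e l]
  constructor
  · intro h u t; have := h t u; omega
  · intro h t u; have := h u t; omega

theorem orb_up {u t : ℤ} : orb e l c (T + 1) u (t + 1) = orb e l c T u t := by
  have := orb_add e l c T u t 0 1
  simpa using this

/-- The enumeration after a bead has moved from the row `T + 1` to the row `T`. -/
theorem IsEnum.move_down (hM : IsBits e l M) (h : IsEnum M τ)
    (h1 : M c (T + 1) = 1) (h0 : M c T = 0) (hN : Moves l e T c (dual M) (dual N)) :
    IsEnum N fun k u => τ k u - orb e l c (T + 1) u (τ k u) := by
  rw [moves_dual_iff] at hN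
  have hnb : ∀ u t, ¬ (orb e l c (T + 1) u t = 1 ∧ orb e l c T u t = 1) := fun u t ⟨x, y⟩ => by
    have := hM.orb_eq x; have := hM.orb_eq y; omega
  refine ⟨fun u j k hjk => ?_, fun u t => ?_⟩
  · have hlt := h.strictMono u hjk
    simp only at *
    rcases orb_zero_or_one e l c (T + 1) u (τ j u) with o1 | o1 <;>
    rcases orb_zero_or_one e l c (T + 1) u (τ k u) with o2 | o2
    · omega
    · have : τ j u ≠ τ k u - 1 := fun hc => by
        have e1 := orb_up (e := e) (l := l) (c := c) (T := T) (u := u) (t := τ k u - 1)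
        rw [sub_add_cancel, o2, ← hc] at e1
        have := hM.orb_eq e1.symm
        have := h.one j u
        omega
      omega
    · omega
    · omega
  · rw [hN]
    rcases orb_zero_or_one e l c T u t with o1 | o1
    · rcases orb_zero_or_one e l c (T + 1) u t with o2 | o2
      · rw [o1, o2, add_zero, sub_zero, h.mem]
        constructor
        · rintro ⟨k, rfl⟩; exact ⟨k, by omega⟩
        · rintro ⟨k, hk⟩
          refine ⟨k, ?_⟩
          rcases orb_zero_or_one e l c (T + 1) u (τ k u) with o3 | o3
          · omega
          · rw [show τ k u = t + 1 by omega, orb_up] at o3; omega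
      · have := hM.orb_eq o2
        rw [o1, o2]
        constructor
        · intro; omega
        · rintro ⟨k, hk⟩
          exfalso
          rcases orb_zero_or_one e l c (T + 1) u (τ k u) with o3 | o3
          · rw [show τ k u = t by omega] at o3; omega
          · rw [show τ k u = t + 1 by omega, orb_up] at o3; omega
    · have o2 := orb_up.trans o1
      have m1 := hM.orb_eq o1
      have m2 := hM.orb_eq o2
      have o3 : orb e l c (T + 1) u t = 0 :=
        (orb_zero_or_one _ _ _ _ _ _).resolve_right fun o => hnb u t ⟨o, o1⟩
      obtain ⟨k, hk⟩ := (h.mem u (t + 1)).1 (m2.trans h1)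
      rw [o1, o3, m1, h0]
      simp only [zero_add, sub_zero, true_iff]
      exact ⟨k, by rw [hk, o2]; ring⟩

/-- The enumeration after a bead has moved from the row `T` to the row `T + 1`. -/
theorem IsEnum.move_up (hM : IsBits e l M) (h : IsEnum M τ)
    (h1 : M c T = 1) (h0 : M c (T + 1) = 0) (hN : Moves l e T c (dual N) (dual M)) :
    IsEnum N fun k u => τ k u + orb e l c T u (τ k u) := by
  rw [moves_dual_iff] at hN
  have hnb : ∀ u t, ¬ (orb e l c (T + 1) u t = 1 ∧ orb e l c T u t = 1) := fun u t ⟨x, y⟩ => by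
    have := hM.orb_eq x; have := hM.orb_eq y; omega
  refine ⟨fun u j k hjk => ?_, fun u t => ?_⟩
  · have hlt := h.strictMono u hjk
    simp only at *
    rcases orb_zero_or_one e l c T u (τ j u) with o1 | o1 <;>
    rcases orb_zero_or_one e l c T u (τ k u) with o2 | o2
    · omega
    · omega
    · have : τ k u ≠ τ j u + 1 := fun hc => by
        have e1 := orb_up (e := e) (l := l) (c := c) (T := T) (u := u) (t := τ j u)
        rw [o1, ← hc] at e1
        have := hM.orb_eq e1
        have := h.one k u
        omega
      omega
    · omega
  · have hN := hN u t
    rcases orb_zero_or_one e l c (T + 1) u t with o1 | o1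
    · rcases orb_zero_or_one e l c T u t with o2 | o2
      · rw [show N u t = M u t by omega, h.mem]
        constructor
        · rintro ⟨k, rfl⟩; exact ⟨k, by omega⟩
        · rintro ⟨k, hk⟩
          refine ⟨k, ?_⟩
          rcases orb_zero_or_one e l c T u (τ k u) with o3 | o3
          · omega
          · rw [show τ k u = t - 1 by omega, ← orb_up, sub_add_cancel] at o3; omega
      · have := hM.orb_eq o2
        constructor
        · intro; omega
        · rintro ⟨k, hk⟩
          exfalso
          rcases orb_zero_or_one e l c T u (τ k u) with o3 | o3
          · rw [show τ k u = t by omega] at o3; omega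
          · rw [show τ k u = t - 1 by omega, ← orb_up, sub_add_cancel] at o3; omega
    · have o2 : orb e l c T u (t - 1) = 1 := by rw [← orb_up, sub_add_cancel]; exact o1
      have m1 := hM.orb_eq o1
      have m2 := hM.orb_eq o2
      have o3 : orb e l c T u t = 0 :=
        (orb_zero_or_one _ _ _ _ _ _).resolve_right fun o => hnb u t ⟨o1, o⟩
      obtain ⟨k, hk⟩ := (h.mem u (t - 1)).1 (m2.trans h1)
      rw [show N u t = 1 by omega]
      simp only [true_iff]
      exact ⟨k, by rw [hk, o2]; ring⟩

/-- Translation by the period preserves the index of a bead in its column, so an orbit consists of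
beads of one index. -/
theorem IsEnum.orb_iff (hM : IsBits e l M) (h : IsEnum M τ) {s : ℤ} {k : ℕ} {u : ℤ}
    (ho : orb e l c s u (τ k u) = 1) : τ k c = s := by
  obtain ⟨m, rfl, h2⟩ := orb_eq_one.1 ho
  rw [h.period_mul hM] at h2
  omega

/-- Row moves of a configuration and of its shift move corresponding beads. -/
theorem IsShift.orb_eq {n : ℕ} {M' : ℤ → ℤ → ℤ} {c' s : ℤ} (h : IsShift n M M' τ)
    (hM : IsBits e l M) (hM' : IsBits e l M') {k₀ : ℕ} (hk₀ : τ k₀ c = s)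
    (hc' : c' = if k₀ ≤ n then c + 1 else c) (k : ℕ) (u : ℤ) :
    orb e l c' s u (shiftEnum n τ k u) =
      if k ≤ n then orb e l c s (u - 1) (τ k (u - 1)) else orb e l c s u (τ k u) := by
  have hk₀' : shiftEnum n τ k₀ c' = s := by
    rw [hc']; unfold shiftEnum
    split_ifs
    · rw [add_sub_cancel_right, hk₀]
    · exact hk₀
  have aux : ∀ j u, orb e l c s u (τ j u) = 1 → j = k₀ := fun j u ho =>
    (h.enum.strictMono c).injective ((h.enum.orb_iff hM ho).trans hk₀.symm)
  have aux' : ∀ j u, orb e l c' s u (shiftEnum n τ j u) = 1 → j = k₀ := fun j u ho =>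
    (h.enum'.strictMono c').injective ((h.enum'.orb_iff hM' ho).trans hk₀'.symm)
  have hz : ∀ {x y : ℤ}, (x = 0 ∨ x = 1) → (y = 0 ∨ y = 1) → ¬ x = 1 → ¬ y = 1 → x = y := by
    intros; omega
  by_cases hk : k = k₀
  · subst hk
    unfold shiftEnum at *
    split_ifs at * with hkn
    · subst hc'
      have := orb_add e l c s (u - 1) (τ k (u - 1)) 1 0
      simpa using this
    · subst hc'; rfl
  · have h1 : ¬ orb e l c' s u (shiftEnum n τ k u) = 1 := fun ho => hk (aux' _ _ ho)
    split_ifs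
    · exact hz (orb_zero_or_one ..) (orb_zero_or_one ..) h1 fun ho => hk (aux _ _ ho)
    · exact hz (orb_zero_or_one ..) (orb_zero_or_one ..) h1 fun ho => hk (aux _ _ ho)

end RowMoves

section Highest

variable {e l T : ℤ} {M N : ℤ → ℤ → ℤ}

theorem RowArr.isConf (hM : IsConf e l M) (h : RowArr e l T M N) : IsConf e l N := by
  have := (Arr.isConf h hM.dual).dual
  rwa [dual_dual] at this

/-- An arrow into `N` from another column would complete, by a commuting square, to a column arrow
into `M`. -/
theorem IsHighest.row (he : 2 ≤ e) (hl : 2 ≤ l) (hM : IsConf e l M) (h : IsHighest e l M)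
    (hr : RowArr e l T M N) : IsHighest e l N := by
  intro U K hK harr
  have hN := hr.isConf hM
  obtain ⟨K', h1, -, h2⟩ := square_raise_raise he hl hN.toIsBits hK.toIsBits hM.toIsBits harr hr
  obtain ⟨D, a, -, hm⟩ := id h2
  exact h U K' (hM.of_moves h1 (Or.inr hm)) h2

theorem IsHighest.row_symm (he : 2 ≤ e) (hl : 2 ≤ l) (hM : IsConf e l M) (hN : IsConf e l N)
    (h : IsHighest e l M) (hr : RowArr e l T N M) : IsHighest e l N := by
  intro U K hK harr
  obtain ⟨K', h1, -, h2⟩ := square_raise_lower he hl hN.toIsBits hK.toIsBits harr hr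
  obtain ⟨D, a, -, hm⟩ := id h2
  exact h U K' (hM.of_moves h1 (Or.inr hm)) h2

theorem isHighest_iff_no_raise (he : 2 ≤ e) (hM : IsConf e l M) :
    IsHighest e l M ↔ ∀ U D a, ¬ Raises (M U) (M (U + 1)) D a := by
  constructor
  · intro h U D a hr
    obtain ⟨b1, b2⟩ := arr_of_raises (e := e) (l := l) he hM.toIsBits hr
      (M := fun x t => M x t + orb e l U a x t - orb e l (U + 1) a x t) (fun x t => by ring)
    exact h U _ (hM.of_moves (U := U) (a := a) b1 (Or.inr fun x t => by ring)) b2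
  · intro h U K hK harr
    obtain ⟨D, a, hr, -⟩ := harr.raises he hK.toIsBits
    exact h U D a hr

variable {n : ℕ} {M' : ℤ → ℤ → ℤ} {τ : ℕ → ℤ → ℤ}

/-- Raising certificates of the rows pass through a shift in both directions. -/
theorem IsShift.isHighest_dual_iff (hl : 2 ≤ l) (hM : IsConf e l M) (hM' : IsConf e l M')
    (h : IsShift n M M' τ) : IsHighest l e (dual M) ↔ IsHighest l e (dual M') := by
  rw [isHighest_iff_no_raise hl hM.dual, isHighest_iff_no_raise hl hM'.dual]
  constructor
  · intro hh T D c hr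
    obtain ⟨D', c', hr'⟩ := h.raises_inv hl hM.toIsBits hM'.toIsBits hr
    exact hh _ _ _ hr'
  · intro hh T D c hr
    obtain ⟨D', c', hr', -⟩ := h.raises hM.toIsBits hM'.toIsBits hr
    exact hh _ _ _ hr'

theorem RowArr.of_lowers {D : ℤ → ℤ} {c : ℤ} (h : Lowers (dual M T) (dual M (T + 1)) D c) :
    ∃ N, RowArr e l T M N ∧ Moves l e T c (dual M) (dual N) := by
  refine ⟨dual fun t u => dual M t u - orb l e T c t u + orb l e (T + 1) c t u, ⟨D, c, h, ?_⟩, ?_⟩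
  · rw [dual_dual]; intro _ _; rfl
  · rw [dual_dual]; intro _ _; rfl

theorem RowArr.of_raises (hl : 2 ≤ l) (hM : IsConf e l M) {D : ℤ → ℤ} {c : ℤ}
    (h : Raises (dual M T) (dual M (T + 1)) D c) :
    ∃ N, IsConf e l N ∧ RowArr e l T N M ∧ Moves l e T c (dual N) (dual M) := by
  have hm : Moves l e T c (fun t u => dual M t u + orb l e T c t u - orb l e (T + 1) c t u)
    (dual M) := fun t u => by ring
  obtain ⟨h1, h2⟩ := arr_of_raises hl hM.dual.toIsBits h hm
  refine ⟨dual (fun t u => dual M t u + orb l e T c t u - orb l e (T + 1) c t u),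
    (hM.dual.of_moves h1 (Or.inr hm)).dual, ?_, ?_⟩
  · unfold RowArr; rwa [dual_dual]
  · rwa [dual_dual]

/-- Shifts commute with the lowering row arrows. -/
theorem IsShift.row_lower (he : 2 ≤ e) (hl : 2 ≤ l) (hM : IsConf e l M) (hM' : IsConf e l M')
    (h : IsShift n M M' τ) (hr : RowArr e l T M N) :
    ∃ N' ρ, IsConf e l N' ∧ RowArr e l T M' N' ∧ IsShift n N N' ρ := by
  have hN := hr.isConf hM
  have hh := IsHighest.row he hl hM ((isHighest_iff he hM h.enum).2 h.mono) hr
  obtain ⟨D, c, hD, hm⟩ := hr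
  obtain ⟨D', c', hD', hc'⟩ := h.lowers hM.toIsBits hM'.toIsBits hD
  obtain ⟨N', hr', hm'⟩ := RowArr.of_lowers (e := e) (l := l) hD'
  obtain ⟨b1, b2, -⟩ := hD.bits (hM.dual.zero_or_one _ _) (hM.dual.zero_or_one _ _)
  obtain ⟨b3, b4, -⟩ := hD'.bits (hM'.dual.zero_or_one _ _) (hM'.dual.zero_or_one _ _)
  unfold dual at b1 b2 b3 b4
  have e1 := h.enum.move_down hM.toIsBits (c := c) (T := T) (by omega) (by omega) hm
  have e2 := h.enum'.move_down hM'.toIsBits (c := c') (T := T) (by omega) (by omega) hm'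
  obtain ⟨k₀, hk₀⟩ := (h.enum.mem c (T + 1)).1 (by omega)
  -- The certificate is displaced exactly when the bead that moves belongs to one of the shifted
  -- layers, so both row moves affect the same layer.
  have hcc : c' = if k₀ ≤ n then c + 1 else c := by
    have h1 := h.enum.le_iff (j := k₀) (k := n) (u := c)
    have h2 : τ n c ≠ T := fun hT => by
      have := h.enum.one n c
      rw [hT] at this
      omega
    split_ifs with hkn
    · have := h1.2 hkn; omega
    · have := fun hc => hkn (h1.1 hc); omega
  refine ⟨N', _, hr'.isConf hM', hr', e1, (isHighest_iff he hN e1).1 hh, ?_⟩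
  convert e2 using 2 with k
  funext u
  simp only [shiftEnum]
  have := h.orb_eq hM.toIsBits hM'.toIsBits hk₀ hcc k u
  simp only [shiftEnum] at this
  split_ifs at * <;> omega

/-- Shifts commute with the raising row arrows. -/
theorem IsShift.row_raise (he : 2 ≤ e) (hl : 2 ≤ l) (hM : IsConf e l M) (hM' : IsConf e l M')
    (hN : IsConf e l N) (h : IsShift n M M' τ) (hr : RowArr e l T N M) :
    ∃ N' ρ, IsConf e l N' ∧ RowArr e l T N' M' ∧ IsShift n N N' ρ := by
  have hh := IsHighest.row_symm he hl hM hN ((isHighest_iff he hM h.enum).2 h.mono) hr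
  obtain ⟨D, c, hD, hm⟩ := Arr.raises hl hN.dual.toIsBits hr
  obtain ⟨D', c', hD', hc'⟩ := h.raises hM.toIsBits hM'.toIsBits hD
  obtain ⟨N', hNc', hr', hm'⟩ := RowArr.of_raises hl hM' hD'
  obtain ⟨b1, b2, -⟩ := hD.bits (hM.dual.zero_or_one _ _) (hM.dual.zero_or_one _ _)
  obtain ⟨b3, b4, -⟩ := hD'.bits (hM'.dual.zero_or_one _ _) (hM'.dual.zero_or_one _ _)
  unfold dual at b1 b2 b3 b4
  have e1 := h.enum.move_up hM.toIsBits (c := c) (T := T) (by omega) (by omega) hm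
  have e2 := h.enum'.move_up hM'.toIsBits (c := c') (T := T) (by omega) (by omega) hm'
  obtain ⟨k₀, hk₀⟩ := (h.enum.mem c T).1 (by omega)
  have hcc : c' = if k₀ ≤ n then c + 1 else c := by
    have h1 := h.enum.le_iff (j := k₀) (k := n) (u := c)
    split_ifs with hkn
    · have := h1.2 hkn; omega
    · have := fun hc => hkn (h1.1 hc); omega
  refine ⟨N', _, hNc', hr', e1, (isHighest_iff he hN e1).1 hh, ?_⟩
  convert e2 using 2 with k
  funext u
  simp only [shiftEnum]
  have := h.orb_eq hM.toIsBits hM'.toIsBits hk₀ hcc k u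
  simp only [shiftEnum] at this
  split_ifs at * <;> omega

theorem IsShift.functional {N : ℤ → ℤ → ℤ} {ρ : ℕ → ℤ → ℤ} (hM' : IsConf e l M') (hN : IsConf e l N)
    (h : IsShift n M M' τ) (h' : IsShift n M N ρ) : M' = N := by
  obtain rfl := h.enum.unique h'.enum
  exact IsEnum.bits_unique hM'.toIsBits hN.toIsBits h.enum' h'.enum'

theorem IsShift.injective {N : ℤ → ℤ → ℤ} {ρ : ℕ → ℤ → ℤ} (hM : IsConf e l M) (hN : IsConf e l N)
    (h : IsShift n M M' τ) (h' : IsShift n N M' ρ) : M = N := by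
  have h1 := h.enum'.unique h'.enum'
  have : τ = ρ := by
    funext k u
    by_cases hk : k ≤ n
    · have := congrFun (congrFun h1 k) (u + 1)
      simpa [shiftEnum, hk] using this
    · have := congrFun (congrFun h1 k) u
      simpa [shiftEnum, hk] using this
  subst this
  exact IsEnum.bits_unique hM.toIsBits hN.toIsBits h.enum h'.enum

/-- The certificate passes back to `M` and gives an arrow there. The arrow that it induces on `M'`
must be the given one, because arrows are functional. -/
theorem IsShift.row_lower_inv (he : 2 ≤ e) (hl : 2 ≤ l) (hM : IsConf e l M) (hM' : IsConf e l M')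
    {N' : ℤ → ℤ → ℤ} (h : IsShift n M M' τ) (hr : RowArr e l T M' N') :
    ∃ N ρ, IsConf e l N ∧ RowArr e l T M N ∧ IsShift n N N' ρ := by
  obtain ⟨D, c, hD, hm⟩ := id hr
  obtain ⟨D', c', hD'⟩ := h.lowers_inv hl hM.toIsBits hM'.toIsBits hD
  obtain ⟨N, hr', -⟩ := RowArr.of_lowers (e := e) (l := l) hD'
  obtain ⟨N'', ρ, h1, h2, h3⟩ := h.row_lower he hl hM hM' hr'
  have : N'' = N' := by
    rw [← dual_dual N'', Arr.functional h2 hr, dual_dual]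
  subst this
  exact ⟨N, ρ, hr'.isConf hM, hr', h3⟩

theorem IsShift.row_raise_inv (he : 2 ≤ e) (hl : 2 ≤ l) (hM : IsConf e l M) (hM' : IsConf e l M')
    {N' : ℤ → ℤ → ℤ} (hN' : IsConf e l N') (h : IsShift n M M' τ) (hr : RowArr e l T N' M') :
    ∃ N ρ, IsConf e l N ∧ RowArr e l T N M ∧ IsShift n N N' ρ := by
  obtain ⟨D, c, hD, hm⟩ := Arr.raises hl hN'.dual.toIsBits hr
  obtain ⟨D', c', hD'⟩ := h.raises_inv hl hM.toIsBits hM'.toIsBits hD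
  obtain ⟨N, hN, hr', -⟩ := RowArr.of_raises hl hM hD'
  obtain ⟨N'', ρ, h1, h2, h3⟩ := h.row_raise he hl hM hM' hN hr'
  have : N'' = N' := by
    rw [← dual_dual N'', Arr.injective hl h1.dual.toIsBits hN'.dual.toIsBits h2 hr, dual_dual]
  subst this
  exact ⟨N, ρ, hN, hr', h3⟩

end Highest


/-! ### Charges of columns and rows -/

/-- The line `A` becomes the vacuum with first bead at `f` after finitely many moves. -/
def HasCharge (A : ℤ → ℤ) (f : ℤ) : Prop :=
  ∃ n : ℤ → ℤ, (∀ t, n t - n (t - 1) = A t) ∧ (∃ a, ∀ t ≤ a, n t = 0) ∧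
    ∃ b, ∀ t, b ≤ t → n t = t - f + 1

theorem HasCharge.unique {A : ℤ → ℤ} {f f' : ℤ} (h : HasCharge A f) (h' : HasCharge A f') :
    f = f' := by
  obtain ⟨n, n1, ⟨a, n2⟩, b, n3⟩ := h
  obtain ⟨n', n1', ⟨a', n2'⟩, b', n3'⟩ := h'
  have h1 := potential_sub (D := n) (D' := n') (fun t => by rw [n1, n1']) (max b b') (min a a')
  rw [n2 _ (min_le_left _ _), n2' _ (min_le_right _ _), n3 _ (le_max_left _ _),
    n3' _ (le_max_right _ _)] at h1
  omega

section Charge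

variable {e l : ℤ} {M N : ℤ → ℤ → ℤ} {τ : ℕ → ℤ → ℤ}

theorem IsConf.exists_charge (he : 2 ≤ e) (hM : IsConf e l M) (u : ℤ) :
    ∃ f, HasCharge (M u) f := by
  obtain ⟨n, a, n1, n2, n3⟩ := hM.exists_count he u
  obtain ⟨b, hb⟩ := hM.col_one he u
  refine ⟨b - n b + 1, n, n1, ⟨a, n2⟩, b, fun t ht => ?_⟩
  have := const_above (D := fun t => n t - t) (a := b)
    (fun t ht => by have := n1 t; have := hb t ht.le; omega) ht
  omega

theorem HasCharge.enum (he : 2 ≤ e) (hM : IsConf e l M) (h : IsEnum M τ) {u f : ℤ}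
    (hc : HasCharge (M u) f) : ∃ K, ∀ k ≥ K, τ k u = f + k := by
  obtain ⟨n, n1, ⟨a, n2⟩, b, n3⟩ := hc
  obtain ⟨t₀, ht₀⟩ := hM.col_zero he u
  have cnt := h.count (hM.zero_or_one u) n1 (n2 (min a t₀) (min_le_left _ _))
    (fun t ht => ht₀ t (ht.trans (min_le_right _ _)))
  refine ⟨(b - f + 1).toNat, fun k hk => ?_⟩
  have h0 := Int.self_le_toNat (b - f + 1)
  have h1 := cnt k (f + k)
  have h2 := cnt k (f + k - 1)
  rw [n3 _ (by omega)] at h1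
  rw [n3 _ (by omega)] at h2
  have h3 := h1.1 (by omega)
  have h4 := fun hx => h2.2 hx
  by_contra hne
  have := h4 (by omega)
  omega

theorem hasCharge_of_enum (he : 2 ≤ e) (hM : IsConf e l M) (h : IsEnum M τ) {u f : ℤ} {K : ℕ}
    (hK : ∀ k ≥ K, τ k u = f + k) : HasCharge (M u) f := by
  obtain ⟨f', hf'⟩ := hM.exists_charge he u
  obtain ⟨K', hK'⟩ := hf'.enum he hM h
  have h1 := hK (max K K') (le_max_left _ _)
  have h2 := hK' (max K K') (le_max_right _ _)
  obtain rfl : f = f' := by omega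
  exact hf'

theorem orb_col_finite (he : 2 ≤ e) (c T u : ℤ) :
    ∃ s, ∀ t, t ≠ s → orb e l c T u t = 0 := by
  by_cases h : ∃ s, orb e l c T u s = 1
  · obtain ⟨s, hs⟩ := h
    refine ⟨s, fun t ht => (orb_zero_or_one ..).resolve_right fun h1 => ht ?_⟩
    rw [orb_congr hs] at h1
    exact (orb_same_col he).1 h1
  · exact ⟨0, fun t _ => (orb_zero_or_one ..).resolve_right fun h1 => h ⟨t, h1⟩⟩

theorem HasCharge.move (he : 2 ≤ e) {c T u f : ℤ} {ε : ℤ}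
    (hN : ∀ t, N u t = M u t + ε * (orb e l c T u t - orb e l c (T + 1) u t))
    (h : HasCharge (M u) f) : HasCharge (N u) f := by
  obtain ⟨n, n1, ⟨a, n2⟩, b, n3⟩ := h
  obtain ⟨s, hs⟩ := orb_col_finite (l := l) he c T u
  refine ⟨fun t => n t + ε * orb e l c T u t, fun t => ?_, ⟨min a (s - 1), fun t ht => ?_⟩,
    max b (s + 1), fun t ht => ?_⟩
  · have h1 := orb_up (e := e) (l := l) (c := c) (T := T) (u := u) (t := t - 1)
    rw [sub_add_cancel] at h1
    rw [hN, ← n1, h1]; ring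
  · simp only
    rw [hs t (by omega), n2 t (by omega)]; ring
  · simp only
    rw [hs t (by omega), n3 t (by omega)]; ring

theorem RowArr.hasCharge (he : 2 ≤ e) {T u f : ℤ} (h : RowArr e l T M N) :
    HasCharge (M u) f ↔ HasCharge (N u) f := by
  obtain ⟨D, c, -, hm⟩ := h
  rw [moves_dual_iff] at hm
  exact ⟨HasCharge.move he (ε := 1) (c := c) (T := T) fun t => by rw [hm]; ring,
    HasCharge.move he (ε := -1) (c := c) (T := T) fun t => by rw [hm]; ring⟩

variable {n : ℕ} {M' : ℤ → ℤ → ℤ}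

/-- In row `T` a shift inserts one hole at the crossing with layer `n` and delays the rest by one
column; the two effects on the charge cancel. -/
theorem IsShift.hasCharge_dual (hl : 2 ≤ l) (hM : IsConf e l M) (hM' : IsConf e l M')
    (h : IsShift n M M' τ) {T f : ℤ} (hc : HasCharge (dual M T) f) : HasCharge (dual M' T) f := by
  obtain ⟨m, m1, ⟨a, m2⟩, b, m3⟩ := hc
  obtain ⟨r, hr⟩ := h.enum.exists_last hl hM.toIsBits (h.mono n) (T - 1)
  have hr' : ∀ u, τ n u < T ↔ u ≤ r := fun u => by rw [hr]; omega
  refine ⟨fun u => if u ≤ r then m u else m (u - 1) + 1, fun u => ?_, ⟨min a r, fun u hu => ?_⟩,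
    max (b + 1) (r + 1), fun u hu => ?_⟩
  · have d1 := m1 u
    have d2 := m1 (u - 1)
    have p := fun ht => eq_of_one_iff (hM'.zero_or_one u T) (hM.zero_or_one u T) (h.below ht)
    have q := fun ht => eq_of_one_iff (hM'.zero_or_one u T) (hM.zero_or_one (u - 1) T)
      (h.above ht)
    have s := fun ht ht' => (hM'.zero_or_one u T).resolve_right (h.between ht ht')
    have e1 := hr' u
    have e2 := hr' (u - 1)
    unfold dual at *
    beta_reduce
    rcases lt_trichotomy u (r + 1) with hu | hu | hu
    · rw [if_pos (by omega), if_pos (by omega), p (by omega), d1]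
    · rw [if_neg (by omega), if_pos (by omega), s (by omega) (by omega)]; omega
    · rw [if_neg (by omega), if_neg (by omega), q (by omega)]; omega
  · simp only
    rw [if_pos (by omega), m2 u (by omega)]
  · simp only
    rw [if_neg (by omega), m3 (u - 1) (by omega)]; ring

end Charge

/-! ### Doubly highest weight configurations built from a staircase and a partition -/

/-- A monotone staircase. -/
structure IsStair (e l : ℤ) (F : ℤ → ℤ) : Prop where
  mono : Monotone F
  period : ∀ u, F (u + e) = F u + l

/-- The sequence of the parts of a partition. -/
structure IsPartSeq (κ : ℕ → ℕ) : Prop where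
  anti : Antitone κ
  finite : ∃ K, ∀ k ≥ K, κ k = 0

/-- The enumeration of the beads below a staircase, with the `k`-th layer shifted `κ k` steps to
the right. -/
def vertexEnum (F : ℤ → ℤ) (κ : ℕ → ℕ) : ℕ → ℤ → ℤ := fun k u => F (u - κ k) + k

section Vertex

variable {e l : ℤ} {M N : ℤ → ℤ → ℤ} {τ : ℕ → ℤ → ℤ} {F : ℤ → ℤ} {κ : ℕ → ℕ}

theorem vertexEnum_strictMono (hF : IsStair e l F) (hκ : IsPartSeq κ) (u : ℤ) :
    StrictMono fun k => vertexEnum F κ k u := by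
  intro j k hjk
  have h1 := hκ.anti hjk.le
  have h2 := hF.mono (show u - κ j ≤ u - κ k by omega)
  simp only [vertexEnum]
  omega

theorem vertexEnum_mono (hF : IsStair e l F) (k : ℕ) : Monotone (vertexEnum F κ k) := by
  intro u v huv
  have := hF.mono (show u - κ k ≤ v - κ k by omega)
  simp only [vertexEnum]
  omega

theorem IsStair.period_mul (hF : IsStair e l F) (u m : ℤ) : F (u + m * e) = F u + m * l := by
  induction m using Int.induction_on with
  | zero => simp
  | succ i ih => rw [show u + (i + 1) * e = u + i * e + e by ring, hF.period, ih]; ring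
  | pred i ih =>
    have := hF.period (u + (-(i : ℤ) - 1) * e)
    rw [show u + (-(i : ℤ) - 1) * e + e = u + -(i : ℤ) * e by ring, ih] at this
    linarith

theorem IsStair.bound (he : 2 ≤ e) (hF : IsStair e l F) (u : ℤ) :
    l * u - (|e * F 0| + l * e) ≤ e * F u ∧ e * F u ≤ l * u + (|e * F 0| + l * e) := by
  have h1 := Int.emod_nonneg u (show e ≠ 0 by omega)
  have h2 := Int.emod_lt_of_pos u (show 0 < e by omega)
  have h3 := Int.emod_add_mul_ediv u e
  have h4 := hF.period_mul (u % e) (u / e)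
  rw [show u % e + u / e * e = u by linarith] at h4
  have h5 := hF.mono h1
  have h6 := hF.mono h2.le
  have h7 := hF.period 0
  rw [zero_add] at h7
  have h8 : 0 ≤ l := by have := hF.mono (show (0 : ℤ) ≤ e by omega); omega
  have h9 := le_abs_self (e * F 0)
  have h10 := neg_abs_le (e * F 0)
  have h11 : e * F u - l * u = e * F (u % e) - l * (u % e) := by
    linear_combination e * h4 + l * h3
  have h12 : e * F 0 ≤ e * F (u % e) := mul_le_mul_of_nonneg_left h5 (by omega)
  have h13 : e * F (u % e) ≤ e * (F 0 + l) := mul_le_mul_of_nonneg_left (by omega) (by omega)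
  have h14 : l * (u % e) ≤ l * e := mul_le_mul_of_nonneg_left h2.le h8
  have h15 : 0 ≤ l * (u % e) := mul_nonneg h8 h1
  constructor
  · linarith
  · rw [mul_add] at h13; linarith

theorem exists_vertex (he : 2 ≤ e) (hF : IsStair e l F) (hκ : IsPartSeq κ) :
    ∃ M, IsConf e l M ∧ IsEnum M (vertexEnum F κ) := by
  classical
  obtain ⟨K, hK⟩ := hκ.finite
  have hmem : ∀ u t, (if ∃ k, vertexEnum F κ k u = t then (1 : ℤ) else 0) = 1 ↔
      ∃ k, vertexEnum F κ k u = t := fun u t => by split_ifs with h <;> simp [h]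
  have hl : 0 ≤ l := by
    have := hF.mono (show (0 : ℤ) ≤ e by omega)
    have := hF.period 0
    rw [zero_add] at this
    omega
  -- The bound has a part for the deviation of `F` from its slope, a part `e * K` because only the
  -- layers from `K` on are certainly unshifted, and a part `l * κ 0` because layer 0 is shifted the
  -- most.
  refine ⟨fun u t => if ∃ k, vertexEnum F κ k u = t then 1 else 0, ⟨⟨fun u t => ?_, fun u t => ?_⟩,
    (|e * F 0| + l * e) + e * K + l * κ 0 + 1, fun u t => ⟨fun h => ?_, fun h => ?_⟩⟩,
    ⟨vertexEnum_strictMono hF hκ, hmem⟩⟩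
  · split_ifs <;> simp
  · congr 1
    apply propext
    have : ∀ k, vertexEnum F κ k (u + e) = vertexEnum F κ k u + l := fun k => by
      have := hF.period (u - κ k)
      simp only [vertexEnum]
      rw [show u + e - (κ k : ℤ) = u - κ k + e by ring, this]; ring
    constructor <;> rintro ⟨k, hk⟩ <;> exact ⟨k, by have := this k; omega⟩
  · rw [hmem]
    obtain ⟨b1, b2⟩ := hF.bound he u
    have h0 : 0 ≤ l * κ 0 := by positivity
    have h1 : (K : ℤ) ≤ t - F u := by
      by_contra hc
      have : e * (t - F u) ≤ e * K := mul_le_mul_of_nonneg_left (by omega) (by omega)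
      rw [mul_sub] at this
      linarith
    refine ⟨(t - F u).toNat, ?_⟩
    rw [vertexEnum, hK _ (by omega)]
    simp only [Nat.cast_zero, sub_zero]
    omega
  · rw [if_neg]
    rintro ⟨k, hk⟩
    have h1 := (vertexEnum_strictMono hF hκ u).monotone (Nat.zero_le k)
    rw [hk] at h1
    simp only [vertexEnum, Nat.cast_zero, add_zero] at h1
    obtain ⟨b1, b2⟩ := hF.bound he (u - κ 0)
    have h2 : e * F (u - κ 0) ≤ e * t := mul_le_mul_of_nonneg_left h1 (by omega)
    rw [mul_sub] at b1
    have : 0 ≤ e * K := by positivity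
    linarith

theorem vertex_hasCharge (he : 2 ≤ e) (hκ : IsPartSeq κ) (hM : IsConf e l M)
    (h : IsEnum M (vertexEnum F κ)) (u : ℤ) : HasCharge (M u) (F u) := by
  obtain ⟨K, hK⟩ := hκ.finite
  exact hasCharge_of_enum he hM h (K := K) fun k hk => by simp [vertexEnum, hK k hk]

/-- A source of both crystals. -/
def IsDoublyHighestConf (e l : ℤ) (M : ℤ → ℤ → ℤ) : Prop :=
  IsHighest e l M ∧ IsHighest l e (dual M)

theorem IsPartSeq.pred (hκ : IsPartSeq κ) : IsPartSeq fun k => κ k - 1 :=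
  ⟨fun j k hjk => Nat.sub_le_sub_right (hκ.anti hjk) 1, by
    obtain ⟨K, hK⟩ := hκ.finite
    exact ⟨K, fun k hk => by rw [hK k hk]⟩⟩

/-- Removing the first column of `κ` undoes a shift. -/
theorem exists_isShift (he : 2 ≤ e) (hF : IsStair e l F) (hκ : IsPartSeq κ) (h0 : 0 < κ 0)
    (h : IsEnum M (vertexEnum F κ)) :
    ∃ n N, IsConf e l N ∧ IsShift n N M (vertexEnum F fun k => κ k - 1) := by
  obtain ⟨K, hK⟩ := hκ.finite
  obtain ⟨N, hN, hN'⟩ := exists_vertex he hF hκ.pred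
  have hex : ∃ n, κ (n + 1) = 0 := ⟨K, hK _ (by omega)⟩
  classical
  -- The least `n` with `κ (n + 1) = 0`: since `κ 0 > 0`, the indices `k ≤ n` are those with `κ k >
  -- 0`.
  refine ⟨Nat.find hex, N, hN, hN', fun k => vertexEnum_mono hF k, ?_⟩
  convert h using 1
  funext k u
  unfold shiftEnum
  split_ifs with hk
  · have : 0 < κ k := by
      rcases Nat.eq_zero_or_pos k with rfl | hk0
      · exact h0
      · have := Nat.find_min hex (m := k - 1) (by omega)
        rw [Nat.sub_add_cancel hk0] at this
        omega
    simp only [vertexEnum]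
    rw [show u - 1 - ((κ k - 1 : ℕ) : ℤ) = u - κ k by omega]
  · have h1 := Nat.find_spec hex
    have h2 := hκ.anti (show Nat.find hex + 1 ≤ k by omega)
    have : κ k = 0 := by omega
    simp [vertexEnum, this]

/-- Without shifts every bead has a bead directly above it, so no bead of row `T` lies below a hole
of row `T + 1`. -/
theorem vertex_zero_dual (hl : 2 ≤ l) (hM : IsConf e l M)
    (h : IsEnum M (vertexEnum F κ)) (h0 : ∀ k, κ k = 0) : IsHighest l e (dual M) := by
  rw [isHighest_iff_no_raise hl hM.dual]
  intro T D c hr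
  obtain ⟨b1, b2, -⟩ := hr.bits (hM.dual.zero_or_one _ _) (hM.dual.zero_or_one _ _)
  unfold dual at b1 b2
  have h1 : M c T = 1 := by omega
  rw [h.mem] at h1
  obtain ⟨k, hk⟩ := h1
  have h2 : M c (T + 1) = 1 := by
    rw [h.mem]
    refine ⟨k + 1, ?_⟩
    simp only [vertexEnum, h0] at *
    push_cast at *
    omega
  omega

/-- Induction on the first part: a shift removes the first column of `κ`. A property that holds for
empty `κ` and survives shifts holds for every vertex with the given `F`. -/
theorem vertex_induction (he : 2 ≤ e) (hF : IsStair e l F) {P : (ℤ → ℤ → ℤ) → Prop}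
    (base : ∀ M, IsConf e l M → IsEnum M (vertexEnum F fun _ => 0) → P M)
    (step : ∀ n M M' τ, IsConf e l M → IsConf e l M' → IsShift n M M' τ → P M → P M')
    (hκ : IsPartSeq κ) (hM : IsConf e l M) (h : IsEnum M (vertexEnum F κ)) : P M := by
  induction hm : κ 0 using Nat.strong_induction_on generalizing κ M with
  | _ m ih =>
    subst hm
    rcases Nat.eq_zero_or_pos (κ 0) with h0 | h0
    · have : κ = fun _ => 0 := by
        funext k
        have := hκ.anti (Nat.zero_le k)
        omega
      exact base M hM (this ▸ h)
    · obtain ⟨n, N, hN, hs⟩ := exists_isShift he hF hκ h0 h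
      exact step n N M _ hN hM hs (ih (κ 0 - 1) (by omega) hκ.pred hN hs.enum rfl)

theorem vertex_isDoublyHighest (he : 2 ≤ e) (hl : 2 ≤ l) (hF : IsStair e l F) (hκ : IsPartSeq κ)
    (hM : IsConf e l M) (h : IsEnum M (vertexEnum F κ)) : IsDoublyHighestConf e l M := by
  refine ⟨(isHighest_iff he hM h).2 fun k => vertexEnum_mono hF k, ?_⟩
  exact vertex_induction he hF (P := fun M => IsHighest l e (dual M))
    (fun M hM h => vertex_zero_dual hl hM h fun _ => rfl)
    (fun n M M' τ hM hM' hs hP => (hs.isHighest_dual_iff hl hM hM').1 hP) hκ hM h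

/-- The row charges of a doubly highest weight configuration form the staircase that is adjoint
to that of the column charges. -/
theorem vertex_hasCharge_dual (he : 2 ≤ e) (hl : 2 ≤ l) (hF : IsStair e l F) (hκ : IsPartSeq κ)
    (hM : IsConf e l M) (h : IsEnum M (vertexEnum F κ)) {T f : ℤ} (hf : ∀ u, u < f ↔ F u ≤ T) :
    HasCharge (dual M T) f := by
  refine vertex_induction he hF (P := fun M => HasCharge (dual M T) f) (fun M hM h => ?_)
    (fun n M M' τ hM hM' hs hP => hs.hasCharge_dual hl hM hM' hP) hκ hM h
  have hbit : ∀ u, M u T = if u < f then 1 else 0 := by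
    intro u
    have h1 := hM.zero_or_one u T
    have h2 := h.mem u T
    have h3 : (∃ k, vertexEnum F (fun _ => 0) k u = T) ↔ u < f := by
      rw [hf]
      simp only [vertexEnum, Nat.cast_zero, sub_zero]
      exact ⟨fun ⟨k, hk⟩ => by omega, fun hu => ⟨(T - F u).toNat, by omega⟩⟩
    rw [h3] at h2
    split_ifs with hu
    · exact h2.2 hu
    · exact h1.resolve_right fun h1 => hu (h2.1 h1)
  refine ⟨fun u => if u < f then 0 else u - f + 1, fun u => ?_, ⟨f - 1, fun u hu => ?_⟩, f,
    fun u hu => ?_⟩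
  · unfold dual; rw [hbit]; beta_reduce; split_ifs <;> omega
  · simp only; rw [if_pos (by omega)]
  · simp only; rw [if_neg (by omega)]

end Vertex


/-! ### Classification of the doubly highest weight configurations -/

variable {e l : ℤ} {M : ℤ → ℤ → ℤ} {τ : ℕ → ℤ → ℤ}

theorem count_nonneg {A n : ℤ → ℤ} (hA : ∀ t, A t = 0 ∨ A t = 1)
    (hn : ∀ t, n t - n (t - 1) = A t) {a : ℤ} (h0 : ∀ t ≤ a, n t = 0) (t : ℤ) : 0 ≤ n t := by
  have hmon : Monotone n := monotone_int_of_le_succ fun t => by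
    have := hn (t + 1)
    have := hA (t + 1)
    simp only [add_sub_cancel_right] at *
    omega
  have := h0 (min t a) (min_le_right _ _)
  have := hmon (min_le_left t a)
  omega

theorem IsHighest.count_le (he : 2 ≤ e) (hM : IsConf e l M) (h : IsHighest e l M) {U : ℤ}
    {n n' : ℤ → ℤ} (n1 : ∀ t, n t - n (t - 1) = M U t) (n1' : ∀ t, n' t - n' (t - 1) = M (U + 1) t)
    {a a' : ℤ} (n2 : ∀ t ≤ a, n t = 0) (n2' : ∀ t ≤ a', n' t = 0) (n3 : ∀ t ≤ a, M U t = 0)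
    (n3' : ∀ t ≤ a', M (U + 1) t = 0) (t : ℤ) : n' t ≤ n t := by
  obtain ⟨τ, hτ⟩ := hM.exists_enum he
  have c1 := hτ.count (hM.zero_or_one U) n1 (n2 a le_rfl) n3
  have c2 := hτ.count (hM.zero_or_one (U + 1)) n1' (n2' a' le_rfl) n3'
  by_contra hc
  have hn0 := count_nonneg (hM.zero_or_one U) n1 n2 t
  have h1 := c1 (n t).toNat t
  have h2 := c2 (n t).toNat t
  rw [Int.toNat_of_nonneg hn0] at h1 h2
  have h3 := h2.1 (by omega)
  have h4 := (isHighest_iff he hM hτ).1 h (n t).toNat (show U ≤ U + 1 by omega)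
  have h5 := h1.2 (h4.trans h3)
  omega

/-- Each column is eventually filled; periodicity reduces the choice of a common threshold to the
`e` columns of one period. -/
theorem IsEnum.eventually_charge (he : 2 ≤ e) (hM : IsConf e l M) (h : IsEnum M τ) :
    ∃ (F : ℤ → ℤ) (K : ℕ), ∀ k ≥ K, ∀ u, τ k u = F u + k := by
  choose F hF using hM.exists_charge he
  choose K hK using fun u => (hF u).enum he hM h
  have hper : ∀ u, F (u + e) = F u + l := fun u => by
    have h1 := hK (u + e) (max (K u) (K (u + e))) (le_max_right _ _)
    have h2 := hK u (max (K u) (K (u + e))) (le_max_left _ _)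
    have h3 := h.period hM.toIsBits (max (K u) (K (u + e))) u
    omega
  have hper' : ∀ u m : ℤ, F (u + m * e) = F u + m * l := fun u m => by
    induction m using Int.induction_on with
    | zero => simp
    | succ i ih => rw [show u + (i + 1) * e = u + i * e + e by ring, hper, ih]; ring
    | pred i ih =>
      have := hper (u + (-(i : ℤ) - 1) * e)
      rw [show u + (-(i : ℤ) - 1) * e + e = u + -(i : ℤ) * e by ring, ih] at this
      linarith
  refine ⟨F, (Finset.Ico 0 e).sup K, fun k hk u => ?_⟩
  have h1 := Int.emod_nonneg u (show e ≠ 0 by omega)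
  have h2 := Int.emod_lt_of_pos u (show 0 < e by omega)
  have h3 := Int.emod_add_mul_ediv u e
  have h4 : K (u % e) ≤ (Finset.Ico 0 e).sup K := Finset.le_sup (by simp; omega)
  have h5 := hK (u % e) k (by omega)
  have h6 := h.period_mul hM.toIsBits k (u % e) (u / e)
  have h7 := hper' (u % e) (u / e)
  rw [show u % e + u / e * e = u by linarith] at h6 h7
  rw [h6, h5, h7]; ring

/-- The shape of the doubly highest weight configurations. -/
theorem IsDoublyHighestConf.exists_vertex (he : 2 ≤ e) (hl : 2 ≤ l) (hM : IsConf e l M)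
    (h : IsDoublyHighestConf e l M) :
    ∃ F κ, IsStair e l F ∧ IsPartSeq κ ∧ IsEnum M (vertexEnum F κ) := by
  obtain ⟨τ, hτ⟩ := hM.exists_enum he
  have mono := (isHighest_iff he hM hτ).1 h.1
  -- `q k T` is the last column in which layer `k` has not risen above row `T`. Below, `n T u`
  -- counts the holes of row `T` up to column `u`.
  choose q hq using fun k T => hτ.exists_last hl hM.toIsBits (mono k) T
  choose n a n1 n2 n3 using fun T => hM.dual.exists_count hl T
  have hle : ∀ T u, n (T + 1) u ≤ n T u := fun T u =>
    h.2.count_le hl hM.dual (n1 T) (n1 (T + 1)) (n2 T) (n2 (T + 1)) (n3 T) (n3 (T + 1)) u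
  have hlt : ∀ k u, τ k u < τ (k + 1) u := fun k u => hτ.lt_iff.2 (Nat.lt_add_one k)
  -- the lengths of the horizontal pieces of consecutive layers
  have key : ∀ (k : ℕ) T, (n T (q k T) - n (T + 1) (q k T)) -
      (n T (q (k + 1) T) - n (T + 1) (q (k + 1) T)) =
      (q k (T - 1) - q (k + 1) T) - (q k T - q (k + 1) (T + 1)) := by
    intro k T
    have o1 : q (k + 1) T ≤ q k (T - 1) := by
      rw [hq]; have := (hq (k + 1) T _).1 le_rfl; have := hlt k (q (k + 1) T); omega
    have o2 : q k (T - 1) ≤ q k T := by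
      rw [hq]; have := (hq k (T - 1) _).1 le_rfl; omega
    have o3 : q (k + 1) T ≤ q (k + 1) (T + 1) := by
      rw [hq]; have := (hq (k + 1) T _).1 le_rfl; omega
    have o4 : q (k + 1) (T + 1) ≤ q k T := by
      rw [hq]; have := (hq (k + 1) (T + 1) _).1 le_rfl; have := hlt k (q (k + 1) (T + 1)); omega
    have gap : ∀ t u, t < τ (k + 1) u → τ k u < t → M u t = 0 := by
      intro t u h1 h2
      refine (hM.zero_or_one u t).resolve_right fun h3 => ?_
      obtain ⟨j, rfl⟩ := (hτ.mem u t).1 h3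
      have := hτ.lt_iff.1 h1
      have := hτ.lt_iff.1 h2
      omega
    have i1 := const_between (D := fun u => n T u - u) (a := q (k + 1) T) (b := q k (T - 1))
      (fun u h1 h2 => by
        have h3 := gap T u (by have := mt (hq (k + 1) T u).2 (by omega); omega)
          (by have := (hq k (T - 1) u).1 h2; omega)
        have := n1 T u
        unfold dual at this
        beta_reduce; omega) o1
    have i2 := const_between (D := n T) (a := q k (T - 1)) (b := q k T)
      (fun u h1 h2 => by
        have h3 : τ k u = T := by
          have := mt (hq k (T - 1) u).2 (by omega); have := (hq k T u).1 h2; omega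
        have h4 := hτ.one k u
        have := n1 T u
        unfold dual at this
        rw [h3] at h4; omega) o2
    have i3 := const_between (D := n (T + 1)) (a := q (k + 1) T) (b := q (k + 1) (T + 1))
      (fun u h1 h2 => by
        have h3 : τ (k + 1) u = T + 1 := by
          have := mt (hq (k + 1) T u).2 (by omega); have := (hq (k + 1) (T + 1) u).1 h2; omega
        have h4 := hτ.one (k + 1) u
        have := n1 (T + 1) u
        unfold dual at this
        rw [h3] at h4; omega) o3
    have i4 := const_between (D := fun u => n (T + 1) u - u) (a := q (k + 1) (T + 1)) (b := q k T)
      (fun u h1 h2 => by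
        have h3 := gap (T + 1) u (by have := mt (hq (k + 1) (T + 1) u).2 (by omega); omega)
          (by have := (hq k T u).1 h2; omega)
        have := n1 (T + 1) u
        unfold dual at this
        beta_reduce; omega) o4
    beta_reduce at i1 i4
    omega
  have hqper : ∀ k T, q k (T + l) = q k T + e := by
    intro k T
    have hper := hτ.period hM.toIsBits k
    refine le_antisymm ?_ ?_
    · have h1 := (hq k (T + l) _).1 le_rfl
      have h2 := hper (q k (T + l) - e)
      rw [sub_add_cancel] at h2
      have := (hq k T (q k (T + l) - e)).2 (by omega)
      omega
    · rw [hq, hper]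
      have := (hq k T _).1 le_rfl
      omega
  have hδper : ∀ (k : ℕ) T, q k (T + l) - q (k + 1) (T + l + 1) = q k T - q (k + 1) (T + 1) := by
    intro k T
    rw [hqper, show T + l + 1 = T + 1 + l by ring, hqper]; ring
  obtain ⟨F, K, hK⟩ := hτ.eventually_charge he hM
  -- The excesses `n T (q k T) - n (T + 1) (q k T)` are nonnegative because `M` is a row source.
  -- Their sum over one period of rows does not depend on `k` and vanishes for large `k`, so all of
  -- them vanish.
  have hzero : ∀ k T, n T (q k T) - n (T + 1) (q k T) = 0 := by
    -- For large `k` the column `q k T` lies so far to the left that neither row has a hole up to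
    -- it.
    have hlast : ∀ T, ∃ k₀, ∀ k ≥ k₀, n T (q k T) - n (T + 1) (q k T) = 0 := by
      intro T
      set a₀ := min (a T) (a (T + 1)) with ha₀
      refine ⟨(T - τ 0 a₀ + 1).toNat, fun k hk => ?_⟩
      have hk' : ∀ k : ℕ, τ 0 a₀ + k ≤ τ k a₀ := fun k => by
        induction k with
        | zero => simp
        | succ k ih => have := hlt k a₀; push_cast; omega
      have h1 := mt (hq k T a₀).1 (by have := hk' k; omega)
      rw [n2 T _ (by omega), n2 (T + 1) _ (by omega)]; rfl
    -- By `key` the change from `k` to `k + 1` is a difference in `T` of the quantity `q k T - q (k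
    -- + 1) (T + 1)`, which is periodic; the sum over a period telescopes to zero.
    have hsum : ∀ k : ℕ, ∑ i ∈ Finset.range l.toNat, (n i (q k i) - n (i + 1) (q k i)) =
        ∑ i ∈ Finset.range l.toNat, (n i (q (k + 1) i) - n (i + 1) (q (k + 1) i)) := by
      intro k
      rw [← sub_eq_zero, ← Finset.sum_sub_distrib]
      have h1 := Finset.sum_range_sub' (fun i : ℕ => q k ((i : ℤ) - 1) - q (k + 1) i) l.toNat
      have h2 := hδper k (-1)
      rw [Int.toNat_of_nonneg (by omega)] at h1
      rw [show -1 + l = l - 1 by ring, sub_add_cancel] at h2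
      rw [h2] at h1
      simp only [Nat.cast_zero, zero_sub, neg_add_cancel, sub_self] at h1
      rw [← h1]
      refine Finset.sum_congr rfl fun i _ => ?_
      rw [key]
      push_cast
      simp
    have hsum0 : ∀ k : ℕ, ∑ i ∈ Finset.range l.toNat, (n i (q k i) - n (i + 1) (q k i)) = 0 := by
      choose k₀ hk₀ using hlast
      set K₀ := (Finset.range l.toNat).sup fun i : ℕ => k₀ i
      intro k
      have h1 : ∀ j, ∑ i ∈ Finset.range l.toNat, (n i (q k i) - n (i + 1) (q k i)) =
          ∑ i ∈ Finset.range l.toNat, (n i (q (k + j) i) - n (i + 1) (q (k + j) i)) := by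
        intro j
        induction j with
        | zero => rfl
        | succ j ih => rw [ih, hsum]; rfl
      rw [h1 K₀]
      refine Finset.sum_eq_zero fun i hi => hk₀ i _ ?_
      have : k₀ i ≤ K₀ := Finset.le_sup (f := fun i : ℕ => k₀ i) hi
      omega
    have hzero' : ∀ k T, 0 ≤ T → T < l → n T (q k T) - n (T + 1) (q k T) = 0 := by
      intro k T h0 h1
      have := (Finset.sum_eq_zero_iff_of_nonneg fun i _ => by
        have := hle i (q k i); omega).1 (hsum0 k) T.toNat (by simp; omega)
      rwa [Int.toNat_of_nonneg h0] at this
    have hδ : ∀ k T, 0 ≤ T → T < l →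
        q k (T - 1) - q (k + 1) T = q k T - q (k + 1) (T + 1) := by
      intro k T h0 h1
      have := key k T
      rw [hzero' k T h0 h1, hzero' (k + 1) T h0 h1] at this
      omega
    have hδ' : ∀ (k : ℕ) (T m : ℤ), q k (T + m * l) - q (k + 1) (T + m * l + 1) =
        q k T - q (k + 1) (T + 1) := by
      intro k T m
      induction m using Int.induction_on with
      | zero => simp
      | succ i ih => rw [← ih, ← hδper k (T + i * l)]; congr 2 <;> ring
      | pred i ih =>
        rw [← ih, ← hδper]; congr 2 <;> ring
    intro k T
    obtain ⟨k₁, hk₁⟩ := hlast T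
    have hstep : ∀ k, n T (q k T) - n (T + 1) (q k T) =
        n T (q (k + 1) T) - n (T + 1) (q (k + 1) T) := by
      intro k
      have h1 := Int.emod_nonneg T (show l ≠ 0 by omega)
      have h2 := Int.emod_lt_of_pos T (show 0 < l by omega)
      have h3 := Int.emod_add_mul_ediv T l
      have h4 := hδ k (T % l) h1 h2
      have h5 := hδ' k (T % l) (T / l)
      have h6 := hδ' k (T % l - 1) (T / l)
      rw [show T % l + T / l * l = T by linarith] at h5
      rw [show T % l - 1 + T / l * l = T - 1 by linarith, sub_add_cancel, sub_add_cancel] at h6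
      have h7 := key k T
      omega
    have hj : ∀ j, n T (q k T) - n (T + 1) (q k T) =
        n T (q (k + j) T) - n (T + 1) (q (k + j) T) := by
      intro j
      induction j with
      | zero => rfl
      | succ j ih => rw [ih, hstep]; rfl
    rw [hj k₁, hk₁ _ (by omega)]
  -- Once the excesses vanish, `key` makes this quantity independent of `T`: layer `k + 1` is layer
  -- `k` raised by one and translated to the left by a constant `d k`.
  have hconst : ∀ (k : ℕ) T, q k T - q (k + 1) (T + 1) = q k 0 - q (k + 1) (0 + 1) := by
    intro k T
    have := potential_sub (D := fun T => q k T - q (k + 1) (T + 1)) (D' := fun _ => 0)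
      (fun T => by
        have := key k T
        rw [hzero, hzero] at this
        rw [sub_add_cancel]; omega) T 0
    simpa using this
  have hnn : ∀ k : ℕ, 0 ≤ q k 0 - q (k + 1) (0 + 1) := fun k => by
    have := (hq (k + 1) (0 + 1) _).1 le_rfl
    have := hlt k (q (k + 1) (0 + 1))
    have := (hq k 0 (q (k + 1) (0 + 1))).2 (by omega)
    omega
  obtain ⟨d, hd⟩ : ∃ d : ℕ → ℕ, ∀ k, (d k : ℤ) = q k 0 - q (k + 1) (0 + 1) :=
    ⟨fun k => (q k 0 - q (k + 1) (0 + 1)).toNat, fun k => Int.toNat_of_nonneg (hnn k)⟩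
  have hrel : ∀ k u, τ (k + 1) (u - d k) = τ k u + 1 := by
    intro k u
    refine le_antisymm ?_ ?_
    · rw [← hq]
      have := (hq k (τ k u) u).2 le_rfl
      have := hconst k (τ k u)
      have := hd k
      omega
    · have h1 := (hq (k + 1) (τ (k + 1) (u - d k) - 1 + 1) (u - d k)).2 (by omega)
      have h2 := hconst k (τ (k + 1) (u - d k) - 1)
      have h3 := (hq k (τ (k + 1) (u - d k) - 1) u).1 (by have := hd k; omega)
      omega
  have hdz : ∀ k ≥ K, d k = 0 := by
    intro k hk
    have h1 := hrel k (q (k + 1) 0 + d k)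
    rw [add_sub_cancel_right, hK k hk, hK (k + 1) (by omega)] at h1
    have h2 := (hq (k + 1) 0 (q (k + 1) 0)).1 le_rfl
    have h3 := (hq (k + 1) 0 (q (k + 1) 0 + d k)).2 (by
      rw [hK (k + 1) (by omega)] at h2 ⊢
      push_cast at *
      omega)
    omega
  -- The displacement of layer `k` relative to the unshifted layers from `K` on is the sum of the
  -- successive displacements `d i`.
  refine ⟨F, fun k => ∑ i ∈ Finset.Ico k K, d i, ⟨fun u v huv => ?_, fun u => ?_⟩,
    ⟨fun i j hij => Finset.sum_le_sum_of_subset (Finset.Ico_subset_Ico_left hij),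
      K, fun k hk => by rw [Finset.Ico_eq_empty (by omega), Finset.sum_empty]⟩, ?_⟩
  · have := mono K huv
    rw [hK K le_rfl, hK K le_rfl] at this
    omega
  · have := hτ.period hM.toIsBits K u
    rw [hK K le_rfl, hK K le_rfl] at this
    omega
  · convert hτ using 1
    have main : ∀ j k u, k + j = K → τ k u = F (u - (∑ i ∈ Finset.Ico k K, d i : ℕ)) + k := by
      intro j
      induction j with
      | zero =>
        intro k u hk
        rw [Finset.Ico_eq_empty (by omega), Finset.sum_empty, hK k (by omega)]
        simp
      | succ j ih =>
        intro k u hk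
        have h1 := ih (k + 1) (u - d k) (by omega)
        rw [hrel] at h1
        rw [Finset.sum_eq_sum_Ico_succ_bot (by omega)]
        push_cast at *
        rw [show u - ((d k : ℤ) + ∑ i ∈ Finset.Ico (k + 1) K, (d i : ℤ)) =
          u - d k - ∑ i ∈ Finset.Ico (k + 1) K, (d i : ℤ) by ring]
        omega
    funext k u
    rcases le_or_gt k K with hk | hk
    · rw [main (K - k) k u (by omega)]; rfl
    · rw [hK k hk.le]
      simp only [vertexEnum]
      rw [Finset.Ico_eq_empty (by omega), Finset.sum_empty]; simp


/-! ### Components of commuting families of arrows -/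

section Reach

variable {ι ι' X Y : Type*}

/-- Arrows followed forwards (`true`) or backwards (`false`). -/
def twoWay (R : ι → X → X → Prop) : ι × Bool → X → X → Prop
  | (a, true), v, w => R a v w
  | (a, false), v, w => R a w v

/-- The family of relations is stable under reversal. -/
def IsSymm (A : ι → X → X → Prop) : Prop := ∀ a, ∃ a', ∀ v w, A a v w ↔ A a' w v

def IsFunctional (A : ι → X → X → Prop) : Prop := ∀ a v w w', A a v w → A a v w' → w = w'

theorem twoWay_isSymm (R : ι → X → X → Prop) : IsSymm (twoWay R)
  | (a, true) => ⟨(a, false), fun _ _ => Iff.rfl⟩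
  | (a, false) => ⟨(a, true), fun _ _ => Iff.rfl⟩

theorem IsFunctional.injective {A : ι → X → X → Prop} (hA : IsFunctional A) (hs : IsSymm A) {a : ι}
    {v v' w : X} (h : A a v w) (h' : A a v' w) : v = v' := by
  obtain ⟨a', ha⟩ := hs a
  exact hA a' w v v' ((ha _ _).1 h) ((ha _ _).1 h')

/-- `v` and `w` are linked by a path. -/
def Reach (A : ι → X → X → Prop) : X → X → Prop := Relation.ReflTransGen fun v w => ∃ a, A a v w

/-- Two paths with the same labels link `x` to `v` and `y` to `w`. -/
def PairReach (A : ι → X → X → Prop) : X × X → X × X → Prop :=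
  Relation.ReflTransGen fun p q => ∃ a, A a p.1 q.1 ∧ A a p.2 q.2

variable {A : ι → X → X → Prop} {E : ι → X → X → Prop} {L : ι' → X → X → Prop}

theorem Reach.symm (hs : IsSymm A) {v w : X} (h : Reach A v w) : Reach A w v := by
  refine @Relation.ReflTransGen.stdSymm _ _ ⟨?_⟩ |>.symm _ _ h
  rintro x y ⟨a, ha⟩
  obtain ⟨a', h'⟩ := hs a
  exact ⟨a', (h' _ _).1 ha⟩

theorem PairReach.symm (hs : IsSymm A) {p q : X × X} (h : PairReach A p q) :
    PairReach A q p := by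
  refine @Relation.ReflTransGen.stdSymm _ _ ⟨?_⟩ |>.symm _ _ h
  rintro x y ⟨a, ha⟩
  obtain ⟨a', h'⟩ := hs a
  exact ⟨a', (h' _ _).1 ha.1, (h' _ _).1 ha.2⟩

theorem PairReach.swap {p q : X × X} (h : PairReach A p q) : PairReach A p.swap q.swap :=
  Relation.ReflTransGen.lift Prod.swap (fun _ _ ⟨a, h1, h2⟩ => ⟨a, h2, h1⟩) _ _ h

theorem PairReach.fst {p q : X × X} (h : PairReach A p q) : Reach A p.1 q.1 :=
  Relation.ReflTransGen.lift Prod.fst (fun _ _ ⟨a, h1, _⟩ => ⟨a, h1⟩) _ _ h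

theorem PairReach.diag {x y : X} (h : Reach A x y) : PairReach A (x, x) (y, y) :=
  Relation.ReflTransGen.lift (fun z => (z, z)) (fun _ _ ⟨a, h1⟩ => ⟨a, h1, h1⟩) _ _ h

/-- Sending `x` to `y` extends to a map from the component of `x` that is compatible with all
arrows. -/
def Emb (A : ι → X → X → Prop) (x y : X) : Prop :=
  (∀ v w w', PairReach A (x, y) (v, w) → PairReach A (x, y) (v, w') → w = w') ∧
    ∀ v w, PairReach A (x, y) (v, w) → ∀ a v', A a v v' → ∃ w', A a w w'

/-- An embedding of a component is obtained from any functional relation through which arrows lift: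
the pairs reached by equal label sequences all satisfy it. -/
theorem Emb.of_rel {x y : X} (D : X → X → Prop) (h0 : D x y)
    (h1 : ∀ v w w', D v w → D v w' → w = w')
    (h2 : ∀ a v w v', D v w → A a v v' → ∃ w', A a w w' ∧ D v' w') (hA : IsFunctional A) :
    Emb A x y := by
  have key : ∀ q, PairReach A (x, y) q → D q.1 q.2 := by
    intro q h
    induction h with
    | refl => exact h0
    | tail _ h ih =>
      obtain ⟨a, ha, hb⟩ := h
      obtain ⟨w', h3, h4⟩ := h2 a _ _ _ ih ha
      rwa [hA _ _ _ _ hb h3]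
  refine ⟨fun v w w' h h' => h1 v w w' (key _ h) (key _ h'), fun v w h a v' hv => ?_⟩
  obtain ⟨w', h3, -⟩ := h2 a _ _ _ (key _ h) hv
  exact ⟨w', h3⟩

theorem Emb.refl (hA : IsFunctional A) (x : X) : Emb A x x :=
  Emb.of_rel Eq rfl (fun _ _ _ h h' => h.symm.trans h')
    (fun _ _ _ v' h h' => ⟨v', h ▸ h', rfl⟩) hA

theorem Emb.exists_of_reach {x y v : X} (h : Emb A x y) (hv : Reach A x v) :
    ∃ w, PairReach A (x, y) (v, w) := by
  induction hv with
  | refl => exact ⟨y, .refl⟩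
  | tail _ h' ih =>
    obtain ⟨w, hw⟩ := ih
    obtain ⟨a, ha⟩ := h'
    obtain ⟨w', hw'⟩ := h.2 _ _ hw a _ ha
    exact ⟨w', hw.tail ⟨a, ha, hw'⟩⟩

theorem Emb.trans (hA : IsFunctional A) {x y z : X} (h : Emb A x y) (h' : Emb A y z) :
    Emb A x z := by
  refine Emb.of_rel (fun v w => ∃ u, PairReach A (x, y) (v, u) ∧ PairReach A (y, z) (u, w))
    ⟨y, .refl, .refl⟩ ?_ ?_ hA
  · rintro v w w' ⟨u, h1, h2⟩ ⟨u', h3, h4⟩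
    obtain rfl := h.1 _ _ _ h1 h3
    exact h'.1 _ _ _ h2 h4
  · rintro a v w v' ⟨u, h1, h2⟩ ha
    obtain ⟨u', hu⟩ := h.2 _ _ h1 a _ ha
    obtain ⟨w', hw⟩ := h'.2 _ _ h2 a _ hu
    exact ⟨w', hw, u', h1.tail ⟨a, ha, hu⟩, h2.tail ⟨a, hu, hw⟩⟩

theorem Emb.of_injective {B : ι' → Y → Y → Prop} {f : X → Y} {g : ι → ι'}
    (hA : IsFunctional A)
    (hAB : ∀ a v w, A a v w ↔ B (g a) (f v) (f w)) (hf : Function.Injective f)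
    (hB : ∀ a v y, B (g a) (f v) y → ∃ w, f w = y) {x y : X} (h : Emb B (f x) (f y)) :
    Emb A x y := by
  refine Emb.of_rel (fun v w => PairReach B (f x, f y) (f v, f w)) .refl
    (fun v w w' h1 h2 => hf (h.1 _ _ _ h1 h2)) (fun a v w v' h1 h2 => ?_) hA
  obtain ⟨z, hz⟩ := h.2 _ _ h1 (g a) (f v') ((hAB _ _ _).1 h2)
  obtain ⟨w', rfl⟩ := hB a _ _ hz
  exact ⟨w', (hAB _ _ _).2 hz, h1.tail ⟨_, (hAB _ _ _).1 h2, hz⟩⟩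

/-- Arrows of the two families commute. -/
def Squares (E : ι → X → X → Prop) (L : ι' → X → X → Prop) : Prop :=
  ∀ a b x y z, E a x y → L b x z → ∃ t, E a z t ∧ L b y t

theorem Squares.flip (h : Squares E L) : Squares L E := fun a b x y z h1 h2 => by
  obtain ⟨t, h3, h4⟩ := h b a x z y h2 h1
  exact ⟨t, h4, h3⟩

theorem Squares.pair_step (h : Squares E L) {p q : X × X} (hp : PairReach E p q) {b : ι'} {r : X × X}
    (h1 : L b p.1 r.1) (h2 : L b p.2 r.2) :
    ∃ t, PairReach E r t ∧ L b q.1 t.1 ∧ L b q.2 t.2 := by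
  induction hp with
  | refl => exact ⟨r, .refl, h1, h2⟩
  | tail _ hs ih =>
    obtain ⟨t, h3, h4, h5⟩ := ih
    obtain ⟨a, ha, hb⟩ := hs
    obtain ⟨t1, h6, h7⟩ := h a b _ _ _ ha h4
    obtain ⟨t2, h8, h9⟩ := h a b _ _ _ hb h5
    exact ⟨(t1, t2), h3.tail ⟨a, h6, h8⟩, h7, h9⟩

theorem Squares.pair_grid (h : Squares E L) {p q r : X × X} (hq : PairReach E p q)
    (hr : PairReach L p r) : ∃ t, PairReach E r t ∧ PairReach L q t := by
  induction hr with
  | refl => exact ⟨q, hq, .refl⟩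
  | tail _ hs ih =>
    obtain ⟨t, h1, h2⟩ := ih
    obtain ⟨b, h3, h4⟩ := hs
    obtain ⟨t', h5, h6, h7⟩ := h.pair_step h1 h3 h4
    exact ⟨t', h5, h2.tail ⟨b, h6, h7⟩⟩

theorem Squares.grid (h : Squares E L) {x y z : X} (hy : Reach E x y) (hz : Reach L x z) :
    ∃ t, Reach E z t ∧ Reach L y t := by
  obtain ⟨t, h1, h2⟩ := h.pair_grid (PairReach.diag hy) (PairReach.diag hz)
  exact ⟨t.1, h1.fst, h2.fst⟩

/-- Parallel arrows of `L` carry `E`-paths out of their ends back to `E`-paths out of their starting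
points, where the embedding property is known; arrows of `L` are injective, so it carries over. -/
theorem Squares.emb (h : Squares E L) (hL : IsFunctional L) (hLs : IsSymm L)
    {x y x' y' : X} (hr : PairReach L (x, y) (x', y')) (he : Emb E x y) : Emb E x' y' := by
  have key : ∀ r, PairReach L (x, y) r → Emb E r.1 r.2 := by
    intro r hr
    induction hr with
    | refl => exact he
    | tail _ hs ih =>
      rename_i p r _
      obtain ⟨b, h1, h2⟩ := hs
      obtain ⟨b', hb⟩ := hLs b
      have back : ∀ q, PairReach E r q → ∃ t, PairReach E p t ∧ L b t.1 q.1 ∧ L b t.2 q.2 := by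
        intro q hq
        obtain ⟨t, h3, h4, h5⟩ := h.pair_step hq ((hb _ _).1 h1) ((hb _ _).1 h2)
        exact ⟨t, h3, (hb _ _).2 h4, (hb _ _).2 h5⟩
      refine ⟨fun v w w' h3 h4 => ?_, fun v w h3 a v' hv => ?_⟩
      · obtain ⟨t, h5, h6, h7⟩ := back _ h3
        obtain ⟨t', h8, h9, h10⟩ := back _ h4
        obtain ⟨t1, t2⟩ := t
        obtain ⟨t1', t2'⟩ := t'
        obtain rfl : t1 = t1' := hL.injective hLs h6 h9
        obtain rfl := ih.1 _ _ _ h5 h8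
        exact hL _ _ _ _ h7 h10
      · obtain ⟨t, h5, h6, h7⟩ := back _ h3
        obtain ⟨v₁, h8, h9⟩ := h a b' _ _ _ hv ((hb _ _).1 h6)
        obtain ⟨w₁, h10⟩ := ih.2 _ _ h5 a _ h8
        obtain ⟨w', h11, h12⟩ := h a b _ _ _ h10 h7
        exact ⟨w', h11⟩
  exact key _ hr

/-- The union of two families. -/
def both (E : ι → X → X → Prop) (L : ι' → X → X → Prop) : ι ⊕ ι' → X → X → Prop
  | .inl a => E a
  | .inr b => L b

theorem both_isFunctional (hE : IsFunctional E) (hL : IsFunctional L) : IsFunctional (both E L)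
  | .inl a => hE a
  | .inr b => hL b

theorem both_isSymm (hE : IsSymm E) (hL : IsSymm L) : IsSymm (both E L)
  | .inl a => let ⟨a', h⟩ := hE a; ⟨.inl a', h⟩
  | .inr b => let ⟨b', h⟩ := hL b; ⟨.inr b', h⟩

theorem Squares.exists_of_reach (h : Squares E L) (hEs : IsSymm E) {x v : X}
    (hr : Reach (both E L) x v) : ∃ y, Reach L x y ∧ Reach E y v := by
  induction hr with
  | refl => exact ⟨x, .refl, .refl⟩
  | tail _ hs ih =>
    obtain ⟨y, h1, h2⟩ := ih
    obtain ⟨a | b, hs⟩ := hs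
    · exact ⟨y, h1, h2.tail ⟨a, hs⟩⟩
    · obtain ⟨z, h3, h4⟩ := h.grid (Reach.symm hEs h2) (.single ⟨b, hs⟩)
      exact ⟨z, h1.trans h4, Reach.symm hEs h3⟩

theorem Squares.pair_grid_left (h : Squares E L) {x y z : X} (hy : Reach E x y) (hz : Reach L x z) :
    ∃ t, Reach E z t ∧ PairReach L (x, y) (z, t) := by
  induction hz with
  | refl => exact ⟨y, hy, .refl⟩
  | tail _ hs ih =>
    obtain ⟨t, h1, h2⟩ := ih
    obtain ⟨b, hb⟩ := hs
    rename_i u _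
    obtain ⟨s, h3, h4, h5⟩ := h.pair_step (PairReach.diag h1) (r := (u, u)) hb hb
    exact ⟨s.1, h3.fst, h2.tail ⟨b, hb, h4⟩⟩

/-- Every vertex of the joint component is reached by an `L`-path followed by an `E`-path, and its
image is obtained by following the same labels from `y`. The hypothesis `hu` makes the intermediate
vertex unique. -/
theorem Squares.emb_both (h : Squares E L) (hE : IsFunctional E) (hL : IsFunctional L)
    (hEs : IsSymm E) (hLs : IsSymm L) {x y : X} (hxE : Emb E x y) (hxL : Emb L x y)
    (hu : ∀ z, Reach E x z → Reach L x z → z = x) : Emb (both E L) x y := by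
  refine Emb.of_rel (fun v w => ∃ p, PairReach L (x, y) p ∧ PairReach E p (v, w))
    ⟨_, .refl, .refl⟩ ?_ ?_ (both_isFunctional hE hL)
  · rintro v w w' ⟨⟨u, p⟩, h1, h2⟩ ⟨⟨u', p'⟩, h3, h4⟩
    -- Two intermediate vertices are joined by an `E`-path. Carried back along the `L`-path to `x`,
    -- it ends in a vertex that is linked to `x` in both families, hence in `x` itself; so the two
    -- vertices coincide.
    obtain ⟨t, h5, h6⟩ := h.pair_grid_left (h2.fst.trans (Reach.symm hEs h4.fst))
      (Reach.symm hLs h1.fst)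
    obtain rfl := hu t h5 (h3.fst.trans (Relation.ReflTransGen.lift Prod.snd
      (fun _ _ ⟨a, h1, h2⟩ => ⟨a, h2⟩) _ _ h6))
    obtain rfl := (Emb.refl hL t).1 _ _ _ (h6.symm hLs) (PairReach.diag h1.fst)
    obtain rfl := hxL.1 _ _ _ h1 h3
    exact (h.emb hL hLs h1 hxE).1 _ _ _ h2 h4
  · rintro (a | b) v w v' ⟨p, h1, h2⟩ hv
    · obtain ⟨w', hw⟩ := (h.emb hL hLs h1 hxE).2 _ _ h2 a _ hv
      exact ⟨w', hw, p, h1, h2.tail ⟨a, hv, hw⟩⟩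
    · obtain ⟨t, h3, h4⟩ := h.pair_grid h2 (h1.symm hLs)
      obtain ⟨w', hw⟩ := (h.flip.emb hE hEs h3 hxL).2 _ _ (h4.symm hLs) b _ hv
      obtain ⟨s, h5, h6⟩ := h.pair_grid (h3.symm hEs)
        ((h4.symm hLs).tail ⟨b, hv, hw⟩ : PairReach L t (v', w'))
      exact ⟨w', hw, s, h6, h5.symm hEs⟩

end Reach


/-- Two-sided version of `Emb`. -/
def Twin {ι X : Type*} (A : ι → X → X → Prop) (x y : X) : Prop := Emb A x y ∧ Emb A y x

theorem Twin.trans {ι X : Type*} {A : ι → X → X → Prop} (hA : IsFunctional A) {x y z : X}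
    (h : Twin A x y) (h' : Twin A y z) : Twin A x z :=
  ⟨h.1.trans hA h'.1, h'.2.trans hA h.2⟩

theorem Twin.symm {ι X : Type*} {A : ι → X → X → Prop} {x y : X}
    (h : Twin A x y) : Twin A y x := ⟨h.2, h.1⟩

/-! ### Components of configurations depend only on the staircase -/

section Conf

variable {e l : ℤ}

/-- The arrows between configurations that move a bead from column `U` to column `U + 1`. -/
def confE (e l : ℤ) (U : ℤ) (M N : {M // IsConf e l M}) : Prop := Arr e l U M.1 N.1

/-- The arrows between configurations that move a bead from row `T + 1` to row `T`. -/
def confL (e l : ℤ) (T : ℤ) (M N : {M // IsConf e l M}) : Prop := RowArr e l T M.1 N.1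

theorem confE_functional (he : 2 ≤ e) : IsFunctional (twoWay (confE e l)) := by
  rintro ⟨U, _ | _⟩ M N N' h h'
  · exact Subtype.ext (Arr.injective he N.2.toIsBits N'.2.toIsBits h h')
  · exact Subtype.ext (Arr.functional h h')

theorem confL_functional (hl : 2 ≤ l) : IsFunctional (twoWay (confL e l)) := by
  rintro ⟨U, _ | _⟩ M N N' h h'
  · have := Arr.injective hl N.2.dual.toIsBits N'.2.dual.toIsBits h h'
    exact Subtype.ext (by rw [← dual_dual N.1, this, dual_dual])
  · have := Arr.functional h h'
    exact Subtype.ext (by rw [← dual_dual N.1, this, dual_dual])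

theorem conf_squares (he : 2 ≤ e) (hl : 2 ≤ l) : Squares (twoWay (confE e l)) (twoWay (confL e l)) := by
  rintro ⟨U, _ | _⟩ ⟨T, _ | _⟩ ⟨M, hM⟩ ⟨N, hN⟩ ⟨P, hP⟩ h1 h2
  · obtain ⟨K, hK, h3, h4⟩ := square_raise_raise he hl hM.1 hN.1 hP.1 h1 h2
    obtain ⟨_, _, _, hm⟩ := id h4
    exact ⟨⟨K, hP.of_moves hK (Or.inr hm)⟩, h4, h3⟩
  · obtain ⟨K, hK, h3, h4⟩ := square_raise_lower he hl hM.1 hN.1 h1 h2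
    exact ⟨⟨K, RowArr.isConf hN h3⟩, h4, h3⟩
  · obtain ⟨K, hK, h3, h4⟩ := square_lower_raise he hl hM.1 hP.1 h1 h2
    exact ⟨⟨K, h4.isConf hP⟩, h4, h3⟩
  · obtain ⟨K, h3, h4⟩ := square_lower_lower he hl hM.1 h1 h2
    exact ⟨⟨K, RowArr.isConf hN h3⟩, h4, h3⟩

theorem confL_isShift (he : 2 ≤ e) (hl : 2 ≤ l) {n : ℕ} (M M' : {M // IsConf e l M})
    {τ : ℕ → ℤ → ℤ} (h : IsShift n M.1 M'.1 τ) : Twin (twoWay (confL e l)) M M' := by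
  constructor
  · refine Emb.of_rel (fun M M' => ∃ τ, IsShift n M.1 M'.1 τ) ⟨τ, h⟩ ?_ ?_ (confL_functional hl)
    · rintro v w w' ⟨τ, h⟩ ⟨τ', h'⟩
      exact Subtype.ext (h.functional w.2 w'.2 h')
    · rintro ⟨T, _ | _⟩ v w v' ⟨τ, h⟩ hv
      · obtain ⟨N, ρ, h1, h2, h3⟩ := h.row_raise he hl v.2 w.2 v'.2 hv
        exact ⟨⟨N, h1⟩, h2, ρ, h3⟩
      · obtain ⟨N, ρ, h1, h2, h3⟩ := h.row_lower he hl v.2 w.2 hv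
        exact ⟨⟨N, h1⟩, h2, ρ, h3⟩
  · refine Emb.of_rel (fun M' M => ∃ τ, IsShift n M.1 M'.1 τ) ⟨τ, h⟩ ?_ ?_ (confL_functional hl)
    · rintro v w w' ⟨τ, h⟩ ⟨τ', h'⟩
      exact Subtype.ext (h.injective w.2 w'.2 h')
    · rintro ⟨T, _ | _⟩ v w v' ⟨τ, h⟩ hv
      · obtain ⟨N, ρ, h1, h2, h3⟩ := h.row_raise_inv he hl w.2 v.2 v'.2 hv
        exact ⟨⟨N, h1⟩, h2, ρ, h3⟩
      · obtain ⟨N, ρ, h1, h2, h3⟩ := h.row_lower_inv he hl w.2 v.2 hv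
        exact ⟨⟨N, h1⟩, h2, ρ, h3⟩

/-- `M` encodes the doubly highest weight vertex with charges `F` and parameter `κ`. -/
def IsVertex (e l : ℤ) (F : ℤ → ℤ) (κ : ℕ → ℕ) (M : ℤ → ℤ → ℤ) : Prop :=
  IsStair e l F ∧ IsPartSeq κ ∧ IsEnum M (vertexEnum F κ)

/-- Both configurations arise by shifts from the one with the same staircase and empty partition,
and each shift is an isomorphism of row components. -/
theorem IsVertex.twin_confL (he : 2 ≤ e) (hl : 2 ≤ l) {F : ℤ → ℤ} {κ κ' : ℕ → ℕ}
    {M M' : {M // IsConf e l M}} (h : IsVertex e l F κ M.1) (h' : IsVertex e l F κ' M'.1) :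
    Twin (twoWay (confL e l)) M M' := by
  obtain ⟨M₀, h1, h2⟩ := exists_vertex he h.1 (κ := fun _ => 0) ⟨fun _ _ _ => le_rfl, 0, fun _ _ => rfl⟩
  have key : ∀ {κ : ℕ → ℕ} {M : {M // IsConf e l M}}, IsVertex e l F κ M.1 →
      Twin (twoWay (confL e l)) ⟨M₀, h1⟩ M := by
    rintro κ ⟨M, hM⟩ ⟨hF, hκ, hE⟩
    have := vertex_induction he hF
      (P := fun M => ∀ hM, Twin (twoWay (confL e l)) ⟨M₀, h1⟩ ⟨M, hM⟩) ?_ ?_ hκ hM hE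
    · exact this hM
    · intro M hM h3
      obtain rfl := IsEnum.bits_unique h1.1 hM.1 h2 h3
      exact fun _ => ⟨Emb.refl (confL_functional hl) _, Emb.refl (confL_functional hl) _⟩
    · exact fun n M M' τ hM hM' h3 ih _ =>
        (ih hM).trans (confL_functional hl) (confL_isShift he hl ⟨M, hM⟩ ⟨M', hM'⟩ h3)
  exact (key h).symm.trans (confL_functional hl) (key h')

theorem reach_confL_shift (he : 2 ≤ e) (hl : 2 ≤ l) {n : ℕ} {M N M' : {M // IsConf e l M}}
    {τ : ℕ → ℤ → ℤ} (h : IsShift n N.1 M.1 τ) (hr : Reach (twoWay (confL e l)) M M') :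
    ∃ N', Reach (twoWay (confL e l)) N N' ∧ ∃ ρ, IsShift n N'.1 M'.1 ρ := by
  induction hr with
  | refl => exact ⟨N, .refl, τ, h⟩
  | tail _ hs ih =>
    rename_i v v' _
    obtain ⟨w, h0, τ, h⟩ := ih
    obtain ⟨⟨T, _ | _⟩, hs⟩ := hs
    · obtain ⟨N, ρ, h1, h2, h3⟩ := h.row_raise_inv he hl w.2 v.2 v'.2 hs
      exact ⟨⟨N, h1⟩, h0.tail ⟨(T, false), h2⟩, ρ, h3⟩
    · obtain ⟨N, ρ, h1, h2, h3⟩ := h.row_lower_inv he hl w.2 v.2 hs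
      exact ⟨⟨N, h1⟩, h0.tail ⟨(T, true), h2⟩, ρ, h3⟩

theorem Reach.hasCharge (he : 2 ≤ e) {M M' : {M // IsConf e l M}}
    (hr : Reach (twoWay (confL e l)) M M') {u f : ℤ} (h : HasCharge (M.1 u) f) :
    HasCharge (M'.1 u) f := by
  induction hr with
  | refl => exact h
  | tail _ hs ih =>
    obtain ⟨⟨T, _ | _⟩, hs⟩ := hs
    · exact (RowArr.hasCharge he hs).2 ih
    · exact (RowArr.hasCharge he hs).1 ih

theorem vertex_charges (he : 2 ≤ e) {F F' : ℤ → ℤ} {κ κ' : ℕ → ℕ}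
    {M M' : {M // IsConf e l M}} (h : IsVertex e l F κ M.1) (h' : IsVertex e l F' κ' M'.1)
    (hr : Reach (twoWay (confL e l)) M M') : F = F' := funext fun u =>
  (hr.hasCharge he (vertex_hasCharge he h.2.1 M.2 h.2.2 u)).unique
    (vertex_hasCharge he h'.2.1 M'.2 h'.2.2 u)

theorem IsPartSeq.eq_zero {κ : ℕ → ℕ} (hκ : IsPartSeq κ) (h0 : κ 0 = 0) (k : ℕ) : κ k = 0 := by
  have := hκ.anti (Nat.zero_le k)
  omega

/-- If the empty partition came from a shift, strict growth of the heights in column `u` between the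
indices `0` and `n + 1` would give `F (u + 1) ≤ F u` for all `u`, against `F (u + e) = F u + l`. -/
theorem IsShift.false_of_zero {n : ℕ} {F : ℤ → ℤ} {κ : ℕ → ℕ} {N M : ℤ → ℤ → ℤ}
    {τ : ℕ → ℤ → ℤ} (he : 2 ≤ e) (hl : 2 ≤ l) (hM : IsVertex e l F κ M) (h : IsShift n N M τ)
    (h0 : κ 0 = 0) : False := by
  obtain ⟨hF, hκ, hM⟩ := hM
  have heq := h.enum'.unique hM
  have hle : ∀ u, F (u + 1) ≤ F u := by
    intro u
    have h1 := congrFun (congrFun heq 0) (u + 1)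
    have h2 := congrFun (congrFun heq (n + 1)) u
    have h3 : ∀ j : ℕ, τ 0 u + j ≤ τ j u := by
      intro j
      induction j with
      | zero => simp
      | succ j ih =>
        have := h.enum.strictMono u (Nat.lt_succ_self j)
        push_cast
        simp only [Nat.succ_eq_add_one] at this
        omega
    have h4 := h3 (n + 1)
    simp only [shiftEnum, vertexEnum, hκ.eq_zero h0, Nat.zero_le, if_true, add_sub_cancel_right,
      Nat.cast_zero, sub_zero, add_zero, if_neg (show ¬ n + 1 ≤ n by omega)] at h1 h2
    omega
  have h1 := antitone_int_of_succ_le hle (show (0 : ℤ) ≤ 0 + e by omega)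
  have h2 := hF.period 0
  omega

/-- Row arrows preserve the column charges, so both ends have the same staircase. Induction on the
first part of `κ` removes a shift along the whole path; for empty `κ` no shift can be removed, so
the other end has empty partition too. -/
theorem eq_of_reach_confL (he : 2 ≤ e) (hl : 2 ≤ l) {M M' : {M // IsConf e l M}}
    (h : IsDoublyHighestConf e l M.1) (h' : IsDoublyHighestConf e l M'.1)
    (hr : Reach (twoWay (confL e l)) M M') : M = M' := by
  obtain ⟨F, κ, hM⟩ := h.exists_vertex he hl M.2
  obtain ⟨m, hm⟩ : ∃ m, κ 0 = m := ⟨_, rfl⟩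
  have hs := twoWay_isSymm (confL e l)
  clear h
  induction m generalizing κ M M' with
  | zero =>
    obtain ⟨F', κ', hM'⟩ := h'.exists_vertex he hl M'.2
    obtain rfl := vertex_charges he hM hM' hr
    rcases Nat.eq_zero_or_pos (κ' 0) with h0 | h0
    · obtain rfl : κ = κ' := funext fun k => by
        rw [hM.2.1.eq_zero hm, hM'.2.1.eq_zero h0]
      exact Subtype.ext (IsEnum.bits_unique M.2.1 M'.2.1 hM.2.2 hM'.2.2)
    · obtain ⟨n, N, hN, hsh⟩ := exists_isShift he hM'.1 hM'.2.1 h0 hM'.2.2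
      obtain ⟨N', -, ρ, hρ⟩ := reach_confL_shift he hl (N := ⟨N, hN⟩) hsh (hr.symm hs)
      exact (hρ.false_of_zero he hl hM hm).elim
  | succ m ih =>
    obtain ⟨n, N, hN, hsh⟩ := exists_isShift he hM.1 hM.2.1 (by omega) hM.2.2
    obtain ⟨N', hr', ρ, hρ⟩ := reach_confL_shift he hl (N := ⟨N, hN⟩) hsh hr
    obtain rfl := ih (M := ⟨N, hN⟩) (M' := N') (κ := fun k => κ k - 1)
      ⟨(isHighest_iff he N'.2 hρ.enum).2 hρ.mono,
        (IsShift.isHighest_dual_iff hl N'.2 M'.2 hρ).2 h'.2⟩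
      hr' ⟨hM.1, hM.2.1.pred, hsh.enum⟩ (by omega)
    exact Subtype.ext (hsh.functional M.2 M'.2 hρ)

end Conf


section Conf

variable {e l : ℤ}

def dualConf (M : {M // IsConf e l M}) : {M // IsConf l e M} := ⟨dual M.1, M.2.dual⟩

theorem dualConf_dualConf (M : {M // IsConf e l M}) : dualConf (dualConf M) = M :=
  Subtype.ext (dual_dual _)

theorem dualConf_injective : Function.Injective (dualConf (e := e) (l := l)) := fun M N h => by
  rw [← dualConf_dualConf M, h, dualConf_dualConf]

theorem twoWay_confE_iff (a : ℤ × Bool) (M N : {M // IsConf e l M}) :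
    twoWay (confE e l) a M N ↔ twoWay (confL l e) a (dualConf M) (dualConf N) := by
  obtain ⟨U, _ | _⟩ := a <;> simp [twoWay, confE, confL, RowArr, dualConf, dual_dual]

theorem IsDoublyHighestConf.dual {M : ℤ → ℤ → ℤ} (h : IsDoublyHighestConf e l M) :
    IsDoublyHighestConf l e (dual M) := ⟨h.2, by rw [dual_dual]; exact h.1⟩

theorem Reach.dualConf {M N : {M // IsConf e l M}} (h : Reach (twoWay (confE e l)) M N) :
    Reach (twoWay (confL l e)) (dualConf M) (dualConf N) :=
  Relation.ReflTransGen.lift HeisenbergCrystal.dualConf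
    (fun _ _ ⟨a, h1⟩ => ⟨a, (twoWay_confE_iff a _ _).1 h1⟩) _ _ h

theorem eq_of_reach_confE (he : 2 ≤ e) (hl : 2 ≤ l) {M M' : {M // IsConf e l M}}
    (h : IsDoublyHighestConf e l M.1) (h' : IsDoublyHighestConf e l M'.1)
    (hr : Reach (twoWay (confE e l)) M M') : M = M' :=
  dualConf_injective (eq_of_reach_confL hl he h.dual h'.dual hr.dualConf)

theorem IsStair.exists_adjoint (he : 2 ≤ e) (hl : 2 ≤ l) {F : ℤ → ℤ} (hF : IsStair e l F) (T : ℤ) :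
    ∃ f, ∀ u, u < f ↔ F u ≤ T := by
  obtain ⟨M, hM, h⟩ := exists_vertex he hF (κ := fun _ => 0) ⟨fun _ _ _ => le_rfl, 0, fun _ _ => rfl⟩
  obtain ⟨q, hq⟩ := h.exists_last hl hM.1 (vertexEnum_mono hF 0) T
  refine ⟨q + 1, fun u => ?_⟩
  have := hq u
  simp only [vertexEnum, Nat.cast_zero, sub_zero, add_zero] at this
  rw [← this]
  omega

/-- The dual configurations are again doubly highest, and their staircases are given by the row
charges. These are adjoint to `F` and do not depend on the partition, so the result for row
components applies to the duals. -/
theorem IsVertex.twin_confE (he : 2 ≤ e) (hl : 2 ≤ l) {F : ℤ → ℤ} {κ κ' : ℕ → ℕ}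
    {M M' : {M // IsConf e l M}} (h : IsVertex e l F κ M.1) (h' : IsVertex e l F κ' M'.1) :
    Twin (twoWay (confE e l)) M M' := by
  have h1 := vertex_isDoublyHighest he hl h.1 h.2.1 M.2 h.2.2
  have h1' := vertex_isDoublyHighest he hl h'.1 h'.2.1 M'.2 h'.2.2
  obtain ⟨G, ρ, hG⟩ := h1.dual.exists_vertex hl he M.2.dual
  obtain ⟨G', ρ', hG'⟩ := h1'.dual.exists_vertex hl he M'.2.dual
  obtain rfl : G = G' := funext fun T => by
    obtain ⟨f, hf⟩ := h.1.exists_adjoint he hl T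
    have h2 := vertex_hasCharge_dual he hl h.1 h.2.1 M.2 h.2.2 hf
    have h3 := vertex_hasCharge_dual he hl h'.1 h'.2.1 M'.2 h'.2.2 hf
    exact ((vertex_hasCharge hl hG.2.1 M.2.dual hG.2.2 T).unique h2).trans
      (h3.unique (vertex_hasCharge hl hG'.2.1 M'.2.dual hG'.2.2 T))
  have key : Twin (twoWay (confL l e)) (dualConf M) (dualConf M') :=
    IsVertex.twin_confL hl he hG hG'
  exact ⟨Emb.of_injective (g := id) (confE_functional he) twoWay_confE_iff dualConf_injective
    (fun a v y _ => ⟨_, dualConf_dualConf y⟩) key.1,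
    Emb.of_injective (g := id) (confE_functional he) twoWay_confE_iff dualConf_injective
    (fun a v y _ => ⟨_, dualConf_dualConf y⟩) key.2⟩

theorem IsHighest.reach (he : 2 ≤ e) (hl : 2 ≤ l) {M M' : {M // IsConf e l M}}
    (h : IsHighest e l M.1) (hr : Reach (twoWay (confL e l)) M M') : IsHighest e l M'.1 := by
  induction hr with
  | refl => exact h
  | tail _ hs ih =>
    rename_i N N' _
    obtain ⟨⟨T, _ | _⟩, hs⟩ := hs
    · exact ih.row_symm he hl N.2 N'.2 hs
    · exact ih.row he hl N.2 hs

theorem IsHighest.reach_dual (he : 2 ≤ e) (hl : 2 ≤ l) {M M' : {M // IsConf e l M}}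
    (h : IsHighest l e (dual M.1)) (hr : Reach (twoWay (confE e l)) M M') :
    IsHighest l e (dual M'.1) :=
  IsHighest.reach hl he (M := dualConf M) h hr.dualConf

/-- All arrows between configurations, in both directions. -/
def confArrow (e l : ℤ) :
    ℤ × Bool ⊕ ℤ × Bool → {M // IsConf e l M} → {M // IsConf e l M} → Prop :=
  both (twoWay (confE e l)) (twoWay (confL e l))

theorem confArrow_functional (he : 2 ≤ e) (hl : 2 ≤ l) : IsFunctional (confArrow e l) :=
  both_isFunctional (confE_functional he) (confL_functional hl)

/-- A vertex linked to `M` in both crystals separately is again a source of both, hence equal to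
`M`. This is the uniqueness needed to combine the row and column isomorphisms. -/
theorem IsVertex.twin (he : 2 ≤ e) (hl : 2 ≤ l) {F : ℤ → ℤ} {κ κ' : ℕ → ℕ}
    {M M' : {M // IsConf e l M}} (h : IsVertex e l F κ M.1) (h' : IsVertex e l F κ' M'.1) :
    Twin (confArrow e l) M M' := by
  have key : ∀ {κ : ℕ → ℕ} {M : {M // IsConf e l M}}, IsVertex e l F κ M.1 →
      ∀ z, Reach (twoWay (confE e l)) M z → Reach (twoWay (confL e l)) M z → z = M := by
    intro κ M h z h1 h2
    have h3 := vertex_isDoublyHighest he hl h.1 h.2.1 M.2 h.2.2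
    exact (eq_of_reach_confL he hl h3 ⟨h3.1.reach he hl h2, IsHighest.reach_dual he hl h3.2 h1⟩ h2).symm
  have hE := h.twin_confE he hl h'
  have hL := h.twin_confL he hl h'
  exact ⟨(conf_squares he hl).emb_both (confE_functional he) (confL_functional hl)
      (twoWay_isSymm _) (twoWay_isSymm _) hE.1 hL.1 (key h),
    (conf_squares he hl).emb_both (confE_functional he) (confL_functional hl)
      (twoWay_isSymm _) (twoWay_isSymm _) hE.2 hL.2 (key h')⟩

/-- The path is rearranged into a row path followed by a column path. The vertex in between is
doubly highest, because each kind of arrow preserves sources of the other crystal. -/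
theorem eq_of_reach_confArrow (he : 2 ≤ e) (hl : 2 ≤ l) {M M' : {M // IsConf e l M}}
    (h : IsDoublyHighestConf e l M.1) (h' : IsDoublyHighestConf e l M'.1)
    (hr : Reach (confArrow e l) M M') : M = M' := by
  obtain ⟨N, h1, h2⟩ := (conf_squares he hl).exists_of_reach (twoWay_isSymm _) hr
  have h3 : IsDoublyHighestConf e l N.1 :=
    ⟨h.1.reach he hl h1, IsHighest.reach_dual he hl h'.2 (h2.symm (twoWay_isSymm _))⟩
  exact (eq_of_reach_confL he hl h h3 h1).trans (eq_of_reach_confE he hl h3 h' h2)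

end Conf


/-! ### Young diagrams, row lengths and beads -/

section Young

theorem rowLen_injective {μ ν : YoungDiagram} (h : ∀ k, μ.rowLen k = ν.rowLen k) : μ = ν := by
  refine YoungDiagram.ext (Finset.ext fun x => ?_)
  rw [YoungDiagram.mem_cells, YoungDiagram.mem_cells, ← Prod.mk.eta (p := x),
    YoungDiagram.mem_iff_lt_rowLen, YoungDiagram.mem_iff_lt_rowLen, h]

theorem rowLen_isPartSeq (μ : YoungDiagram) : IsPartSeq μ.rowLen := by
  refine ⟨fun i j h => μ.rowLen_anti i j h, μ.colLen 0, fun k hk => ?_⟩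
  by_contra h
  have := YoungDiagram.mem_iff_lt_colLen.1
    (YoungDiagram.mem_iff_lt_rowLen.2 (Nat.pos_of_ne_zero h))
  omega

theorem IsPartSeq.exists_young {κ : ℕ → ℕ} (hκ : IsPartSeq κ) :
    ∃ μ : YoungDiagram, ∀ k, μ.rowLen k = κ k := by
  obtain ⟨K, hK⟩ := hκ.finite
  have hlt : ∀ {i j : ℕ}, j < κ i → i < K := fun {i j} h => by
    by_contra hc
    have := hK i (by omega)
    omega
  let μ : YoungDiagram :=
    ⟨(Finset.range K ×ˢ Finset.range (κ 0)).filter fun p => p.2 < κ p.1, by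
      rintro ⟨a, b⟩ ⟨c, d⟩ ⟨h1, h2⟩ h
      simp only [Finset.coe_filter, Finset.mem_product, Finset.mem_range, Set.mem_ofPred_eq] at h ⊢
      simp only at h1 h2
      have h3 := hκ.anti h1
      have h4 := hκ.anti (Nat.zero_le c)
      omega⟩
  have hmem : ∀ i j, (i, j) ∈ μ ↔ j < κ i := by
    intro i j
    rw [← YoungDiagram.mem_cells]
    simp only [μ, Finset.mem_filter, Finset.mem_product, Finset.mem_range]
    refine ⟨fun h => h.2, fun h => ⟨⟨hlt h, ?_⟩, h⟩⟩
    have h4 := hκ.anti (Nat.zero_le i)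
    omega
  refine ⟨μ, fun k => ?_⟩
  have h1 := fun j => (YoungDiagram.mem_iff_lt_rowLen (μ := μ)).symm.trans (hmem k j)
  have h2 := h1 (κ k)
  have h3 := h1 (μ.rowLen k)
  omega

theorem addsBox_iff {μ ν : YoungDiagram} {a b : ℕ} :
    AddsBox μ (a, b) ν ↔
      b = μ.rowLen a ∧ ∀ k, ν.rowLen k = μ.rowLen k + if k = a then 1 else 0 := by
  constructor
  · rintro ⟨h1, h2⟩
    have h3 : ∀ i j, j < ν.rowLen i ↔ i = a ∧ j = b ∨ j < μ.rowLen i := by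
      intro i j
      rw [← YoungDiagram.mem_iff_lt_rowLen, ← YoungDiagram.mem_iff_lt_rowLen,
        ← YoungDiagram.mem_cells, h2]
      simp
    rw [YoungDiagram.mem_iff_lt_rowLen] at h1
    have hb : b = μ.rowLen a := by
      have e1 := h3 a b
      have e2 := h3 a (μ.rowLen a)
      simp only [true_and, lt_irrefl, or_false, true_or, iff_true] at e1 e2
      by_contra hne
      have := e2.1 (by omega)
      omega
    refine ⟨hb, fun k => ?_⟩
    have e1 := h3 k (μ.rowLen k)
    have e2 := h3 k (ν.rowLen k)
    have e3 := h3 k (μ.rowLen k + 1)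
    by_cases hk : k = a
    · subst hk
      simp only [true_and, if_true] at *
      omega
    · simp only [hk, false_and, false_or, if_false] at *
      omega
  · rintro ⟨rfl, h⟩
    refine ⟨by rw [YoungDiagram.mem_iff_lt_rowLen]; omega, Finset.ext ?_⟩
    rintro ⟨i, j⟩
    rw [Finset.mem_insert, YoungDiagram.mem_cells, YoungDiagram.mem_cells,
      YoungDiagram.mem_iff_lt_rowLen, YoungDiagram.mem_iff_lt_rowLen, h, Prod.mk.injEq]
    split_ifs with hk
    · subst hk; simp only [true_and]; omega
    · simp [hk]

theorem exists_addsBox {μ : YoungDiagram} {a : ℕ} (h : a = 0 ∨ μ.rowLen a < μ.rowLen (a - 1)) :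
    ∃ ν, AddsBox μ (a, μ.rowLen a) ν := by
  have hμ := rowLen_isPartSeq μ
  obtain ⟨K, hK⟩ := hμ.finite
  obtain ⟨ν, hν⟩ := IsPartSeq.exists_young (κ := fun k => μ.rowLen k + if k = a then 1 else 0)
    ⟨antitone_nat_of_succ_le fun n => by
      have h1 := hμ.anti (Nat.le_add_right n 1)
      by_cases h2 : n + 1 = a
      · subst h2
        rcases h with h | h
        · omega
        · rw [Nat.add_sub_cancel] at h
          rw [if_pos rfl, if_neg (by omega)]; omega
      · rw [if_neg h2]; omega, max K (a + 1), fun k hk => by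
      rw [hK k (le_trans (le_max_left _ _) hk), if_neg (by have := le_max_right K (a + 1); omega)]⟩
  exact ⟨ν, addsBox_iff.2 ⟨rfl, hν⟩⟩

/-- The beads of one row of an abacus. -/
def bead (μ : YoungDiagram) (s : ℤ) (k : ℕ) : ℤ := μ.rowLen k + s - k

theorem bead_strictAnti (μ : YoungDiagram) (s : ℤ) : StrictAnti (bead μ s) := by
  refine strictAnti_nat_of_succ_lt fun n => ?_
  have := μ.rowLen_anti n (n + 1) (by omega)
  simp only [bead]
  push_cast
  omega

/-- A strictly decreasing sequence is determined by its range; far out the parts vanish and the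
charge can be read off. -/
theorem bead_injective {μ ν : YoungDiagram} {s s' : ℤ}
    (h : Set.range (bead μ s) = Set.range (bead ν s')) : μ = ν ∧ s = s' := by
  have h1 := congrFun ((StrictMono.range_inj (f := OrderDual.toDual ∘ bead μ s)
    (g := OrderDual.toDual ∘ bead ν s') (bead_strictAnti μ s) (bead_strictAnti ν s')).1
      (by rw [Set.range_comp, Set.range_comp, h]))
  obtain ⟨K, hK⟩ := (rowLen_isPartSeq μ).finite
  obtain ⟨K', hK'⟩ := (rowLen_isPartSeq ν).finite
  have h2 : bead μ s _ = bead ν s' _ := h1 (max K K')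
  rw [bead, bead, hK _ (le_max_left _ _), hK' _ (le_max_right _ _)] at h2
  obtain rfl : s = s' := by omega
  refine ⟨rowLen_injective fun k => ?_, rfl⟩
  have : bead μ s k = bead ν s k := h1 k
  rw [bead, bead] at this
  omega

theorem AddsBox.range_bead {μ ν : YoungDiagram} {a b : ℕ} (h : AddsBox μ (a, b) ν) (s x : ℤ) :
    x ∈ Set.range (bead ν s) ↔
      x = b - a + s + 1 ∨ x ≠ b - a + s ∧ x ∈ Set.range (bead μ s) := by
  obtain ⟨rfl, h'⟩ := addsBox_iff.1 h
  have hb : bead μ s a = μ.rowLen a - a + s := by simp only [bead]; ring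
  constructor
  · rintro ⟨k, rfl⟩
    by_cases hk : k = a
    · left; subst hk; simp only [bead, h', if_true]; push_cast; ring
    · right
      have : bead ν s k = bead μ s k := by
        simp [bead, h', hk]
      rw [this]
      exact ⟨fun hc => hk ((bead_strictAnti μ s).injective (hc.trans hb.symm)), k, rfl⟩
  · rintro (rfl | ⟨h1, k, rfl⟩)
    · exact ⟨a, by simp only [bead, h', if_true]; push_cast; ring⟩
    · have hk : k ≠ a := fun hk => h1 (hk ▸ hb)
      exact ⟨k, by simp [bead, h', hk]⟩

theorem AddsBox.bead_mem {μ ν : YoungDiagram} {a b : ℕ} (h : AddsBox μ (a, b) ν) (s : ℤ) :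
    (b - a + s : ℤ) ∈ Set.range (bead μ s) ∧
      (b - a + s + 1 : ℤ) ∉ Set.range (bead μ s) := by
  obtain ⟨rfl, h'⟩ := addsBox_iff.1 h
  have hb : bead μ s a = μ.rowLen a - a + s := by simp only [bead]; ring
  refine ⟨⟨a, hb⟩, ?_⟩
  rintro ⟨k, hk⟩
  have hka : k < a := (bead_strictAnti μ s).lt_iff_gt.1 (by omega)
  have h1 := bead_strictAnti ν s hka
  simp only [bead, h', if_true, if_neg hka.ne] at h1 hk
  push_cast at h1
  omega

theorem exists_addsBox_of_bead {μ : YoungDiagram} {s x : ℤ} (h1 : x ∈ Set.range (bead μ s))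
    (h2 : x + 1 ∉ Set.range (bead μ s)) : ∃ a b : ℕ, (b : ℤ) - a + s = x ∧ ∃ ν, AddsBox μ (a, b) ν := by
  obtain ⟨a, rfl⟩ := h1
  refine ⟨a, μ.rowLen a, by rw [bead]; ring, exists_addsBox ?_⟩
  by_contra! h
  obtain ⟨h3, h4⟩ := h
  have h5 := μ.rowLen_anti (a - 1) a (by omega)
  refine h2 ⟨a - 1, ?_⟩
  rw [bead, bead, Nat.cast_sub (by omega)]
  have : μ.rowLen (a - 1) = μ.rowLen a := by omega
  rw [this]; push_cast; ring

theorem AddsBox.eq_of_content {μ ν ν' : YoungDiagram} {a b a' b' : ℕ} (h : AddsBox μ (a, b) ν)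
    (h' : AddsBox μ (a', b') ν') (hc : (b : ℤ) - a = b' - a') : (a, b) = (a', b') := by
  obtain ⟨rfl, -⟩ := addsBox_iff.1 h
  obtain ⟨rfl, -⟩ := addsBox_iff.1 h'
  obtain rfl : a = a' := (bead_strictAnti μ 0).injective (by simp only [bead]; omega)
  rfl

theorem AddsBox.eq_of_content' {μ μ' ν : YoungDiagram} {a b a' b' : ℕ} (h : AddsBox μ (a, b) ν)
    (h' : AddsBox μ' (a', b') ν) (hc : (b : ℤ) - a = b' - a') : (a, b) = (a', b') := by
  obtain ⟨rfl, h1⟩ := addsBox_iff.1 h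
  obtain ⟨rfl, h2⟩ := addsBox_iff.1 h'
  have h3 := h1 a
  have h4 := h2 a'
  rw [if_pos rfl] at h3 h4
  obtain rfl : a = a' := (bead_strictAnti ν 0).injective (by
    simp only [bead, h3, h4]; push_cast; omega)
  congr 1
  omega

end Young


/-! ### Charged multipartitions as periodic configurations -/

/-- The configuration seen by rows from the right. -/
def transposeRev (M : ℤ → ℤ → ℤ) : ℤ → ℤ → ℤ := fun t u => M (-u) (-t)

theorem IsConf.transposeRev {e l : ℤ} {M : ℤ → ℤ → ℤ} (hM : IsConf e l M) :
    IsConf l e (transposeRev M) := by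
  obtain ⟨B, hB⟩ := hM.bounded
  refine ⟨⟨fun t u => hM.zero_or_one _ _, fun t u => ?_⟩, B, fun t u => ⟨fun h => ?_, fun h => ?_⟩⟩
  · simp only [HeisenbergCrystal.transposeRev]
    rw [← hM.period]
    congr 1 <;> ring
  · exact (hB _ _).1 (by linarith)
  · exact (hB _ _).2 (by linarith)

theorem HasCharge.reverse {A : ℤ → ℤ} {f : ℤ} (h : HasCharge A f) :
    HasCharge (fun u => 1 - A (-u)) (1 - f) := by
  obtain ⟨n, h1, ⟨a, h2⟩, b, h3⟩ := h
  refine ⟨fun u => u + n (-u - 1) + f, fun t => ?_, ⟨-b - 1, fun t ht => ?_⟩, -a, fun t ht => ?_⟩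
  · have := h1 (-t)
    simp only
    rw [show -(t - 1) - 1 = -t by ring]
    omega
  · simp only
    rw [h3 _ (by omega)]; ring
  · simp only
    rw [h2 _ (by omega)]; ring

section Abacus

variable {e l : ℕ}

/-- The row of the abacus with index `t` modulo `l`. -/
def rowOf (l : ℕ) [NeZero l] (t : ℤ) : Fin l := ⟨(t % l).toNat, divX_lt l t⟩

theorem natCast_pos (l : ℕ) [NeZero l] : (0 : ℤ) < l := by exact_mod_cast NeZero.pos l

theorem rowOf_val [NeZero l] (t : ℤ) : ((rowOf l t : ℕ) : ℤ) = t % l :=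
  Int.toNat_of_nonneg (Int.emod_nonneg _ (natCast_pos l).ne')

theorem rowOf_eq_iff [NeZero l] {t : ℤ} {j : Fin l} : rowOf l t = j ↔ t % l = j := by
  rw [← rowOf_val, Fin.ext_iff]
  exact Int.natCast_inj.symm

theorem rowOf_add_mul [NeZero l] (t m : ℤ) : rowOf l (t + l * m) = rowOf l t := by
  rw [rowOf_eq_iff, rowOf_val, Int.add_mul_emod_self_left]

theorem fin_emod (j : Fin l) : (j : ℤ) % l = j :=
  Int.emod_eq_of_lt (by omega) (by have := j.2; omega)

theorem fin_ediv (j : Fin l) : (j : ℤ) / l = 0 :=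
  Int.ediv_eq_zero_of_lt (by omega) (by have := j.2; omega)

theorem rowOf_coe [NeZero l] (j : Fin l) : rowOf l j = j := rowOf_eq_iff.2 (fin_emod j)

open Classical in
/-- The infinite periodic configuration obtained by unrolling the abacus of `v`. -/
noncomputable def conf (e : ℕ) {l : ℕ} [NeZero l] (v : ChargedMultipartition l) : ℤ → ℤ → ℤ :=
  fun u t => if (rowOf l t, u - e * (t / l)) ∈ abacus v then 1 else 0

theorem mem_abacus_iff {v : ChargedMultipartition l} {j : Fin l} {x : ℤ} :
    (j, x) ∈ abacus v ↔ x ∈ Set.range (bead (v.part j) (v.charge j)) := by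
  simp only [abacus, Set.mem_ofPred_eq, bead, Set.mem_range, eq_comm]

theorem abacus_injective {v w : ChargedMultipartition l} (h : abacus v = abacus w) : v = w := by
  have key : ∀ j, v.part j = w.part j ∧ v.charge j = w.charge j := fun j =>
    bead_injective (Set.ext fun x => by rw [← mem_abacus_iff, ← mem_abacus_iff, h])
  exact ChargedMultipartition.ext (funext fun j => (key j).1) (funext fun j => (key j).2)

variable [NeZero l]

theorem conf_eq_one {v : ChargedMultipartition l} {u t : ℤ} :
    conf e v u t = 1 ↔ (rowOf l t, u - e * (t / l)) ∈ abacus v := by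
  unfold conf; split_ifs with h <;> simp [h]

theorem conf_eq_one_coe {v : ChargedMultipartition l} {u : ℤ} {j : Fin l} :
    conf e v u j = 1 ↔ (j, u) ∈ abacus v := by
  rw [conf_eq_one, rowOf_coe, fin_ediv, mul_zero, sub_zero]

theorem conf_zero_or_one (v : ChargedMultipartition l) (u t : ℤ) :
    conf e v u t = 0 ∨ conf e v u t = 1 := by
  unfold conf; split_ifs <;> simp

theorem conf_isBits (v : ChargedMultipartition l) : IsBits e l (conf e v) := by
  refine ⟨conf_zero_or_one v, fun u t => ?_⟩
  have h1 : rowOf l (t + l) = rowOf l t := by simpa using rowOf_add_mul (l := l) t 1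
  have h2 : (t + l) / l = t / l + 1 := by
    have := Int.add_mul_ediv_right t 1 (natCast_pos l).ne'
    rwa [one_mul] at this
  have h3 : u + e - e * ((t + l) / l) = u - e * (t / l) := by rw [h2]; ring
  unfold conf
  rw [h1, h3]

theorem bead_bounded (μ : YoungDiagram) (s : ℤ) :
    ∃ B : ℕ, ∀ x : ℤ, (x + B ≤ 0 → x ∈ Set.range (bead μ s)) ∧ (B ≤ x → x ∉ Set.range (bead μ s)) := by
  obtain ⟨K, hK⟩ := (rowLen_isPartSeq μ).finite
  have hs := le_abs_self s
  have hs' := neg_abs_le s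
  refine ⟨K + s.natAbs + μ.rowLen 0 + 1, fun x => ⟨fun h => ⟨(s - x).toNat, ?_⟩, ?_⟩⟩
  · push_cast at h
    have h1 : ((s - x).toNat : ℤ) = s - x := Int.toNat_of_nonneg (by omega)
    rw [bead, hK _ (by omega), h1]; push_cast; ring
  · rintro h ⟨k, rfl⟩
    have := μ.rowLen_anti 0 k (by omega)
    rw [bead] at h
    push_cast at h
    omega

theorem conf_isConf (v : ChargedMultipartition l) : IsConf e l (conf e v) := by
  choose B hB using fun j => bead_bounded (v.part j) (v.charge j)
  obtain ⟨C, hC⟩ : ∃ C : ℕ, ∀ j, B j ≤ C :=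
    ⟨Finset.univ.sup B, fun j => Finset.le_sup (Finset.mem_univ j)⟩
  have hl := natCast_pos l
  have he : (0 : ℤ) ≤ e := Int.natCast_nonneg e
  refine ⟨conf_isBits v, l * C + e * l, fun u t => ?_⟩
  have h1 := Int.emod_add_mul_ediv t l
  have h2 := Int.emod_nonneg t hl.ne'
  have h3 := Int.emod_lt_of_pos t hl
  have h4 := hB (rowOf l t) (u - e * (t / l))
  have h5 : (B (rowOf l t) : ℤ) ≤ C := by exact_mod_cast hC _
  have h6 : (l : ℤ) * (u - e * (t / l)) = l * u - e * t + e * (t % l) := by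
    linear_combination (-e : ℤ) * h1
  have h7 : (e : ℤ) * (t % l) ≤ e * l := mul_le_mul_of_nonneg_left h3.le he
  have h8 : 0 ≤ (e : ℤ) * (t % l) := mul_nonneg he h2
  constructor
  · intro h
    rw [conf_eq_one, mem_abacus_iff]
    refine h4.1 ?_
    have : (l : ℤ) * (u - e * (t / l) + C) ≤ 0 := by rw [mul_add, h6]; linarith
    have := nonpos_of_mul_nonpos_right this hl
    omega
  · intro h
    refine (conf_zero_or_one v u t).resolve_right fun hc => ?_
    rw [conf_eq_one, mem_abacus_iff] at hc
    refine h4.2 ?_ hc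
    have : (0 : ℤ) ≤ l * (u - e * (t / l) - C) := by rw [mul_sub, h6]; nlinarith
    have := nonneg_of_mul_nonneg_right this hl
    omega

theorem conf_injective {v w : ChargedMultipartition l} (h : conf e v = conf e w) : v = w :=
  abacus_injective (Set.ext fun ⟨j, x⟩ => by
    rw [← conf_eq_one_coe (e := e), ← conf_eq_one_coe (e := e), h])

/-- Half-turn and transposition make the beads of a row, counted from the right, an enumerated
column. Its distance from the vacuum gives a partition, and its charge with the opposite sign gives
the charge of the row. -/
theorem IsConf.exists_conf (hl : 2 ≤ l) {M : ℤ → ℤ → ℤ} (hM : IsConf e l M) :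
    ∃ v : ChargedMultipartition l, conf e v = M := by
  have hN := hM.transposeRev
  have hl' : (2 : ℤ) ≤ l := by exact_mod_cast hl
  obtain ⟨τ, hτ⟩ := hN.exists_enum hl'
  choose f hf using fun j : Fin l => hN.exists_charge hl' (-j)
  choose K hK using fun j => (hf j).enum hl' hN hτ
  have hmono : ∀ (j : Fin l) (k : ℕ), τ k (-j) + 1 ≤ τ (k + 1) (-j) := fun j k =>
    hτ.strictMono (-j) (Nat.lt_succ_self k)
  have hle : ∀ (j : Fin l) (k : ℕ), 0 ≤ -τ k (-j) + k + f j := by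
    intro j k
    have h1 : ∀ i : ℕ, τ k (-j) + i ≤ τ (k + i) (-j) := by
      intro i
      induction i with
      | zero => simp
      | succ i ih =>
        have := hmono j (k + i)
        rw [← add_assoc]; push_cast; linarith
    have h2 := h1 (K j)
    have h3 := hK j (k + K j) (by omega)
    push_cast at h3
    omega
  have hex : ∀ j : Fin l, ∃ μ : YoungDiagram, ∀ k : ℕ, (μ.rowLen k : ℤ) = -τ k (-j) + k + f j := by
    intro j
    obtain ⟨μ, hμ⟩ := IsPartSeq.exists_young (κ := fun k => (-τ k (-j) + k + f j).toNat)
      ⟨antitone_nat_of_succ_le fun k => Int.toNat_le_toNat (by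
        have := hmono j k; push_cast; omega), K j, fun k hk => by
        rw [hK j k hk]; simp⟩
    exact ⟨μ, fun k => by rw [hμ, Int.toNat_of_nonneg (hle j k)]⟩
  choose μ hμ using hex
  refine ⟨⟨μ, fun j => -f j⟩, ?_⟩
  have key : ∀ (j : Fin l) x, conf e ⟨μ, fun j => -f j⟩ x j = M x j := by
    intro j x
    have h1 := hM.zero_or_one x j
    have h2 := conf_zero_or_one (e := e) ⟨μ, fun j => -f j⟩ x j
    have h3 : conf e ⟨μ, fun j => -f j⟩ x j = 1 ↔ M x j = 1 := by
      rw [conf_eq_one_coe, mem_abacus_iff]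
      have h4 := hτ.mem (-j) (-x)
      rw [HeisenbergCrystal.transposeRev, neg_neg, neg_neg] at h4
      rw [h4]
      refine exists_congr fun k => ?_
      rw [bead, hμ]
      constructor <;> intro h <;> linarith
    omega
  funext u t
  have h1 := (conf_isBits (e := e) (l := l) ⟨μ, fun j => -f j⟩).period_mul
    (t / l) (u - e * (t / l)) (t % l)
  have h2 := hM.period_mul (t / l) (u - e * (t / l)) (t % l)
  have h3 := Int.emod_add_mul_ediv t l
  rw [show t % l + t / l * l = t by linarith,
    show u - e * (t / l) + t / l * e = u by ring] at h1 h2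
  rw [h1, h2, ← rowOf_val, key]

/-- `dual` counts the holes of a row, and the first hole of the vacuum lies one step after the
charge, whence the `+ 1`. -/
theorem conf_hasCharge (hl : 2 ≤ l) (v : ChargedMultipartition l) (j : Fin l) :
    HasCharge (dual (conf e v) j) (v.charge j + 1) := by
  have hl' : (2 : ℤ) ≤ l := by exact_mod_cast hl
  have hN := (conf_isConf (e := e) v).transposeRev
  obtain ⟨K, hK⟩ := (rowLen_isPartSeq (v.part j)).finite
  have henum : IsEnum (transposeRev (conf e v))
      (fun k t => -(bead (v.part (rowOf l (-t))) (v.charge (rowOf l (-t))) k + e * (-t / l))) := by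
    refine ⟨fun t => strictMono_nat_of_lt_succ fun k => ?_, fun t u => ?_⟩
    · have := bead_strictAnti (v.part (rowOf l (-t))) (v.charge (rowOf l (-t))) (Nat.lt_succ_self k)
      simp only [Nat.succ_eq_add_one] at this
      omega
    · rw [transposeRev, conf_eq_one, mem_abacus_iff]
      refine exists_congr fun k => ?_
      constructor <;> intro h <;> linarith
  have h := (hasCharge_of_enum hl' hN henum (u := -j) (f := -v.charge j) (K := K) fun k hk => by
    rw [neg_neg, rowOf_coe, fin_ediv, bead, hK k hk]; push_cast; ring).reverse
  convert h using 1
  · funext u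
    simp [dual, transposeRev]
  · ring

end Abacus


/-! ### The cancellation rule in terms of potentials -/

section Survive

variable {A B D : ℤ → ℤ}

/-- A bead facing a hole is a letter A and a hole facing a bead is a letter R; equal entries
contribute nothing. So the potential counts A minus R. -/
theorem ncard_sub_ncard (hA : ∀ t, A t = 0 ∨ A t = 1) (hB : ∀ t, B t = 0 ∨ B t = 1)
    (hD : ∀ t, D t - D (t - 1) = A t - B t) {a b : ℤ} (hab : a ≤ b) :
    (({t | (A t = 1 ∧ B t = 0) ∧ a < t ∧ t ≤ b}.ncard : ℕ) : ℤ) -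
      ({t | (A t = 0 ∧ B t = 1) ∧ a < t ∧ t ≤ b}.ncard : ℕ) = D b - D a := by
  induction b, hab using Int.leInduction with
  | base =>
    have h : ∀ P : ℤ → Prop, {t | P t ∧ a < t ∧ t ≤ a} = ∅ := fun P => by
      ext t; simp only [Set.mem_ofPred_eq, Set.mem_empty_iff_false, iff_false]; omega
    rw [h (fun t => A t = 1 ∧ B t = 0), h (fun t => A t = 0 ∧ B t = 1)]; simp
  | succ b hab ih =>
    have hfin : ∀ P : ℤ → Prop, {t | P t ∧ a < t ∧ t ≤ b}.Finite := fun P =>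
      (Set.finite_Ioc a b).subset fun t ht => ht.2
    have hin : ∀ P : ℤ → Prop, P (b + 1) → {t | P t ∧ a < t ∧ t ≤ b + 1}.ncard =
        {t | P t ∧ a < t ∧ t ≤ b}.ncard + 1 := by
      intro P hP
      rw [← Set.ncard_insert_of_notMem (a := b + 1) _ (hfin P)]
      · congr 1
        ext t
        simp only [Set.mem_ofPred_eq, Set.mem_insert_iff]
        constructor
        · rintro ⟨h1, h2, h3⟩
          by_cases ht : t = b + 1
          · exact Or.inl ht
          · exact Or.inr ⟨h1, h2, by omega⟩
        · rintro (rfl | ⟨h1, h2, h3⟩)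
          · exact ⟨hP, by omega, le_rfl⟩
          · exact ⟨h1, h2, by omega⟩
      · simp
    have hout : ∀ P : ℤ → Prop, ¬ P (b + 1) → {t | P t ∧ a < t ∧ t ≤ b + 1}.ncard =
        {t | P t ∧ a < t ∧ t ≤ b}.ncard := by
      intro P hP
      congr 1
      ext t
      simp only [Set.mem_ofPred_eq]
      constructor
      · rintro ⟨h1, h2, h3⟩
        have : t ≠ b + 1 := fun h => hP (h ▸ h1)
        exact ⟨h1, h2, by omega⟩
      · rintro ⟨h1, h2, h3⟩
        exact ⟨h1, h2, by omega⟩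
    have hd := hD (b + 1)
    rw [add_sub_cancel_right] at hd
    rcases hA (b + 1) with h1 | h1 <;> rcases hB (b + 1) with h2 | h2
    · rw [hout (fun t => A t = 1 ∧ B t = 0) (by simp [h1]),
        hout (fun t => A t = 0 ∧ B t = 1) (by simp [h2])]; omega
    · rw [hout (fun t => A t = 1 ∧ B t = 0) (by simp [h1]),
        hin (fun t => A t = 0 ∧ B t = 1) (by simp [h1, h2])]; push_cast; omega
    · rw [hin (fun t => A t = 1 ∧ B t = 0) (by simp [h1, h2]),
        hout (fun t => A t = 0 ∧ B t = 1) (by simp [h1])]; push_cast; omega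
    · rw [hout (fun t => A t = 1 ∧ B t = 0) (by simp [h2]),
        hout (fun t => A t = 0 ∧ B t = 1) (by simp [h1])]; omega

/-- The letter at position `g` survives the cancellation. -/
def Survives (A B : ℤ → ℤ) (g : ℤ) : Prop :=
  (A g = 1 ∧ B g = 0) ∧ ∀ d, A d = 0 ∧ B d = 1 → g < d →
    {t | (A t = 0 ∧ B t = 1) ∧ g < t ∧ t ≤ d}.ncard ≤ {t | (A t = 1 ∧ B t = 0) ∧ g < t ∧ t ≤ d}.ncard

theorem survives_iff (hA : ∀ t, A t = 0 ∨ A t = 1) (hB : ∀ t, B t = 0 ∨ B t = 1)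
    (hD : ∀ t, D t - D (t - 1) = A t - B t) {g : ℤ} :
    Survives A B g ↔ ∀ t, g ≤ t → D (g - 1) < D t := by
  constructor
  · rintro ⟨h1, h2⟩ t ht
    have h0 := hD g
    suffices D g ≤ D t by omega
    induction t, ht using Int.leInduction with
    | base => exact le_rfl
    | succ t ht ih =>
      have h3 := hD (t + 1)
      rw [add_sub_cancel_right] at h3
      by_cases hR : A (t + 1) = 0 ∧ B (t + 1) = 1
      · have := h2 _ hR (by omega)
        have := ncard_sub_ncard hA hB hD (show g ≤ t + 1 by omega)
        omega
      · have := hA (t + 1)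
        have := hB (t + 1)
        omega
  · intro h
    have h0 := hD g
    have h1 := h g le_rfl
    have h2 := hA g
    have h3 := hB g
    refine ⟨by omega, fun d _ hgd => ?_⟩
    have h4 := h d hgd.le
    have h5 := ncard_sub_ncard hA hB hD hgd.le
    omega

/-- A letter at `g` survives exactly when the potential stays above `D (g - 1)` from `g` on. The
surviving letter with the smallest `g` is therefore the one just after the last minimum, which is
what a certificate says after subtracting the minimum. -/
theorem exists_lowers_iff (hA : ∀ t, A t = 0 ∨ A t = 1) (hB : ∀ t, B t = 0 ∨ B t = 1)
    (hlo : ∃ a, ∀ t ≤ a, A t = B t) (hhi : ∃ b, ∀ t, b ≤ t → A t = B t) {g : ℤ} :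
    (∃ D, Lowers A B D g) ↔ Survives A B g ∧ ∀ g' < g, ¬ Survives A B g' := by
  constructor
  · rintro ⟨D, hD⟩
    refine ⟨(survives_iff hA hB hD.step).2 fun t ht => by rw [hD.zero]; exact hD.pos t ht,
      fun g' hg' h => ?_⟩
    have := (survives_iff hA hB hD.step).1 h (g - 1) (by omega)
    rw [hD.zero] at this
    exact absurd (hD.nonneg (g' - 1)) (by omega)
  · rintro ⟨h1, h2⟩
    obtain ⟨D, hD⟩ := exists_potential fun t => A t - B t
    rw [survives_iff hA hB hD] at h1
    obtain ⟨a, ha⟩ := hlo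
    obtain ⟨b, hb⟩ := hhi
    obtain ⟨m, hm, hm'⟩ := exists_last_min (D := D) (a := a) (b := max b g)
      (fun t ht => (const_below (fun s hs => by rw [hD, ha s (by omega), sub_self]) ht))
      (fun t ht => const_above (fun s hs => by
        rw [hD, hb s (by have := le_max_left b g; omega), sub_self]) ht)
      (h1 _ (le_max_right b g))
    have h3 : ¬ m + 1 < g := fun hlt => h2 _ hlt ((survives_iff hA hB hD).2 fun t ht => by
      rw [add_sub_cancel_right]; exact hm' t (by omega))
    have h4 : ¬ g ≤ m := fun hle => by
      have := h1 m hle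
      have := hm (g - 1)
      omega
    obtain rfl : m = g - 1 := by omega
    exact ⟨fun t => D t - D (g - 1), fun t => by rw [← hD]; ring, sub_self _,
      fun t => sub_nonneg.2 (hm t), fun t ht => sub_pos.2 (h1 t ht)⟩

end Survive

/-! ### Kashiwara arrows as moves of beads -/

section Boxes

variable {e l : ℕ}

/-- The row of the configuration in which the bead of the box `γ` lies in column `U`. -/
def slot (e : ℕ) (v : ChargedMultipartition l) (U : ℤ) (γ : Box l) : ℤ :=
  γ.1 + l * ((U - content v γ) / e)

variable {v w : ChargedMultipartition l} {U : ℤ} {γ δ : Box l}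

theorem content_congr (h : w.charge = v.charge) (γ : Box l) : content w γ = content v γ := by
  rw [content, content, h]

theorem slot_congr (h : w.charge = v.charge) (γ : Box l) : slot e w U γ = slot e v U γ := by
  rw [slot, slot, content_congr h]

variable [NeZero l]

theorem slot_row : rowOf l (slot e v U γ) = γ.1 := by
  rw [slot, rowOf_add_mul, rowOf_coe]

theorem slot_div : slot e v U γ / l = (U - content v γ) / e := by
  rw [slot, Int.add_mul_ediv_left _ _ (natCast_pos l).ne', fin_ediv, zero_add]

theorem slot_col (h : ((content v γ : ℤ) : ZMod e) = U) :
    U - e * (slot e v U γ / l) = content v γ := by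
  have h1 := (ZMod.intCast_eq_intCast_iff_dvd_sub _ _ _).1 h
  rw [slot_div, Int.mul_ediv_cancel' h1]; ring

theorem orb_eq_one_iff {u₀ t₀ u t : ℤ} : orb e l u₀ t₀ u t = 1 ↔
    rowOf l t = rowOf l t₀ ∧ u - e * (t / l) = u₀ - e * (t₀ / l) := by
  have hl := natCast_pos l
  rw [orb_eq_one]
  constructor
  · rintro ⟨m, rfl, rfl⟩
    rw [mul_comm m (l : ℤ), rowOf_add_mul, Int.add_mul_ediv_left _ _ hl.ne']
    exact ⟨rfl, by ring⟩
  · rintro ⟨h1, h2⟩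
    rw [rowOf_eq_iff, rowOf_val] at h1
    have h3 := Int.emod_add_mul_ediv t l
    have h4 := Int.emod_add_mul_ediv t₀ l
    exact ⟨t / l - t₀ / l, by linear_combination h2, by linear_combination h1 - h3 + h4⟩

/-- Adding a box moves its bead from the column equal to its content to the next one; `slot` selects
the copy of this bead that lies in column `U`. -/
theorem AddsBoxAt.moves (h : AddsBoxAt v γ w) (hU : ((content v γ : ℤ) : ZMod e) = U) :
    Moves e l U (slot e v U γ) (conf e v) (conf e w) := by
  obtain ⟨h1, h2, h3⟩ := h
  intro u t
  have o1 := orb_eq_one_iff (e := e) (l := l) (u₀ := U) (t₀ := slot e v U γ) (u := u) (t := t)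
  have o2 := orb_eq_one_iff (e := e) (l := l) (u₀ := U + 1) (t₀ := slot e v U γ) (u := u) (t := t)
  rw [slot_row, slot_col hU] at o1
  rw [slot_row, add_sub_right_comm, slot_col hU] at o2
  have c1 := conf_eq_one (e := e) (v := v) (u := u) (t := t)
  have c2 := conf_eq_one (e := e) (v := w) (u := u) (t := t)
  rw [mem_abacus_iff] at c1 c2
  rw [h1] at c2
  have d1 := conf_zero_or_one (e := e) v u t
  have d2 := conf_zero_or_one (e := e) w u t
  have d3 := orb_zero_or_one e l U (slot e v U γ) u t
  have d4 := orb_zero_or_one e l (U + 1) (slot e v U γ) u t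
  by_cases hrow : rowOf l t = γ.1
  · simp only [hrow, true_and] at o1 o2 c1 c2
    have h4 := h2.range_bead (v.charge γ.1)
    obtain ⟨h5, h6⟩ := h2.bead_mem (v.charge γ.1)
    rw [h4] at c2
    change _ ↔ _ = (γ.2.2 : ℤ) - γ.2.1 + v.charge γ.1 at o1
    change _ ↔ _ = (γ.2.2 : ℤ) - γ.2.1 + v.charge γ.1 + 1 at o2
    by_cases x1 : u - e * (t / l) = (γ.2.2 : ℤ) - γ.2.1 + v.charge γ.1
    · rw [x1] at o1 o2 c1 c2
      have := c1.2 h5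
      have := o1.2 rfl
      simp only [ne_eq, not_true_eq_false, false_and, or_false, one_ne_zero,
        iff_false, left_eq_add] at o2 c2
      omega
    · by_cases x2 : u - e * (t / l) = (γ.2.2 : ℤ) - γ.2.1 + v.charge γ.1 + 1
      · rw [x2] at o2 c1 c2
        have := o2.2 rfl
        have := c2.2 (Or.inl rfl)
        have := c1.not.2 h6
        have := o1.not.2 x1
        omega
      · simp only [x1, x2, iff_false, false_or, not_false_eq_true, true_and, ne_eq] at o1 o2 c2
        rw [← c1] at c2
        omega
  · simp only [hrow, false_and, iff_false] at o1 o2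
    rw [h3 _ hrow, ← c1] at c2
    omega

variable [NeZero e]

theorem exists_addsBoxAt {t : ℤ} (h1 : conf e v U t = 1) (h2 : conf e v (U + 1) t = 0) :
    ∃ γ w, AddsBoxAt v γ w ∧ ((content v γ : ℤ) : ZMod e) = U ∧ slot e v U γ = t := by
  have h3 : ¬ conf e v (U + 1) t = 1 := by omega
  rw [conf_eq_one, mem_abacus_iff] at h1 h3
  rw [add_sub_right_comm] at h3
  obtain ⟨a, b, hab, ν, hν⟩ := exists_addsBox_of_bead h1 h3
  have hc : content v (rowOf l t, (a, b)) = U - e * (t / l) := hab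
  refine ⟨(rowOf l t, (a, b)), ⟨Function.update v.part (rowOf l t) ν, v.charge⟩,
    ⟨rfl, by simpa using hν, fun j hj => by simp [hj]⟩, ?_, ?_⟩
  · rw [hc]; simp
  · rw [slot, hc, sub_sub_cancel, Int.mul_ediv_cancel_left _ (natCast_pos e).ne', rowOf_val]
    exact Int.emod_add_mul_ediv t l

theorem IsAddable.bits (h : IsAddable e (U : ZMod e) v γ) :
    conf e v U (slot e v U γ) = 1 ∧ conf e v (U + 1) (slot e v U γ) = 0 := by
  obtain ⟨h1, w, h2⟩ := h
  have h3 := h2.2.1.bead_mem (v.charge γ.1)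
  have h4 : conf e v U (slot e v U γ) = 1 := by
    rw [conf_eq_one, slot_col h1, slot_row, mem_abacus_iff]; exact h3.1
  refine ⟨h4, (conf_zero_or_one _ _ _).resolve_right fun h5 => ?_⟩
  rw [conf_eq_one, add_sub_right_comm, slot_col h1, slot_row, mem_abacus_iff] at h5
  exact h3.2 h5

theorem IsRemovable.bits (he : 2 ≤ e) (h : IsRemovable e (U : ZMod e) v γ) :
    conf e v U (slot e v U γ) = 0 ∧ conf e v (U + 1) (slot e v U γ) = 1 := by
  obtain ⟨h1, w, h2⟩ := h
  rw [content_congr h2.1] at h1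
  have h3 := h2.moves h1
  have he' : (2 : ℤ) ≤ e := by exact_mod_cast he
  have h4 := IsAddable.bits ⟨h1, _, h2⟩
  rw [slot_congr h2.1]
  have h5 := h3 U (slot e w U γ)
  have h6 := h3 (U + 1) (slot e w U γ)
  rw [orb_self, orb_next_col he' (Or.inr (by ring))] at h5
  rw [orb_self, orb_next_col he' (Or.inl rfl)] at h6
  omega

/-- The bead is moved back, the resulting configuration is realised by a multipartition, and the
corresponding box is added to it again. -/
theorem exists_removable (he : 2 ≤ e) (hl : 2 ≤ l) {t : ℤ} (h1 : conf e v U t = 0)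
    (h2 : conf e v (U + 1) t = 1) : ∃ γ, IsRemovable e (U : ZMod e) v γ ∧ slot e v U γ = t := by
  have he' : (2 : ℤ) ≤ e := by exact_mod_cast he
  have hl' : (2 : ℤ) ≤ l := by exact_mod_cast hl
  have hv := conf_isConf (e := e) v
  let N : ℤ → ℤ → ℤ := fun x s => conf e v x s + orb e l U t x s - orb e l (U + 1) t x s
  have hm : Moves e l U t N (conf e v) := fun x s => by simp only [N]; ring
  have hN : IsBits e l N := by
    refine ⟨fun x s => ?_, fun x s => ?_⟩
    · have d3 := orb_zero_or_one e l U t x s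
      have d4 := orb_zero_or_one e l (U + 1) t x s
      have c1 : orb e l U t x s = 1 → conf e v x s = 0 := fun h => by
        rw [← hv.toIsBits.orb_eq h] at h1; exact h1
      have c2 : orb e l (U + 1) t x s = 1 → conf e v x s = 1 := fun h => by
        rw [← hv.toIsBits.orb_eq h] at h2; exact h2
      have := conf_zero_or_one (e := e) v x s
      simp only [N]
      omega
    · simp only [N, orb_period, hv.period]
  obtain ⟨w, hw⟩ := (hv.of_moves hN (Or.inr hm)).exists_conf hl
  have a1 := hm U t
  have a2 := hm (U + 1) t
  rw [orb_self, orb_next_col he' (Or.inr (by ring))] at a1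
  rw [orb_self, orb_next_col he' (Or.inl rfl)] at a2
  rw [← hw] at a1 a2
  obtain ⟨γ, v', h3, h4, h5⟩ := exists_addsBoxAt (e := e) (v := w) (U := U) (t := t) (by omega) (by omega)
  have h6 := h3.moves h4
  rw [h5, hw] at h6
  obtain rfl : v = v' := conf_injective (e := e) (funext fun x => funext fun s => by rw [hm, h6])
  refine ⟨γ, ⟨?_, w, h3⟩, ?_⟩
  · rw [content_congr h3.1, h4]
  · rw [slot_congr h3.1, h5]

/-- The order on boxes is reversed: larger content means an earlier period of rows, and for equal
content the smaller coordinate has the smaller row. So the rightmost surviving letter is the one in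
the lowest row. -/
theorem boxLT_iff (hγ : ((content v γ : ℤ) : ZMod e) = U) (hδ : ((content v δ : ℤ) : ZMod e) = U) :
    BoxLT v γ δ ↔ slot e v U δ < slot e v U γ := by
  have h1 := slot_col hγ
  have h2 := slot_col hδ
  have h3 := Int.emod_add_mul_ediv (slot e v U γ) l
  have h4 := Int.emod_add_mul_ediv (slot e v U δ) l
  rw [← rowOf_val, slot_row] at h3 h4
  have h5 := γ.1.2
  have h6 := δ.1.2
  have he := natCast_pos e
  have hl := natCast_pos l
  rw [BoxLT, ← h1, ← h2, Fin.lt_def]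
  generalize slot e v U γ / l = p at *
  generalize slot e v U δ / l = q at *
  rcases lt_trichotomy p q with h | rfl | h
  · have : (e : ℤ) * p < e * q := by nlinarith
    have : (l : ℤ) * (p + 1) ≤ l * q := by nlinarith
    rw [mul_add] at this
    constructor <;> intro <;> omega
  · constructor <;> intro <;> omega
  · have : (e : ℤ) * q < e * p := by nlinarith
    have : (l : ℤ) * (q + 1) ≤ l * p := by nlinarith
    rw [mul_add] at this
    constructor <;> intro <;> omega

theorem content_eq_of_slot (hγ : ((content v γ : ℤ) : ZMod e) = U)
    (hδ : ((content v δ : ℤ) : ZMod e) = U) (h : slot e v U γ = slot e v U δ) :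
    γ.1 = δ.1 ∧ (γ.2.2 : ℤ) - γ.2.1 = δ.2.2 - δ.2.1 := by
  have h0 : γ.1 = δ.1 := by rw [← slot_row (e := e) (v := v) (U := U), h, slot_row]
  have h1 : content v γ = content v δ := by rw [← slot_col hγ, h, slot_col hδ]
  rw [content, content, h0] at h1
  exact ⟨h0, by omega⟩

theorem slot_injOn_addable : Set.InjOn (slot e v U) {β | IsAddable e (U : ZMod e) v β} := by
  rintro γ ⟨h1, w, h2⟩ δ ⟨h3, w', h4⟩ h
  obtain ⟨h5, h6⟩ := content_eq_of_slot h1 h3 h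
  have h7 := h4.2.1
  rw [← h5] at h7
  exact Prod.ext h5 (h2.2.1.eq_of_content h7 h6)

theorem slot_injOn_removable : Set.InjOn (slot e v U) {β | IsRemovable e (U : ZMod e) v β} := by
  rintro γ ⟨h1, w, h2⟩ δ ⟨h3, w', h4⟩ h
  obtain ⟨h5, h6⟩ := content_eq_of_slot h1 h3 h
  have h7 := h4.2.1
  rw [← h5] at h7
  exact Prod.ext h5 (h2.2.1.eq_of_content' h7 h6)

theorem survivesAddable_iff (he : 2 ≤ e) (hl : 2 ≤ l) :
    SurvivesAddable e (U : ZMod e) v γ ↔ IsAddable e (U : ZMod e) v γ ∧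
      Survives (conf e v U) (conf e v (U + 1)) (slot e v U γ) := by
  refine and_congr_right fun hγ => ?_
  have hA : ∀ d, {t | (conf e v U t = 1 ∧ conf e v (U + 1) t = 0) ∧ slot e v U γ < t ∧ t ≤ d}.ncard =
      {β | IsAddable e (U : ZMod e) v β ∧ slot e v U β ≤ d ∧ BoxLT v β γ}.ncard := by
    intro d
    rw [← Set.InjOn.ncard_image (f := slot e v U) (slot_injOn_addable.mono fun β h => h.1)]
    congr 1
    ext t
    simp only [Set.mem_ofPred_eq, Set.mem_image]
    constructor
    · rintro ⟨⟨h1, h2⟩, h3, h4⟩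
      obtain ⟨β, w, h5, h6, rfl⟩ := exists_addsBoxAt h1 h2
      exact ⟨β, ⟨⟨h6, w, h5⟩, h4, (boxLT_iff h6 hγ.1).2 h3⟩, rfl⟩
    · rintro ⟨β, ⟨h1, h2, h3⟩, rfl⟩
      exact ⟨h1.bits, (boxLT_iff h1.1 hγ.1).1 h3, h2⟩
  have hR : ∀ d, {t | (conf e v U t = 0 ∧ conf e v (U + 1) t = 1) ∧ slot e v U γ < t ∧ t ≤ d}.ncard =
      {β | IsRemovable e (U : ZMod e) v β ∧ slot e v U β ≤ d ∧ BoxLT v β γ}.ncard := by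
    intro d
    rw [← Set.InjOn.ncard_image (f := slot e v U) (slot_injOn_removable.mono fun β h => h.1)]
    congr 1
    ext t
    simp only [Set.mem_ofPred_eq, Set.mem_image]
    constructor
    · rintro ⟨⟨h1, h2⟩, h3, h4⟩
      obtain ⟨β, h5, rfl⟩ := exists_removable he hl h1 h2
      exact ⟨β, ⟨h5, h4, (boxLT_iff h5.1 hγ.1).2 h3⟩, rfl⟩
    · rintro ⟨β, ⟨h1, h2, h3⟩, rfl⟩
      exact ⟨IsRemovable.bits he h1, (boxLT_iff h1.1 hγ.1).1 h3, h2⟩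
  have hA' : ∀ δ, IsRemovable e (U : ZMod e) v δ →
      {β | IsAddable e (U : ZMod e) v β ∧ ¬ BoxLT v β δ ∧ BoxLT v β γ} =
      {β | IsAddable e (U : ZMod e) v β ∧ slot e v U β ≤ slot e v U δ ∧ BoxLT v β γ} := fun δ hδ => by
    ext β
    simp only [Set.mem_ofPred_eq]
    refine and_congr_right fun hβ => ?_
    rw [boxLT_iff hβ.1 hδ.1, not_lt]
  have hR' : ∀ δ, IsRemovable e (U : ZMod e) v δ →
      {β | IsRemovable e (U : ZMod e) v β ∧ ¬ BoxLT v β δ ∧ BoxLT v β γ} =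
      {β | IsRemovable e (U : ZMod e) v β ∧ slot e v U β ≤ slot e v U δ ∧ BoxLT v β γ} := fun δ hδ => by
    ext β
    simp only [Set.mem_ofPred_eq]
    refine and_congr_right fun hβ => ?_
    rw [boxLT_iff hβ.1 hδ.1, not_lt]
  constructor
  · intro h
    refine ⟨hγ.bits, fun d hd hlt => ?_⟩
    obtain ⟨δ, hδ, rfl⟩ := exists_removable he hl hd.1 hd.2
    have := h δ hδ ((boxLT_iff hδ.1 hγ.1).2 hlt)
    rwa [hA' δ hδ, hR' δ hδ, ← hA, ← hR] at this
  · rintro ⟨-, h⟩ δ hδ hlt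
    have := h (slot e v U δ) (IsRemovable.bits he hδ) ((boxLT_iff hδ.1 hγ.1).1 hlt)
    rwa [hA, hR, ← hA' δ hδ, ← hR' δ hδ] at this

theorem kashiwaraArrow_iff (he : 2 ≤ e) (hl : 2 ≤ l) :
    KashiwaraArrow e (U : ZMod e) v w ↔ Arr e l U (conf e v) (conf e w) := by
  have hv := conf_isConf (e := e) v
  have he' : (2 : ℤ) ≤ e := by exact_mod_cast he
  have hlo : ∃ a, ∀ t ≤ a, conf e v U t = conf e v (U + 1) t := by
    obtain ⟨a, ha⟩ := hv.col_zero he' U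
    obtain ⟨b, hb⟩ := hv.col_zero he' (U + 1)
    exact ⟨min a b, fun t ht => by
      rw [ha t (ht.trans (min_le_left _ _)), hb t (ht.trans (min_le_right _ _))]⟩
  have hhi : ∃ b, ∀ t, b ≤ t → conf e v U t = conf e v (U + 1) t := by
    obtain ⟨a, ha⟩ := hv.col_one he' U
    obtain ⟨b, hb⟩ := hv.col_one he' (U + 1)
    exact ⟨max a b, fun t ht => by
      rw [ha t ((le_max_left _ _).trans ht), hb t ((le_max_right _ _).trans ht)]⟩
  have hcert := fun g => exists_lowers_iff (hv.zero_or_one U) (hv.zero_or_one (U + 1)) hlo hhi (g := g)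
  constructor
  · rintro ⟨γ, ⟨h1, h2⟩, h3⟩
    obtain ⟨h4, h5⟩ := (survivesAddable_iff he hl).1 h1
    obtain ⟨D, hD⟩ := (hcert (slot e v U γ)).2 ⟨h5, fun g' hg' hs => by
      obtain ⟨δ, w', h6, h7, rfl⟩ := exists_addsBoxAt hs.1.1 hs.1.2
      exact h2 δ ((survivesAddable_iff he hl).2 ⟨⟨h7, w', h6⟩, hs⟩) ((boxLT_iff h4.1 h7).2 hg')⟩
    exact ⟨D, _, hD, h3.moves h4.1⟩
  · rintro ⟨D, a, hD, hm⟩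
    obtain ⟨h1, h2⟩ := (hcert a).1 ⟨D, hD⟩
    obtain ⟨γ, w', h3, h4, rfl⟩ := exists_addsBoxAt h1.1.1 h1.1.2
    have h5 := h3.moves h4
    obtain rfl : w' = w := conf_injective (e := e) (funext fun x => funext fun s => by rw [hm, h5])
    refine ⟨γ, ⟨(survivesAddable_iff he hl).2 ⟨⟨h4, w', h3⟩, h1⟩, fun δ hδ hlt => ?_⟩, h3⟩
    obtain ⟨h6, h7⟩ := (survivesAddable_iff he hl).1 hδ
    exact h2 _ ((boxLT_iff h4 h6.1).1 hlt) h7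

end Boxes


/-! ### Level-rank duality as transposed complement -/

theorem Lowers.congr {A B A' B' D : ℤ → ℤ} {a : ℤ} (h : Lowers A B D a) (h1 : ∀ t, A' t = A t)
    (h2 : ∀ t, B' t = B t) : Lowers A' B' D a := by
  obtain rfl : A' = A := funext h1
  obtain rfl : B' = B := funext h2
  exact h

theorem Lowers.comp_add {A B D : ℤ → ℤ} {a : ℤ} (h : Lowers A B D a) (y : ℤ) :
    Lowers (fun t => A (t + y)) (fun t => B (t + y)) (fun t => D (t + y)) (a - y) := by
  refine ⟨fun t => ?_, ?_, fun t => h.nonneg _, fun t ht => h.pos _ (by omega)⟩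
  · rw [← h.step, show t - 1 + y = t + y - 1 by ring]
  · rw [show a - y - 1 + y = a - 1 by ring, h.zero]

theorem arr_comp_add {e l x y U : ℤ} {M N : ℤ → ℤ → ℤ} (h : Arr e l (U + x) M N) :
    Arr e l U (fun u t => M (u + x) (t + y)) (fun u t => N (u + x) (t + y)) := by
  obtain ⟨D, a, hD, hm⟩ := h
  refine ⟨_, _, (hD.comp_add y).congr (fun t => rfl) fun t => ?_, fun u t => ?_⟩
  · rw [add_right_comm]
  · beta_reduce
    rw [hm, ← orb_add e l U (a - y) u t x y, ← orb_add e l (U + 1) (a - y) u t x y, sub_add_cancel,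
      add_right_comm U 1 x]

theorem arr_comp_add_iff {e l x y U : ℤ} {M N : ℤ → ℤ → ℤ} :
    Arr e l U (fun u t => M (u + x) (t + y)) (fun u t => N (u + x) (t + y)) ↔
      Arr e l (U + x) M N := by
  refine ⟨fun h => ?_, arr_comp_add⟩
  have := arr_comp_add (U := U + x) (x := -x) (y := -y) (by rwa [add_neg_cancel_right])
  simpa using this

section LevelRank

variable {e l : ℕ} [NeZero e] [NeZero l]

theorem tauDot_eq (c : ℤ) : tauDot e l c = (rowOf e (-c), -(-c / e)) := by
  have h := Int.emod_add_mul_ediv (-c / e) l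
  rw [tauDot, divY, divZ, ← Int.ediv_ediv_of_nonneg (natCast_pos e).le]
  refine Prod.ext rfl ?_
  simp only
  linarith

theorem tau_mem_iff {v : ChargedMultipartition l} (c : ℤ) :
    tau e l c ∈ abacus v ↔ conf e v (-(-c % e)) (-c / e) = 1 := by
  rw [conf_eq_one, tau, divX, divZ, ← Int.ediv_ediv_of_nonneg (natCast_pos e).le]
  have : -(-c % (e : ℤ)) + e * -(-c / e / l) = -(-c % (e : ℤ)) - e * (-c / e / l) := by ring
  rw [this]
  rfl

theorem mem_levelRank_iff {v : ChargedMultipartition l} {i : Fin e} {y : ℤ} :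
    (i, y) ∈ tauDot e l '' conjugateAbacus (oneAbacus e v) ↔ conf e v (i - e + 1) (y - 1) ≠ 1 := by
  have he := natCast_pos e
  have key : ∀ c : ℤ, -(-(1 - c) % (e : ℤ)) = (rowOf e (-c) : ℕ) - e + 1 ∧
      -(1 - c) / (e : ℤ) = -(-c / e) - 1 := by
    intro c
    have h1 := Int.emod_add_mul_ediv (-c) e
    have h2 := Int.emod_nonneg (-c) he.ne'
    have h3 := Int.emod_lt_of_pos (-c) he
    -- With `-c = r + e * q` the reflection `c ↦ 1 - c` replaces `r` by `e - 1 - r` and `q` by `-q -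
    -- 1`. This is the source of the translation by `1 - e` in columns and `-1` in rows.
    have h4 : -(1 - c) = (e - 1 - -c % e) + e * (-(-c / e) - 1) := by linear_combination h1
    rw [h4, rowOf_val, Int.add_mul_emod_self_left, Int.add_mul_ediv_left _ _ he.ne',
      Int.emod_eq_of_lt (by omega) (by omega), Int.ediv_eq_zero_of_lt (by omega) (by omega)]
    constructor <;> ring
  constructor
  · rintro ⟨c, hc, h⟩
    rw [tauDot_eq, Prod.mk.injEq] at h
    obtain ⟨rfl, rfl⟩ := h
    rw [← (key c).1, ← (key c).2]
    exact fun h => hc ((tau_mem_iff (1 - c)).2 h)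
  · intro h
    have h1 : rowOf e (-(e * y - i)) = i := by
      rw [rowOf_eq_iff, show -(e * y - i : ℤ) = i + e * (-y) by ring, Int.add_mul_emod_self_left, fin_emod]
    have h2 : -(-(e * y - i : ℤ) / e) = y := by
      rw [show -(e * y - i : ℤ) = i + e * (-y) by ring, Int.add_mul_ediv_left _ _ he.ne', fin_ediv]; ring
    refine ⟨e * y - i, fun hc => h ?_, by rw [tauDot_eq, h1, h2]⟩
    have h3 := (tau_mem_iff (e := e) (v := v) (1 - (e * y - i))).1 hc
    rwa [(key _).1, (key _).2, h1, h2] at h3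

theorem isLevelRankDual_iff (v : ChargedMultipartition l) (v' : ChargedMultipartition e) :
    IsLevelRankDual v v' ↔ conf l v' = fun T U => dual (conf e v) (T + -1) (U + (1 - e)) := by
  have he := natCast_pos e
  have hdual : ∀ (i : Fin e) (y : ℤ), conf e v (i - e + 1) (y - 1) ≠ 1 ↔
      dual (conf e v) (y + -1) (i + (1 - e)) = 1 := by
    intro i y
    have := conf_zero_or_one (e := e) v (i - e + 1) (y - 1)
    rw [dual, show (i : ℤ) + (1 - e) = i - e + 1 by ring, ← sub_eq_add_neg]
    omega
  have hper : ∀ T U : ℤ, dual (conf e v) (T + -1) (U + (1 - e)) =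
      dual (conf e v) (T - l * (U / e) + -1) (U % e + (1 - e)) := by
    intro T U
    have h1 := (conf_isBits (e := e) v).dual.period_mul (U / e) (T - l * (U / e) + -1) (U % e + (1 - e))
    have h2 := Int.emod_add_mul_ediv U e
    rw [← h1]
    congr 1
    · ring
    · linear_combination -h2
  constructor
  · intro h
    funext T U
    have h1 := conf_eq_one (e := l) (v := v') (u := T) (t := U)
    rw [h, mem_levelRank_iff, hdual, rowOf_val, ← hper] at h1
    have h2 := conf_zero_or_one (e := l) v' T U
    have h3 := (conf_isBits (e := e) v).dual.zero_or_one (T + -1) (U + (1 - e))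
    omega
  · intro h
    rw [IsLevelRankDual]
    ext ⟨i, y⟩
    rw [mem_levelRank_iff, hdual, ← conf_eq_one_coe (e := l), h]

theorem exists_levelRankDual (he : 2 ≤ e) (v : ChargedMultipartition l) :
    ∃ v' : ChargedMultipartition e, IsLevelRankDual v v' := by
  have hd := (conf_isConf (e := e) v).dual
  obtain ⟨B, hB⟩ := hd.bounded
  have h : IsConf l e fun T U => dual (conf e v) (T + -1) (U + (1 - e)) := by
    refine ⟨⟨fun T U => hd.zero_or_one _ _, fun T U => ?_⟩, B + |(l : ℤ) * (1 - e)| + |(e : ℤ)|,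
      fun T U => ⟨fun h => (hB _ _).1 ?_, fun h => (hB _ _).2 ?_⟩⟩
    · rw [add_right_comm T, add_right_comm U, hd.period]
    · have := neg_abs_le ((l : ℤ) * (1 - e))
      have := neg_abs_le (e : ℤ)
      linarith
    · have := le_abs_self ((l : ℤ) * (1 - e))
      have := le_abs_self (e : ℤ)
      linarith
  obtain ⟨v', hv'⟩ := h.exists_conf he
  exact ⟨v', (isLevelRankDual_iff v v').2 hv'⟩

theorem HasCharge.add_orb {A : ℤ → ℤ} {f : ℤ} (h : HasCharge A f) (ε T c : ℤ) (j : Fin l) :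
    HasCharge (fun u => A u + ε * orb l e T c j u) (f - ε * if rowOf l T = j then 1 else 0) := by
  obtain ⟨n, h1, ⟨a, h2⟩, b, h3⟩ := h
  have ho : ∀ u, orb l e T c j u = 1 ↔ rowOf l T = j ∧ u = c - e * (T / l) := fun u => by
    rw [orb_swap, orb_eq_one_iff, rowOf_coe, fin_ediv, mul_zero, sub_zero, eq_comm (a := j)]
  have hz := orb_zero_or_one l e T c j
  split_ifs with hr
  · refine ⟨fun u => n u + ε * if c - e * (T / l) ≤ u then 1 else 0, fun u => ?_,
      ⟨min a (c - e * (T / l) - 1), fun u hu => ?_⟩, max b (c - e * (T / l)), fun u hu => ?_⟩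
    · have h4 := hz u
      have h5 := ho u
      rw [and_iff_right hr] at h5
      have h6 : (if c - e * (T / l) ≤ u then (1 : ℤ) else 0) -
          (if c - e * (T / l) ≤ u - 1 then 1 else 0) = orb l e T c j u := by
        split_ifs <;> omega
      beta_reduce
      rw [← h6, ← h1]; ring
    · beta_reduce
      rw [h2 _ (hu.trans (min_le_left _ _)), if_neg (by have := min_le_right a (c - e * (T / l) - 1); omega)]
      ring
    · beta_reduce
      rw [h3 _ ((le_max_left _ _).trans hu), if_pos ((le_max_right _ _).trans hu)]
      ring
  · have h4 : ∀ u, orb l e T c j u = 0 := fun u => (hz u).resolve_right fun h => hr ((ho u).1 h).1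
    simp only [h4, mul_zero, add_zero, sub_zero]
    exact ⟨n, h1, ⟨a, h2⟩, b, h3⟩

/-- The orbit that moves from row `T + 1` to row `T` meets each row of the abacus at most once, so
one bead passes between the corresponding two rows. -/
theorem RowArr.charge (hl : 2 ≤ l) {v w : ChargedMultipartition l} {T : ℤ}
    (h : RowArr e l T (conf e v) (conf e w)) (j : Fin l) :
    w.charge j = v.charge j + (if rowOf l T = j then 1 else 0) -
      if rowOf l (T + 1) = j then 1 else 0 := by
  obtain ⟨D, c, -, hm⟩ := h
  have h1 := ((conf_hasCharge (e := e) hl v j).add_orb (e := e) (-1) T c j).add_orb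
    (e := e) 1 (T + 1) c j
  have h2 := conf_hasCharge (e := e) hl w j
  rw [show dual (conf e w) j = fun u => dual (conf e v) j u + -1 * orb l e T c j u +
    1 * orb l e (T + 1) c j u from funext fun u => by rw [hm]; ring] at h2
  have := h2.unique h1
  omega

theorem RowArr.sum_charge (hl : 2 ≤ l) {v w : ChargedMultipartition l} {T : ℤ}
    (h : RowArr e l T (conf e v) (conf e w)) : ∑ j, w.charge j = ∑ j, v.charge j := by
  rw [Finset.sum_congr rfl fun j _ => h.charge hl j, Finset.sum_sub_distrib, Finset.sum_add_distrib]
  simp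

theorem levelRankDual_kashiwaraArrow_iff (he : 2 ≤ e) (hl : 2 ≤ l) {v w : ChargedMultipartition l}
    {v' w' : ChargedMultipartition e} (hv : IsLevelRankDual v v') (hw : IsLevelRankDual w w') (T : ℤ) :
    KashiwaraArrow l (T : ZMod l) v' w' ↔ RowArr e l (T - 1) (conf e v) (conf e w) := by
  rw [kashiwaraArrow_iff hl he, (isLevelRankDual_iff v v').1 hv, (isLevelRankDual_iff w w').1 hw,
    arr_comp_add_iff]
  rfl

/-- The vertical translation by one in the duality turns residue `T` into the rows `T - 1` and `T`.
-/
theorem arrowL_iff (he : 2 ≤ e) (hl : 2 ≤ l) {s : ℤ} (T : ℤ) (v w : FockVertex l s) :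
    arrowL e l s (T : ZMod l) v w ↔ RowArr e l (T - 1) (conf e v.1) (conf e w.1) := by
  constructor
  · rintro ⟨v', w', hv, hw, h⟩
    exact (levelRankDual_kashiwaraArrow_iff he hl hv hw T).1 h
  · intro h
    obtain ⟨v', hv⟩ := exists_levelRankDual he v.1
    obtain ⟨w', hw⟩ := exists_levelRankDual he w.1
    exact ⟨v', w', hv, hw, (levelRankDual_kashiwaraArrow_iff he hl hv hw T).2 h⟩

theorem arrowE_iff (he : 2 ≤ e) (hl : 2 ≤ l) {s : ℤ} (U : ℤ) (v w : FockVertex l s) :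
    arrowE e l s (U : ZMod e) v w ↔ Arr e l U (conf e v.1) (conf e w.1) :=
  kashiwaraArrow_iff he hl

theorem KashiwaraArrow.charge {e l : ℕ} {v w : ChargedMultipartition l} {i : ZMod e}
    (h : KashiwaraArrow e i v w) : w.charge = v.charge := h.choose_spec.2.1

end LevelRank


/-! ### Transfer to the set of charged multipartitions -/

theorem Reach.lift {ι ι' X Y : Type*} {A : ι → X → X → Prop} {B : ι' → Y → Y → Prop} {f : X → Y}
    (h : ∀ a v w, A a v w → ∃ b, B b (f v) (f w)) {v w : X} (hr : Reach A v w) :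
    Reach B (f v) (f w) :=
  Relation.ReflTransGen.lift f (fun _ _ ⟨a, ha⟩ => h a _ _ ha) _ _ hr

theorem Reach.mono_left {ι ι' X : Type*} {E : ι → X → X → Prop} {L : ι' → X → X → Prop} {v w : X}
    (hr : Reach E v w) : Reach (both E L) v w := Reach.lift (f := id) (fun a _ _ h => ⟨.inl a, h⟩) hr

theorem Reach.mono_right {ι ι' X : Type*} {E : ι → X → X → Prop} {L : ι' → X → X → Prop} {v w : X}
    (hr : Reach L v w) : Reach (both E L) v w := Reach.lift (f := id) (fun a _ _ h => ⟨.inr a, h⟩) hr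

theorem exists_source {ι X : Type*} {R : ι → X → X → Prop} (size : X → ℕ)
    (h : ∀ a v w, R a w v → size w < size v) (v : X) :
    ∃ r, (∀ a w, ¬ R a w r) ∧ Reach (twoWay R) v r := by
  induction hn : size v using Nat.strong_induction_on generalizing v with
  | _ n ih =>
    by_cases hv : ∃ a w, R a w v
    · obtain ⟨a, w, hw⟩ := hv
      obtain ⟨r, h1, h2⟩ := ih _ (hn ▸ h a v w hw) w rfl
      exact ⟨r, h1, (Relation.ReflTransGen.single ⟨(a, false), hw⟩).trans h2⟩
    · push Not at hv
      exact ⟨v, hv, .refl⟩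

theorem follow_eq_some {α : Type*} {R : α → α → Prop} (hR : ∀ v w w', R v w → R v w' → w = w')
    {v w : α} : follow R v = some w ↔ R v w := by
  unfold follow
  split_ifs with h
  · rw [Option.some_inj]
    exact ⟨fun h' => h' ▸ h.choose_spec, fun h' => hR _ _ _ h.choose_spec h'⟩
  · simp only [reduceCtorEq, false_iff]
    exact fun h' => h ⟨w, h'⟩

theorem KashiwaraArrow.card {n m : ℕ} {i : ZMod m} {v w : ChargedMultipartition n}
    (h : KashiwaraArrow m i w v) : ∑ j, (w.part j).card < ∑ j, (v.part j).card := by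
  obtain ⟨γ, -, -, h2, h3⟩ := h
  have hcard : (v.part γ.1).card = (w.part γ.1).card + 1 := by
    rw [YoungDiagram.card, h2.2, Finset.card_insert_of_notMem (by simpa using h2.1)]
  refine Finset.sum_lt_sum (fun j _ => ?_) ⟨γ.1, Finset.mem_univ _, by omega⟩
  by_cases hj : j = γ.1
  · subst hj; omega
  · rw [h3 j hj]

theorem zmod_cast_val {e : ℕ} [NeZero e] (i : ZMod e) : (((i.val : ℕ) : ℤ) : ZMod e) = i := by
  rw [Int.cast_natCast, ZMod.natCast_zmod_val]

section Fock

variable {e l : ℕ} [NeZero e] [NeZero l] {s : ℤ}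

/-- The configuration of a vertex. -/
noncomputable def vconf (e : ℕ) {l : ℕ} [NeZero l] {s : ℤ} (v : FockVertex l s) :
    {M // IsConf e l M} := ⟨conf e v.1, conf_isConf v.1⟩

variable (e l s) in
/-- The arrows of both Kashiwara crystals, in both directions. -/
def kashiwara : ZMod e × Bool ⊕ ZMod l × Bool → FockVertex l s → FockVertex l s → Prop :=
  both (twoWay (arrowE e l s)) (twoWay (arrowL e l s))

/-- The arrow between configurations that corresponds to an arrow of a Kashiwara crystal. -/
def confLabel (e l : ℕ) : ZMod e × Bool ⊕ ZMod l × Bool → ℤ × Bool ⊕ ℤ × Bool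
  | .inl (i, b) => .inl (i.val, b)
  | .inr (j, b) => .inr (j.val - 1, b)

theorem vconf_injective : Function.Injective (vconf e : FockVertex l s → _) := fun _ _ h =>
  Subtype.ext (conf_injective (congrArg Subtype.val h))

theorem kashiwara_iff (he : 2 ≤ e) (hl : 2 ≤ l) (a : ZMod e × Bool ⊕ ZMod l × Bool)
    (v w : FockVertex l s) :
    kashiwara e l s a v w ↔ confArrow e l (confLabel e l a) (vconf e v) (vconf e w) := by
  obtain ⟨i, b⟩ | ⟨j, b⟩ := a
  · have := fun v w : FockVertex l s => arrowE_iff he hl i.val v w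
    rw [zmod_cast_val] at this
    cases b
    · exact this w v
    · exact this v w
  · have := fun v w : FockVertex l s => arrowL_iff he hl j.val v w
    rw [zmod_cast_val] at this
    cases b
    · exact this w v
    · exact this v w

/-- Column arrows keep the charge and row arrows keep its sum, so arrows between configurations do
not leave `B_s`. -/
theorem exists_vconf (he : 2 ≤ e) (hl : 2 ≤ l) {b : ℤ × Bool ⊕ ℤ × Bool} {v : FockVertex l s}
    {y : {M // IsConf e l M}} (h : confArrow e l b (vconf e v) y) : ∃ w : FockVertex l s, vconf e w = y := by
  obtain ⟨M, hM⟩ := y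
  obtain ⟨w, rfl⟩ := hM.exists_conf hl
  suffices hw : ∑ j, w.charge j = s from ⟨⟨w, hw⟩, rfl⟩
  obtain ⟨U, _ | _⟩ | ⟨T, _ | _⟩ := b
  · have := ((kashiwaraArrow_iff he hl).2 h : KashiwaraArrow e (U : ZMod e) w v.1).charge
    rw [← this]; exact v.2
  · have := ((kashiwaraArrow_iff he hl).2 h : KashiwaraArrow e (U : ZMod e) v.1 w).charge
    rw [this]; exact v.2
  · exact (RowArr.sum_charge hl h).symm.trans v.2
  · exact (RowArr.sum_charge hl h).trans v.2

theorem kashiwara_functional (he : 2 ≤ e) (hl : 2 ≤ l) : IsFunctional (kashiwara e l s) :=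
  fun a v w w' h h' => vconf_injective (confArrow_functional (e := e) (l := l) (by exact_mod_cast he)
    (by exact_mod_cast hl) _ _ _ _ ((kashiwara_iff he hl a v w).1 h) ((kashiwara_iff he hl a v w').1 h'))

theorem kashiwara_isSymm : IsSymm (kashiwara e l s) :=
  both_isSymm (twoWay_isSymm _) (twoWay_isSymm _)

theorem isKashiwaraOperator_iff {op : FockVertex l s → Option (FockVertex l s)} :
    IsKashiwaraOperator e l s op ↔ ∃ a, op = follow (kashiwara e l s a) := by
  constructor
  · rintro (i | i | j | j)
    · exact ⟨.inl (i, true), rfl⟩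
    · exact ⟨.inl (i, false), rfl⟩
    · exact ⟨.inr (j, true), rfl⟩
    · exact ⟨.inr (j, false), rfl⟩
  · rintro ⟨⟨i, _ | _⟩ | ⟨j, _ | _⟩, rfl⟩
    · exact .raiseE i
    · exact .lowerE i
    · exact .raiseL j
    · exact .lowerL j

theorem isDoublyHighest_iff (he : 2 ≤ e) (hl : 2 ≤ l) (v : FockVertex l s) :
    IsDoublyHighest e l s v ↔ IsDoublyHighestConf e l (conf e v.1) := by
  constructor
  · rintro ⟨h1, h2⟩
    refine ⟨fun U K hK h => ?_, fun T K hK h => ?_⟩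
    · obtain ⟨w, hw⟩ := exists_vconf he hl (v := v) (y := ⟨K, hK⟩) (b := .inl (U, false)) h
      obtain rfl : conf e w.1 = K := congrArg Subtype.val hw
      exact h1 _ w ((arrowE_iff he hl U w v).2 h)
    · have h' : RowArr e l T (dual K) (conf e v.1) := by rwa [RowArr, dual_dual]
      obtain ⟨w, hw⟩ := exists_vconf he hl (v := v) (y := ⟨dual K, hK.dual⟩) (b := .inr (T, false)) h'
      have hw' : conf e w.1 = dual K := congrArg Subtype.val hw
      exact h2 _ w ((arrowL_iff he hl (T + 1) w v).2 (by rwa [hw', add_sub_cancel_right]))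
  · rintro ⟨h1, h2⟩
    refine ⟨fun i w h => ?_, fun j w h => ?_⟩
    · rw [← zmod_cast_val i, arrowE_iff he hl] at h
      exact h1 _ _ (conf_isConf w.1) h
    · rw [← zmod_cast_val j, arrowL_iff he hl] at h
      exact h2 _ _ (conf_isConf w.1).dual h

theorem IsStair.adjoint_le_iff {F : ℤ → ℤ} (hF : IsStair e l F) (q u T : ℤ) :
    F (u - e * q) ≤ T - l * q ↔ F u ≤ T := by
  have := hF.period_mul u (-q)
  rw [show u - e * q = u + -q * e by ring, this]
  constructor <;> intro h <;> linarith

/-- Both sides express the charge of row `j`, computed once from the staircase and once from the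
multipartition. Hence the charge and `F` determine each other. -/
theorem isVertex_adjoint (he : 2 ≤ e) (hl : 2 ≤ l) {F : ℤ → ℤ} {κ : ℕ → ℕ}
    {v : ChargedMultipartition l} (h : IsVertex e l F κ (conf e v)) (j : Fin l) (u : ℤ) :
    F u ≤ j ↔ u ≤ v.charge j := by
  have he' : (2 : ℤ) ≤ e := by exact_mod_cast he
  have hl' : (2 : ℤ) ≤ l := by exact_mod_cast hl
  obtain ⟨f, hf⟩ := h.1.exists_adjoint he' hl' j
  have := (vertex_hasCharge_dual he' hl' h.1 h.2.1 (conf_isConf v) h.2.2 hf).unique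
    (conf_hasCharge hl v j)
  rw [← hf]
  omega

theorem isVertex_adjoint' (he : 2 ≤ e) (hl : 2 ≤ l) {F : ℤ → ℤ} {κ : ℕ → ℕ}
    {v : ChargedMultipartition l} (h : IsVertex e l F κ (conf e v)) (u T : ℤ) :
    F u ≤ T ↔ u - e * (T / l) ≤ v.charge (rowOf l T) := by
  rw [← isVertex_adjoint he hl h, ← h.1.adjoint_le_iff (T / l), rowOf_val]
  have := Int.emod_add_mul_ediv T l
  rw [show T - l * (T / l) = T % l by linarith]

theorem isVertex_charge (he : 2 ≤ e) (hl : 2 ≤ l) {F F' : ℤ → ℤ} {κ κ' : ℕ → ℕ}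
    {v w : ChargedMultipartition l} (h : IsVertex e l F κ (conf e v))
    (h' : IsVertex e l F' κ' (conf e w)) : F = F' ↔ v.charge = w.charge := by
  constructor
  · rintro rfl
    funext j
    have h1 := fun u => (isVertex_adjoint he hl h j u).symm.trans (isVertex_adjoint he hl h' j u)
    exact le_antisymm ((h1 _).1 le_rfl) ((h1 _).2 le_rfl)
  · intro hc
    funext u
    have h1 := fun T => (isVertex_adjoint' he hl h u T).trans
      ((isVertex_adjoint' he hl h' u T).trans (by rw [hc])).symm
    exact le_antisymm ((h1 _).2 le_rfl) ((h1 _).1 le_rfl)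

theorem IsDoublyHighest.isVertex (he : 2 ≤ e) (hl : 2 ≤ l) {v : FockVertex l s}
    (h : IsDoublyHighest e l s v) : ∃ F κ, IsVertex e l F κ (conf e v.1) :=
  ((isDoublyHighest_iff he hl v).1 h).exists_vertex (by exact_mod_cast he) (by exact_mod_cast hl)
    (conf_isConf v.1)

theorem IsDoublyHighest.twin (he : 2 ≤ e) (hl : 2 ≤ l) {v w : FockVertex l s}
    (hv : IsDoublyHighest e l s v) (hw : IsDoublyHighest e l s w) (hc : v.1.charge = w.1.charge) :
    Twin (kashiwara e l s) v w := by
  obtain ⟨F, κ, h1⟩ := hv.isVertex he hl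
  obtain ⟨F', κ', h2⟩ := hw.isVertex he hl
  obtain rfl := (isVertex_charge he hl h1 h2).2 hc
  have := IsVertex.twin (e := e) (l := l) (by exact_mod_cast he) (by exact_mod_cast hl)
    (M := vconf e v) (M' := vconf e w) h1 h2
  exact ⟨Emb.of_injective (kashiwara_functional he hl) (kashiwara_iff he hl) vconf_injective
      (fun a v y h => exists_vconf he hl h) this.1,
    Emb.of_injective (kashiwara_functional he hl) (kashiwara_iff he hl) vconf_injective
      (fun a v y h => exists_vconf he hl h) this.2⟩

theorem IsDoublyHighest.eq_of_reach (he : 2 ≤ e) (hl : 2 ≤ l) {v w : FockVertex l s}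
    (hv : IsDoublyHighest e l s v) (hw : IsDoublyHighest e l s w)
    (h : Reach (kashiwara e l s) v w) : v = w :=
  vconf_injective (eq_of_reach_confArrow (e := e) (l := l) (by exact_mod_cast he)
    (by exact_mod_cast hl) ((isDoublyHighest_iff he hl v).1 hv) ((isDoublyHighest_iff he hl w).1 hw)
    (h.lift fun a v w hvw => ⟨_, (kashiwara_iff he hl a v w).1 hvw⟩))

/-- Going up the first crystal removes boxes from the multipartition, and going up the second
removes boxes from its level-rank dual, so both processes stop. The second one preserves the sources
of the first crystal. -/
theorem exists_root (he : 2 ≤ e) (hl : 2 ≤ l) (v : FockVertex l s) :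
    ∃ r, IsDoublyHighest e l s r ∧ Reach (kashiwara e l s) v r := by
  obtain ⟨w, h1, h2⟩ := exists_source (R := arrowE e l s) (fun v => ∑ j, (v.1.part j).card)
    (fun a v w h => KashiwaraArrow.card h) v
  choose d hd using fun v : FockVertex l s => exists_levelRankDual he v.1
  obtain ⟨r, h3, h4⟩ := exists_source (R := arrowL e l s) (fun v => ∑ j, ((d v).part j).card)
    (fun a v w h => by
      obtain ⟨w', v', h5, h6, h7⟩ := h
      obtain rfl : w' = d w := abacus_injective (h5.trans (hd w).symm)
      obtain rfl : v' = d v := abacus_injective (h6.trans (hd v).symm)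
      exact h7.card) w
  refine ⟨r, ?_, h2.mono_left.trans h4.mono_right⟩
  have hw : IsHighest e l (conf e w.1) := fun U K hK h => by
    obtain ⟨w', hw⟩ := exists_vconf he hl (v := w) (y := ⟨K, hK⟩) (b := .inl (U, false)) h
    obtain rfl : conf e w'.1 = K := congrArg Subtype.val hw
    exact h1 _ w' ((arrowE_iff he hl U w' w).2 h)
  have hr : IsHighest e l (conf e r.1) :=
    IsHighest.reach (by exact_mod_cast he) (by exact_mod_cast hl) (M := vconf e w) (M' := vconf e r) hw
      (h4.lift fun a v w hvw => ⟨((a.1.val : ℤ) - 1, a.2),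
        (kashiwara_iff he hl (.inr a) v w).1 hvw⟩)
  refine ⟨fun i x h => ?_, h3⟩
  rw [← zmod_cast_val i, arrowE_iff he hl] at h
  exact hr _ _ (conf_isConf x.1) h

end Fock


/-! ### Periods are the layers of a doubly highest weight vertex -/

section Periods

variable {e l : ℕ} [NeZero e]

theorem IsFirstPeriod.unique {S : Set (Fin l × ℤ)} {P Q : Period e l} (hP : IsFirstPeriod S P)
    (hQ : IsFirstPeriod S Q) : P = Q := by
  obtain ⟨p1, p2, p3, p4⟩ := hP
  obtain ⟨q1, q2, q3, q4⟩ := hQ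
  have h1 : P.start = Q.start := by
    have a1 := q2 _ (p1 0)
    have a2 := p2 _ (q1 0)
    simp only [Period.pos, Fin.val_zero, Nat.cast_zero, sub_zero, add_zero] at a1 a2
    exact le_antisymm a1 a2
  have h2 : ∀ i, P.row i = Q.row i := by
    intro i
    induction hi : (i : ℕ) using Nat.strong_induction_on generalizing i with
    | _ n ih =>
      have hlt : ∀ i' < i, P.row i' = Q.row i' := fun i' h => ih i' (by subst hi; exact h) i' rfl
      have a1 := p1 i
      have a2 := q1 i
      rw [Period.pos, add_zero] at a1 a2
      refine le_antisymm (p4 i _ (h1 ▸ a2) fun i' h => ?_) (q4 i _ (h1 ▸ a1) fun i' h => ?_)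
      · rw [hlt i' h]; exact q3 h.le
      · rw [← hlt i' h]; exact p3 h.le
  cases P; cases Q
  simp only [Period.mk.injEq]
  exact ⟨h1, funext h2⟩

theorem IsPeriodSequence.unique {S : Set (Fin l × ℤ)} {P Q : ℕ → Period e l}
    (hP : IsPeriodSequence S P) (hQ : IsPeriodSequence S Q) : P = Q := by
  funext k
  induction k using Nat.strong_induction_on with
  | _ k ih =>
    have h : {x | ∃ k' < k, ∃ i, x = (P k').pos 0 i} = {x | ∃ k' < k, ∃ i, x = (Q k').pos 0 i} :=
      Set.ext fun x => exists_congr fun k' => and_congr_right fun hk => by rw [ih k' hk]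
    exact (hP k).unique (h ▸ hQ k)

/-- `P` is the `k`-th layer of the abacus of the doubly highest weight vertex with charges `F` and
parameter `κ`. -/
def IsLayer (F : ℤ → ℤ) (κ : ℕ → ℕ) (k : ℕ) (P : Period e l) : Prop :=
  (∀ u, vertexEnum F κ k u < l ↔ u ≤ P.start) ∧
    ∀ i : Fin e, ((P.row i : ℕ) : ℤ) = vertexEnum F κ k (P.start - (i : ℕ))

/-- The period of layer `k` is its part in the rows `0, …, l - 1`. It starts in the last column
where the layer is below row `l`; since `e` columns raise the layer by `l`, the `e` columns ending
there all fit. -/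
theorem exists_isLayer [NeZero l] (he : 2 ≤ e) (hl : 2 ≤ l) {F : ℤ → ℤ} (hF : IsStair e l F)
    (κ : ℕ → ℕ) (k : ℕ) : ∃ P : Period e l, IsLayer F κ k P := by
  obtain ⟨f, hf⟩ := hF.exists_adjoint (by exact_mod_cast he) (by exact_mod_cast hl) (l - 1 - k)
  have h1 : ∀ u, vertexEnum F κ k u < l ↔ u ≤ f - 1 + κ k := fun u => by
    have := hf (u - κ k)
    rw [vertexEnum]
    omega
  refine ⟨⟨f - 1 + κ k, fun i => rowOf l (vertexEnum F κ k (f - 1 + κ k - (i : ℕ)))⟩, h1, fun i => ?_⟩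
  rw [rowOf_val]
  refine Int.emod_eq_of_lt ?_ ((h1 _).2 (by omega))
  have h2 := (h1 (f - 1 + κ k + 1)).not.2 (by omega)
  have h3 := hF.period (f - 1 + 1 - e)
  rw [sub_add_cancel] at h3
  have h4 := hF.mono (show f - 1 + 1 - e ≤ f - 1 + κ k - (i : ℕ) - κ k by have := i.2; omega)
  rw [vertexEnum] at h2 ⊢
  rw [show f - 1 + κ k + 1 - κ k = f - 1 + 1 by ring] at h2
  omega

theorem IsLayer.mem_iff {F : ℤ → ℤ} {κ : ℕ → ℕ} {k : ℕ} {P : Period e l} (hF : IsStair e l F)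
    (h : IsLayer F κ k P) {j : Fin l} {x t : ℤ} :
    (∃ i, (j, x) = P.pos t i) ↔ vertexEnum F κ k (x - t) = (j : ℕ) := by
  constructor
  · rintro ⟨i, hi⟩
    rw [Period.pos, Prod.mk.injEq] at hi
    obtain ⟨rfl, rfl⟩ := hi
    rw [h.2 i, add_sub_cancel_right]
  · intro hx
    have h1 := (h.1 (x - t)).1 (by rw [hx]; exact_mod_cast j.2)
    have h2 := (h.1 (x - t + e)).not.1 (by
      have := hF.period (x - t - κ k)
      rw [vertexEnum] at hx ⊢
      rw [show x - t + e - κ k = x - t - κ k + e by ring, this]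
      omega)
    refine ⟨⟨(P.start - (x - t)).toNat, by omega⟩, ?_⟩
    have h3 : ((P.start - (x - t)).toNat : ℤ) = P.start - (x - t) := Int.toNat_of_nonneg (by omega)
    have h4 := h.2 ⟨(P.start - (x - t)).toNat, by omega⟩
    simp only [h3, sub_sub_cancel, hx] at h4
    rw [Period.pos, Prod.mk.injEq]
    refine ⟨Fin.ext (by exact_mod_cast h4.symm), ?_⟩
    simp only [h3]
    ring

variable [NeZero l] {F : ℤ → ℤ} {κ : ℕ → ℕ} {v w : ChargedMultipartition l}

theorem IsVertex.mem_abacus (h : IsVertex e l F κ (conf e v)) {j : Fin l} {x : ℤ} :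
    (j, x) ∈ abacus v ↔ ∃ k, vertexEnum F κ k x = (j : ℕ) := by
  rw [← conf_eq_one_coe (e := e), h.2.2.mem]

theorem isVertex_of_mem_abacus (hF : IsStair e l F) (hκ : IsPartSeq κ)
    (h : ∀ (j : Fin l) (x : ℤ), (j, x) ∈ abacus v ↔ ∃ k, vertexEnum F κ k x = (j : ℕ)) :
    IsVertex e l F κ (conf e v) := by
  refine ⟨hF, hκ, fun u => vertexEnum_strictMono hF hκ u, fun u t => ?_⟩
  rw [conf_eq_one, h, rowOf_val]
  refine exists_congr fun k => ?_
  have h1 := Int.emod_add_mul_ediv t l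
  have h2 := hF.period_mul (u - κ k) (-(t / l))
  rw [vertexEnum, vertexEnum, show u - e * (t / l) - κ k = u - κ k + -(t / l) * e by ring, h2]
  constructor <;> intro h <;> linarith

/-- A layer of smaller index is strictly lower in every column. So among the remaining beads layer
`k` reaches furthest to the right and has the smallest row in each of its columns, as the choice of
the first period demands. -/
theorem isPeriodSequence_of_isLayer (h : IsVertex e l F κ (conf e v)) {P : ℕ → Period e l}
    (hP : ∀ k, IsLayer F κ k (P k)) : IsPeriodSequence (abacus v) P := by
  intro k
  have hmem : ∀ (j : Fin l) (x : ℤ), (j, x) ∈ abacus v \ {x | ∃ k' < k, ∃ i, x = (P k').pos 0 i} →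
      ∃ k', k ≤ k' ∧ vertexEnum F κ k' x = (j : ℕ) := by
    rintro j x ⟨h1, h2⟩
    obtain ⟨k', hk'⟩ := h.mem_abacus.1 h1
    refine ⟨k', ?_, hk'⟩
    by_contra hlt
    exact h2 ⟨k', by omega, ((hP k').mem_iff h.1).2 (by rwa [sub_zero])⟩
  have hmono := fun x => (vertexEnum_strictMono h.1 h.2.1 x).monotone
  refine ⟨fun i => ?_, ?_, fun i i' hi => ?_, fun i j hj _ => ?_⟩
  · have h1 := ((hP k).mem_iff h.1 (t := 0)).1 ⟨i, rfl⟩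
    rw [sub_zero] at h1
    refine ⟨h.mem_abacus.2 ⟨k, h1⟩, ?_⟩
    rintro ⟨k', hk', i', hi'⟩
    have h2 := ((hP k').mem_iff h.1 (t := 0)).1 ⟨i', hi'⟩
    rw [sub_zero] at h2
    have := (vertexEnum_strictMono h.1 h.2.1 ((P k).pos 0 i).2).injective (h1.trans h2.symm)
    omega
  · rintro ⟨j, x⟩ hx
    obtain ⟨k', h1, h2⟩ := hmem j x hx
    refine ((hP k).1 x).1 (lt_of_le_of_lt (hmono x h1) ?_)
    simp only [h2]
    exact_mod_cast j.2
  · have h1 := (hP k).2 i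
    have h2 := (hP k).2 i'
    have h3 : ((i : ℕ) : ℤ) ≤ (i' : ℕ) := by exact_mod_cast hi
    have h4 := vertexEnum_mono (κ := κ) h.1 k (show (P k).start - (i' : ℕ) ≤ (P k).start - (i : ℕ) by omega)
    rw [← h1, ← h2] at h4
    exact_mod_cast h4
  · obtain ⟨k', h1, h2⟩ := hmem j _ hj
    have h3 := hmono ((P k).start - (i : ℕ)) h1
    simp only [h2, ← (hP k).2 i] at h3
    exact_mod_cast h3

theorem exists_layers (he : 2 ≤ e) (hl : 2 ≤ l) (h : IsVertex e l F κ (conf e v)) :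
    ∃ P : ℕ → Period e l, (∀ k, IsLayer F κ k (P k)) ∧
      ∀ Q, IsPeriodSequence (abacus v) Q ↔ Q = P := by
  choose P hP using exists_isLayer he hl h.1 κ
  have := isPeriodSequence_of_isLayer h hP
  exact ⟨P, hP, fun Q => ⟨fun hQ => hQ.unique this, fun hQ => hQ ▸ this⟩⟩

theorem IsPartSeq.add {κ σ : ℕ → ℕ} (hκ : IsPartSeq κ) (hσ : IsPartSeq σ) :
    IsPartSeq fun k => κ k + σ k := by
  obtain ⟨K, hK⟩ := hκ.finite
  obtain ⟨K', hK'⟩ := hσ.finite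
  exact ⟨fun i j h => add_le_add (hκ.anti h) (hσ.anti h), max K K', fun k hk => by
    rw [hK k (le_trans (le_max_left _ _) hk), hK' k (le_trans (le_max_right _ _) hk)]⟩

theorem isRightShift_iff {s : ℤ} (he : 2 ≤ e) (hl : 2 ≤ l) {v w : FockVertex l s}
    (h : IsVertex e l F κ (conf e v.1)) (σ : YoungDiagram) :
    IsRightShift e l s σ v w ↔ IsVertex e l F (fun k => κ k + σ.rowLen k) (conf e w.1) := by
  obtain ⟨P, hP, hPu⟩ := exists_layers he hl h
  have key : ∀ (j : Fin l) (x : ℤ), (j, x) ∈ {x | ∃ k i, x = (P k).pos (σ.rowLen k) i} ↔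
      ∃ k, vertexEnum F (fun k => κ k + σ.rowLen k) k x = (j : ℕ) := by
    intro j x
    refine exists_congr fun k => ((hP k).mem_iff h.1).trans ?_
    rw [vertexEnum, vertexEnum, Nat.cast_add, sub_sub, add_comm (κ k : ℤ)]
  constructor
  · rintro ⟨Q, hQ, hw⟩
    obtain rfl := (hPu Q).1 hQ
    exact isVertex_of_mem_abacus h.1 (h.2.1.add (rowLen_isPartSeq σ)) fun j x => by rw [hw, key]
  · intro hw
    refine ⟨P, (hPu P).2 rfl, Set.ext ?_⟩
    rintro ⟨j, x⟩
    rw [key, hw.mem_abacus]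

/-- The charge fixes the staircase, so a possible left shift only changes the partition; comparing
the starting columns of the periods shows that it subtracts `σ`. -/
theorem isLeftShift_iff {s : ℤ} (he : 2 ≤ e) (hl : 2 ≤ l) {v w : FockVertex l s}
    (h : IsVertex e l F κ (conf e v.1)) (σ : YoungDiagram) :
    w.1.charge = v.1.charge ∧ IsLeftShift e l s σ v w ↔
      ∃ ρ : ℕ → ℕ, (∀ k, ρ k + σ.rowLen k = κ k) ∧ IsVertex e l F ρ (conf e w.1) := by
  obtain ⟨P, hP, hPu⟩ := exists_layers he hl h
  constructor
  · rintro ⟨hc, hw, P', Q, hP', hQ, hPQ⟩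
    obtain rfl := (hPu P').1 hP'
    obtain ⟨F', ρ, h'⟩ := hw.isVertex he hl
    obtain rfl := (isVertex_charge he hl h h').2 hc.symm
    obtain ⟨Q', hQ', hQu⟩ := exists_layers he hl h'
    obtain rfl := (hQu Q).1 hQ
    refine ⟨ρ, fun k => ?_, h'⟩
    have h1 := congrArg Prod.snd (hPQ k 0)
    simp only [Period.pos, Fin.val_zero, Nat.cast_zero, sub_zero, add_zero] at h1
    have h2 : ∀ u, u ≤ (P' k).start - κ k ↔ u ≤ (Q k).start - ρ k := fun u => by
      have a1 := (hP k).1 (u + κ k)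
      have a2 := (hQ' k).1 (u + ρ k)
      rw [vertexEnum, add_sub_cancel_right] at a1 a2
      omega
    have h3 := (h2 _).1 le_rfl
    have h4 := (h2 _).2 le_rfl
    omega
  · rintro ⟨ρ, hρ, h'⟩
    have hκ : (fun k => ρ k + σ.rowLen k) = κ := funext hρ
    obtain ⟨Q, hQ, hQu⟩ := exists_layers he hl h'
    refine ⟨((isVertex_charge he hl h h').1 rfl).symm, (isDoublyHighest_iff he hl w).2
      (vertex_isDoublyHighest (by exact_mod_cast he) (by exact_mod_cast hl) h'.1 h'.2.1
        (conf_isConf w.1) h'.2.2), P, Q, (hPu P).2 rfl, (hQu Q).2 rfl, fun k i => ?_⟩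
    have hs : (P k).start = (Q k).start + σ.rowLen k := by
      have h2 : ∀ u, u ≤ (P k).start - κ k ↔ u ≤ (Q k).start - ρ k := fun u => by
        have a1 := (hP k).1 (u + κ k)
        have a2 := (hQ k).1 (u + ρ k)
        rw [vertexEnum, add_sub_cancel_right] at a1 a2
        omega
      have h3 := (h2 _).1 le_rfl
      have h4 := (h2 _).2 le_rfl
      have := hρ k
      omega
    rw [Period.pos, Period.pos, Prod.mk.injEq]
    refine ⟨Fin.ext ?_, by omega⟩
    have a1 := (hP k).2 i
    have a2 := (hQ k).2 i
    rw [vertexEnum] at a1 a2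
    rw [← hρ k, hs] at a1
    have : ((P k).row i : ℤ) = (Q k).row i := by
      rw [a1, a2]; congr 2; push_cast; ring
    exact_mod_cast this.symm

/-- In the vacuum the `a`-th bead of row `j` lies in column `v.charge j - a`, hence in the layer `k`
with `F (v.charge j - a) + k = j`. This layer is displaced by `κ k`, which is the part encoded by
the bead. -/
theorem IsVertex.rowLen_part (he : 2 ≤ e) (hl : 2 ≤ l) (h : IsVertex e l F κ (conf e v)) {j : Fin l}
    {a k : ℕ} (hk : F (v.charge j - a) + k = (j : ℕ)) : (v.part j).rowLen a = κ k := by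
  have hadj := isVertex_adjoint he hl h j
  have hnn : ∀ a : ℕ, F (v.charge j - a) ≤ (j : ℕ) := fun a => (hadj _).2 (by omega)
  have hmono : Monotone fun a : ℕ => ((j : ℕ) - F (v.charge j - a)).toNat := fun a b hab =>
    Int.toNat_le_toNat (by
      have := h.1.mono (show v.charge j - b ≤ v.charge j - a by omega)
      omega)
  obtain ⟨K, hK⟩ := h.2.1.finite
  obtain ⟨μ, hμ⟩ := IsPartSeq.exists_young
    (κ := fun a : ℕ => κ ((j : ℕ) - F (v.charge j - a)).toNat)
    -- Going back `K * e` columns lowers the staircase by `K * l ≥ K`, so all further beads belong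
    -- to unshifted layers.
    ⟨h.2.1.anti.comp_monotone hmono, K * e, fun a ha => hK _ (by
      have h1 := h.1.period_mul (v.charge j) (-K)
      have h2 := h.1.mono (show v.charge j - a ≤ v.charge j + -K * e by
        have : ((K * e : ℕ) : ℤ) ≤ a := by exact_mod_cast ha
        push_cast at this
        linarith)
      have h3 := hnn 0
      rw [Nat.cast_zero, sub_zero] at h3
      have h4 : (K : ℤ) * 1 ≤ K * l := mul_le_mul_of_nonneg_left (by omega) (by omega)
      have h5 : -(K : ℤ) * l = -(K * l) := by ring
      omega)⟩
  have hm : ∀ a : ℕ, F (v.charge j - a) + ((j : ℕ) - F (v.charge j - a)).toNat = (j : ℕ) := fun a => by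
    rw [Int.toNat_of_nonneg (sub_nonneg.2 (hnn a))]; ring
  have hpart : v.part j = μ := by
    refine (bead_injective (s := v.charge j) (s' := v.charge j) (Set.ext fun x => ?_)).1
    rw [← mem_abacus_iff, h.mem_abacus]
    constructor
    · rintro ⟨k', hk'⟩
      rw [vertexEnum] at hk'
      have h1 := (hadj (x - κ k')).1 (by omega)
      have h2 : ((v.charge j - (x - κ k')).toNat : ℤ) = v.charge j - (x - κ k') :=
        Int.toNat_of_nonneg (by omega)
      refine ⟨(v.charge j - (x - κ k')).toNat, ?_⟩
      rw [bead, hμ, h2, sub_sub_cancel, show ((j : ℕ) - F (x - κ k')).toNat = k' by omega]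
      ring
    · rintro ⟨a, rfl⟩
      refine ⟨((j : ℕ) - F (v.charge j - a)).toNat, ?_⟩
      rw [vertexEnum, bead, hμ]
      convert hm a using 3
      ring
  rw [hpart, hμ]
  congr 1
  omega

theorem isKappa_doublyHighest_iff {s : ℤ} (he : 2 ≤ e) (hl : 2 ≤ l) {v : FockVertex l s}
    (h : IsVertex e l F κ (conf e v.1)) (μ : YoungDiagram) :
    (∃ P : ℕ → Period e l, IsPeriodSequence (abacus v.1) P ∧
      ∀ k i, ∃ a : ℕ, (v.1.part ((P k).row i)).rowLen a = μ.rowLen k ∧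
        (P k).start - (i : ℤ) = (μ.rowLen k : ℤ) + v.1.charge ((P k).row i) - (a : ℤ)) ↔
      ∀ k, μ.rowLen k = κ k := by
  obtain ⟨P, hP, hPu⟩ := exists_layers he hl h
  have key : ∀ k (i : Fin e), ∃ a : ℕ, (v.1.part ((P k).row i)).rowLen a = κ k ∧
      (P k).start - ((i : ℕ) : ℤ) = (κ k : ℤ) + v.1.charge ((P k).row i) - (a : ℤ) := by
    intro k i
    have h1 := (hP k).2 i
    rw [vertexEnum] at h1
    have h2 := (isVertex_adjoint he hl h ((P k).row i) ((P k).start - (i : ℕ) - κ k)).1 (by omega)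
    have h3 : ((v.1.charge ((P k).row i) - ((P k).start - (i : ℕ) - κ k)).toNat : ℤ) =
      v.1.charge ((P k).row i) - ((P k).start - (i : ℕ) - κ k) := Int.toNat_of_nonneg (by omega)
    exact ⟨_, h.rowLen_part he hl (by rw [h3, sub_sub_cancel]; exact h1.symm), by rw [h3]; ring⟩
  constructor
  · rintro ⟨Q, hQ, hμ⟩ k
    obtain rfl := (hPu Q).1 hQ
    obtain ⟨a, h1, h2⟩ := hμ k 0
    obtain ⟨a', h3, h4⟩ := key k 0
    obtain rfl : a = a' := (bead_strictAnti (v.1.part ((Q k).row 0)) (v.1.charge ((Q k).row 0))).injective (by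
      rw [bead, bead, h1, h3, ← h2, ← h4])
    rw [← h1, h3]
  · intro hμ
    refine ⟨P, (hPu P).2 rfl, fun k i => ?_⟩
    rw [hμ]
    exact key k i

end Periods


theorem PairReach.split {ι X : Type*} {A : ι → X → X → Prop} {x y z : X} (h : Emb A x y)
    {v w : X} (hr : PairReach A (x, z) (v, w)) :
    ∃ u, PairReach A (x, y) (v, u) ∧ PairReach A (y, z) (u, w) := by
  suffices key : ∀ q, PairReach A (x, z) q →
      ∃ u, PairReach A (x, y) (q.1, u) ∧ PairReach A (y, z) (u, q.2) from key _ hr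
  intro q hq
  induction hq with
  | refl => exact ⟨y, .refl, .refl⟩
  | tail _ hs ih =>
    obtain ⟨u, h1, h2⟩ := ih
    obtain ⟨a, h3, h4⟩ := hs
    obtain ⟨u', hu⟩ := h.2 _ _ h1 a _ h3
    exact ⟨u', h1.tail ⟨a, h3, hu⟩, h2.tail ⟨a, hu, h4⟩⟩

/-! ### Roots, parameters and similar vertices -/

section Fock

variable {e l : ℕ} [NeZero e] [NeZero l] {s : ℤ}

/-- The doubly highest weight vertex from which `v` can be reached. -/
noncomputable def root (e : ℕ) {l : ℕ} [NeZero e] [NeZero l] {s : ℤ} (v : FockVertex l s) :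
    FockVertex l s :=
  @Classical.epsilon _ ⟨v⟩ fun r => IsDoublyHighest e l s r ∧ Reach (kashiwara e l s) v r

theorem root_spec (he : 2 ≤ e) (hl : 2 ≤ l) (v : FockVertex l s) :
    IsDoublyHighest e l s (root e v) ∧ Reach (kashiwara e l s) v (root e v) :=
  Classical.epsilon_spec (exists_root he hl v)

theorem root_reach (he : 2 ≤ e) (hl : 2 ≤ l) (v : FockVertex l s) :
    Reach (kashiwara e l s) (root e v) v := (root_spec he hl v).2.symm kashiwara_isSymm

theorem root_eq (he : 2 ≤ e) (hl : 2 ≤ l) {v r : FockVertex l s} (hr : IsDoublyHighest e l s r)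
    (h : Reach (kashiwara e l s) v r) : root e v = r :=
  (root_spec he hl v).1.eq_of_reach he hl hr ((root_reach he hl v).trans h)

theorem root_congr (he : 2 ≤ e) (hl : 2 ≤ l) {v w : FockVertex l s}
    {a : ZMod e × Bool ⊕ ZMod l × Bool} (h : kashiwara e l s a v w) : root e v = root e w :=
  root_eq he hl (root_spec he hl w).1 ((Relation.ReflTransGen.single ⟨a, h⟩).trans (root_spec he hl w).2)

theorem IsVertex.isDoublyHighest (he : 2 ≤ e) (hl : 2 ≤ l) {F : ℤ → ℤ} {κ : ℕ → ℕ}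
    {v : FockVertex l s} (h : IsVertex e l F κ (conf e v.1)) : IsDoublyHighest e l s v :=
  (isDoublyHighest_iff he hl v).2 (vertex_isDoublyHighest (by exact_mod_cast he)
    (by exact_mod_cast hl) h.1 h.2.1 (conf_isConf v.1) h.2.2)

theorem IsVertex.eq {F : ℤ → ℤ} {κ : ℕ → ℕ} {v w : FockVertex l s}
    (h : IsVertex e l F κ (conf e v.1)) (h' : IsVertex e l F κ (conf e w.1)) : v = w :=
  Subtype.ext (conf_injective (IsEnum.bits_unique (conf_isBits v.1) (conf_isBits w.1) h.2.2 h'.2.2))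

theorem IsVertex.exists_fockVertex (he : 2 ≤ e) (hl : 2 ≤ l) {F : ℤ → ℤ} {κ κ' : ℕ → ℕ}
    {v : FockVertex l s} (h : IsVertex e l F κ (conf e v.1)) (hκ' : IsPartSeq κ') :
    ∃ w : FockVertex l s, IsVertex e l F κ' (conf e w.1) := by
  obtain ⟨M, hM, hE⟩ := exists_vertex (by exact_mod_cast he) h.1 hκ'
  obtain ⟨w, rfl⟩ := hM.exists_conf hl
  have h' : IsVertex e l F κ' (conf e w) := ⟨h.1, hκ', hE⟩
  exact ⟨⟨w, by rw [← (isVertex_charge he hl h h').1 rfl]; exact v.2⟩, h'⟩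

theorem exists_parameter (he : 2 ≤ e) (hl : 2 ≤ l) (v : FockVertex l s) :
    ∃ μ : YoungDiagram, ∃ F, IsVertex e l F μ.rowLen (conf e (root e v).1) := by
  obtain ⟨F, κ, h⟩ := (root_spec he hl v).1.isVertex he hl
  obtain ⟨μ, hμ⟩ := h.2.1.exists_young
  exact ⟨μ, F, by rwa [show μ.rowLen = κ from funext hμ]⟩

/-- The partition that the periods of the root of `v` encode. -/
noncomputable def parameter (e : ℕ) {l : ℕ} [NeZero e] [NeZero l] {s : ℤ} (v : FockVertex l s) :
    YoungDiagram :=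
  Classical.epsilon fun μ => ∃ F, IsVertex e l F μ.rowLen (conf e (root e v).1)

theorem parameter_spec (he : 2 ≤ e) (hl : 2 ≤ l) (v : FockVertex l s) :
    ∃ F, IsVertex e l F (parameter e v).rowLen (conf e (root e v).1) :=
  Classical.epsilon_spec (exists_parameter he hl v)

theorem IsVertex.parameter_unique (he : 2 ≤ e) (hl : 2 ≤ l) {F F' : ℤ → ℤ} {μ ν : YoungDiagram}
    {v : FockVertex l s} (h : IsVertex e l F μ.rowLen (conf e v.1))
    (h' : IsVertex e l F' ν.rowLen (conf e v.1)) : μ = ν :=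
  rowLen_injective ((isKappa_doublyHighest_iff he hl h' μ).1
    ((isKappa_doublyHighest_iff he hl h μ).2 fun _ => rfl))

theorem parameter_eq (he : 2 ≤ e) (hl : 2 ≤ l) {F : ℤ → ℤ} {μ : YoungDiagram} {v : FockVertex l s}
    (h : IsVertex e l F μ.rowLen (conf e (root e v).1)) : parameter e v = μ := by
  obtain ⟨F', h'⟩ := parameter_spec he hl v
  exact h'.parameter_unique he hl h

theorem parameter_congr {v w : FockVertex l s} (h : root e v = root e w) :
    parameter e v = parameter e w := by
  rw [parameter, parameter, h]

theorem IsDoublyHighest.root_eq (he : 2 ≤ e) (hl : 2 ≤ l) {v : FockVertex l s}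
    (h : IsDoublyHighest e l s v) : root e v = v := HeisenbergCrystal.root_eq he hl h .refl

/-- `v` and `w` differ only in the parameter: they are in the same position relative to their
roots, and the roots have the same charge. -/
def Similar (e : ℕ) {l : ℕ} [NeZero e] [NeZero l] {s : ℤ} (v w : FockVertex l s) : Prop :=
  (root e v).1.charge = (root e w).1.charge ∧
    PairReach (kashiwara e l s) (root e v, root e w) (v, w)

theorem root_twin (he : 2 ≤ e) (hl : 2 ≤ l) {v w : FockVertex l s}
    (h : (root e v).1.charge = (root e w).1.charge) :
    Twin (kashiwara e l s) (root e v) (root e w) :=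
  (root_spec he hl v).1.twin he hl (root_spec he hl w).1 h

theorem Similar.refl (he : 2 ≤ e) (hl : 2 ≤ l) (v : FockVertex l s) : Similar e v v :=
  ⟨rfl, PairReach.diag (root_reach he hl v)⟩

theorem Similar.symm {v w : FockVertex l s} (h : Similar e v w) : Similar e w v :=
  ⟨h.1.symm, h.2.swap⟩

/-- The isomorphism from the component of `u` to that of `w` factors through the component of `v`;
functionality identifies the images. -/
theorem Similar.trans (he : 2 ≤ e) (hl : 2 ≤ l) {u v w : FockVertex l s} (h : Similar e u v)
    (h' : Similar e v w) : Similar e u w := by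
  refine ⟨h.1.trans h'.1, ?_⟩
  obtain ⟨w', hw⟩ := (root_twin he hl (h.1.trans h'.1)).1.exists_of_reach (root_reach he hl u)
  obtain ⟨v', h1, h2⟩ := hw.split (root_twin he hl h.1).1
  obtain rfl := (root_twin he hl h.1).1.1 _ _ _ h1 h.2
  obtain rfl := (root_twin he hl h'.1).1.1 _ _ _ h2 h'.2
  exact hw

theorem Similar.step (he : 2 ≤ e) (hl : 2 ≤ l) {v w v' : FockVertex l s} (h : Similar e v w)
    {a : ZMod e × Bool ⊕ ZMod l × Bool} (ha : kashiwara e l s a v v') :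
    ∃ w', kashiwara e l s a w w' ∧ Similar e v' w' := by
  obtain ⟨w', hw⟩ := (root_twin he hl h.1).1.2 _ _ h.2 a _ ha
  refine ⟨w', hw, ?_⟩
  rw [Similar, ← root_congr he hl ha, ← root_congr he hl hw]
  exact ⟨h.1, h.2.tail ⟨a, ha, hw⟩⟩

theorem parameter_vertex (he : 2 ≤ e) (hl : 2 ≤ l) {F : ℤ → ℤ} {κ : ℕ → ℕ} {v w : FockVertex l s}
    (h : IsVertex e l F κ (conf e (root e v).1))
    (hc : (root e v).1.charge = (root e w).1.charge) :
    IsVertex e l F (parameter e w).rowLen (conf e (root e w).1) := by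
  obtain ⟨F', h'⟩ := parameter_spec he hl w
  obtain rfl := (isVertex_charge he hl h h').2 hc
  exact h'

/-- Equal charge and parameter force equal roots, and equal paths from one root end in the same
vertex. -/
theorem Similar.eq (he : 2 ≤ e) (hl : 2 ≤ l) {v w : FockVertex l s} (h : Similar e v w)
    (hp : parameter e v = parameter e w) : v = w := by
  obtain ⟨F, hF⟩ := parameter_spec he hl v
  have h' := parameter_vertex he hl hF h.1
  rw [← hp] at h'
  have h2 := h.2
  rw [← hF.eq h'] at h2
  exact (Emb.refl (kashiwara_functional he hl) _).1 _ _ _ (PairReach.diag (root_reach he hl v)) h2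

/-- The root is replaced by the doubly highest vertex with the same charge and parameter `μ`, and
the path to `v` is repeated from there. -/
theorem exists_similar (he : 2 ≤ e) (hl : 2 ≤ l) (v : FockVertex l s) (μ : YoungDiagram) :
    ∃ w, Similar e v w ∧ parameter e w = μ := by
  obtain ⟨F, hF⟩ := parameter_spec he hl v
  obtain ⟨x, hx⟩ := hF.exists_fockVertex he hl (rowLen_isPartSeq μ)
  have hc := (isVertex_charge he hl hF hx).1 rfl
  have hd := hx.isDoublyHighest he hl
  obtain ⟨w, hw⟩ := ((root_spec he hl v).1.twin he hl hd hc).1.exists_of_reach (root_reach he hl v)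
  have hr : root e w = x := root_eq he hl hd (hw.swap.fst.symm kashiwara_isSymm)
  subst hr
  exact ⟨w, ⟨hc, hw⟩, parameter_eq he hl hx⟩

theorem Similar.isDoublyHighest (he : 2 ≤ e) (hl : 2 ≤ l) {v w : FockVertex l s}
    (h : Similar e v w) (hv : IsDoublyHighest e l s v) : IsDoublyHighest e l s w := by
  have h2 := h.2
  rw [hv.root_eq he hl] at h2
  have hc := h.1
  rw [hv.root_eq he hl] at hc
  have := (hv.twin he hl (root_spec he hl w).1 hc).1.1 _ _ _ h2 .refl
  rw [this]
  exact (root_spec he hl w).1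

theorem similar_iff (he : 2 ≤ e) (hl : 2 ≤ l) {v w : FockVertex l s}
    (hv : IsDoublyHighest e l s v) (hw : IsDoublyHighest e l s w) :
    Similar e v w ↔ v.1.charge = w.1.charge := by
  rw [Similar, hv.root_eq he hl, hw.root_eq he hl]
  exact and_iff_left .refl

theorem kashiwara_charge (he : 2 ≤ e) (hl : 2 ≤ l) {a : ZMod e × Bool ⊕ ZMod l × Bool}
    {v v' w w' : FockVertex l s} (h : kashiwara e l s a v v') (h' : kashiwara e l s a w w')
    (hc : v.1.charge = w.1.charge) : v'.1.charge = w'.1.charge := by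
  obtain ⟨i, _ | _⟩ | ⟨j, _ | _⟩ := a
  · exact (KashiwaraArrow.charge h).symm.trans (hc.trans (KashiwaraArrow.charge h'))
  · exact (KashiwaraArrow.charge h).trans (hc.trans (KashiwaraArrow.charge h').symm)
  · rw [kashiwara_iff he hl] at h h'
    funext k
    have h1 := RowArr.charge hl h k
    have h2 := RowArr.charge hl h' k
    have := congrFun hc k
    omega
  · rw [kashiwara_iff he hl] at h h'
    funext k
    have h1 := RowArr.charge hl h k
    have h2 := RowArr.charge hl h' k
    have := congrFun hc k
    omega

/-- The roots have equal charge, and an arrow changes the charge by an amount that depends only on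
its label. -/
theorem Similar.charge (he : 2 ≤ e) (hl : 2 ≤ l) {v w : FockVertex l s} (h : Similar e v w) :
    v.1.charge = w.1.charge := by
  have key : ∀ q, PairReach (kashiwara e l s) (root e v, root e w) q → q.1.1.charge = q.2.1.charge := by
    intro q hq
    induction hq with
    | refl => exact h.1
    | tail _ hs ih =>
      obtain ⟨a, h1, h2⟩ := hs
      exact kashiwara_charge he hl h1 h2 ih
  exact key _ h.2

/-- `w` is similar to `v`, and the parameters are related by `P`. -/
def ShiftRel (e : ℕ) {l : ℕ} [NeZero e] [NeZero l] {s : ℤ} (P : YoungDiagram → YoungDiagram → Prop)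
    (v w : FockVertex l s) : Prop := Similar e v w ∧ P (parameter e v) (parameter e w)

theorem ShiftRel.functional (he : 2 ≤ e) (hl : 2 ≤ l) {P : YoungDiagram → YoungDiagram → Prop}
    (hP : ∀ μ ν ν', P μ ν → P μ ν' → ν = ν') {v w w' : FockVertex l s} (h : ShiftRel e P v w)
    (h' : ShiftRel e P v w') : w = w' :=
  (h.1.symm.trans he hl h'.1).eq he hl (hP _ _ _ h.2 h'.2)

/-- An arrow can be repeated at a similar vertex, and the parameter is constant on components. Hence
any change of the parameter within a similarity class commutes with the crystal operators. -/
theorem shiftRel_comm (he : 2 ≤ e) (hl : 2 ≤ l) (P : YoungDiagram → YoungDiagram → Prop)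
    (a : ZMod e × Bool ⊕ ZMod l × Bool) (v y : FockVertex l s) :
    (∃ v', kashiwara e l s a v v' ∧ ShiftRel e P v' y) ↔
      ∃ w, ShiftRel e P v w ∧ kashiwara e l s a w y := by
  obtain ⟨a', ha'⟩ := kashiwara_isSymm (e := e) (l := l) (s := s) a
  constructor
  · rintro ⟨v', h1, h2, h3⟩
    obtain ⟨w, h4, h5⟩ := h2.step he hl ((ha' _ _).1 h1)
    refine ⟨w, ⟨h5, ?_⟩, (ha' _ _).2 h4⟩
    rwa [parameter_congr (root_congr he hl h1), ← parameter_congr (root_congr he hl h4)]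
  · rintro ⟨w, ⟨h1, h2⟩, h3⟩
    obtain ⟨v', h4, h5⟩ := h1.symm.step he hl h3
    refine ⟨v', h4, h5.symm, ?_⟩
    rwa [← parameter_congr (root_congr he hl h4), ← parameter_congr (root_congr he hl h3)]

end Fock


/-! ### The Heisenberg operators and their crystal -/

theorem YoungArrow.card {c : ℤ} {μ ν : YoungDiagram} (h : YoungArrow c μ ν) : ν.card = μ.card + 1 := by
  obtain ⟨a, b, ⟨h1, h2⟩, -⟩ := h
  rw [YoungDiagram.card, h2, Finset.card_insert_of_notMem (by simpa using h1)]

theorem young_card_eq_zero {μ : YoungDiagram} : μ.card = 0 ↔ μ = ⊥ := by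
  rw [YoungDiagram.card, Finset.card_eq_zero]
  exact ⟨fun h => YoungDiagram.ext h, fun h => by rw [h, YoungDiagram.cells_bot]⟩

theorem rowLen_bot (k : ℕ) : (⊥ : YoungDiagram).rowLen k = 0 := by
  by_contra h
  exact YoungDiagram.notMem_bot _ (YoungDiagram.mem_iff_lt_rowLen.2 (Nat.pos_of_ne_zero h))

theorem exists_youngArrow {ν : YoungDiagram} (h : ν ≠ ⊥) : ∃ c μ, YoungArrow c μ ν := by
  have hν := rowLen_isPartSeq ν
  have h0 : ∃ k, ν.rowLen k ≠ 0 := by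
    by_contra! hc
    exact h (rowLen_injective fun k => by rw [hc, rowLen_bot])
  obtain ⟨K, hK⟩ := hν.finite
  obtain ⟨a, ha, ha'⟩ : ∃ a, ν.rowLen a ≠ 0 ∧ ∀ k, a < k → ν.rowLen k = 0 := by
    obtain ⟨k, hk⟩ := h0
    have hlt : ∀ k, ν.rowLen k ≠ 0 → k ≤ K := fun k hk => by
      by_contra hc
      exact hk (hK k (by omega))
    classical
    refine ⟨Nat.findGreatest (fun k => ν.rowLen k ≠ 0) K, ?_, fun k' hk' => ?_⟩
    · exact Nat.findGreatest_spec (P := fun k => ν.rowLen k ≠ 0) (hlt k hk) hk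
    · by_contra hc
      exact Nat.findGreatest_is_greatest hk' (hlt _ hc) hc
  obtain ⟨μ, hμ⟩ := IsPartSeq.exists_young (κ := fun k => ν.rowLen k - if k = a then 1 else 0)
    ⟨antitone_nat_of_succ_le fun k => by
      have h1 := hν.anti (Nat.le_add_right k 1)
      by_cases hk : k = a
      · rw [ha' (k + 1) (by omega)]; omega
      · rw [if_neg hk]; omega, K, fun k hk => by rw [hK k hk, Nat.zero_sub]⟩
  refine ⟨_, μ, a, μ.rowLen a, addsBox_iff.2 ⟨rfl, fun k => ?_⟩, rfl⟩
  rw [hμ]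
  split_ifs with hk
  · subst hk; omega
  · omega

section Fock

variable {e l : ℕ} [NeZero e] [NeZero l] {s : ℤ}

/-- Addition of partitions as a relation. -/
def AddsRows (σ μ ν : YoungDiagram) : Prop := ∀ k, ν.rowLen k = μ.rowLen k + σ.rowLen k

theorem exists_addsRows (σ μ : YoungDiagram) : ∃ ν, AddsRows σ μ ν :=
  ((rowLen_isPartSeq μ).add (rowLen_isPartSeq σ)).exists_young

theorem AddsRows.right_unique {σ μ ν ν' : YoungDiagram} (h : AddsRows σ μ ν) (h' : AddsRows σ μ ν') :
    ν = ν' := rowLen_injective fun k => by rw [h, h']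

theorem AddsRows.left_unique {σ μ μ' ν : YoungDiagram} (h : AddsRows σ μ ν) (h' : AddsRows σ μ' ν) :
    μ = μ' := rowLen_injective fun k => by have := h k; have := h' k; omega

theorem exists_pos (he : 2 ≤ e) (hl : 2 ≤ l) (σ : YoungDiagram) (v : FockVertex l s) :
    ∃ w, ShiftRel e (AddsRows σ) v w := by
  obtain ⟨ν, hν⟩ := exists_addsRows σ (parameter e v)
  obtain ⟨w, hw, rfl⟩ := exists_similar he hl v ν
  exact ⟨w, hw, hν⟩

theorem shiftRel_pos_iff (he : 2 ≤ e) (hl : 2 ≤ l) {v w : FockVertex l s} (hv : IsDoublyHighest e l s v)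
    (σ : YoungDiagram) : ShiftRel e (AddsRows σ) v w ↔ IsRightShift e l s σ v w := by
  obtain ⟨F, hF⟩ := parameter_spec he hl v
  have hF' := hF
  rw [hv.root_eq he hl] at hF'
  rw [isRightShift_iff he hl hF']
  constructor
  · rintro ⟨h1, h2⟩
    have hw := parameter_vertex he hl hF h1.1
    rw [(h1.isDoublyHighest he hl hv).root_eq he hl] at hw
    rwa [← funext h2]
  · intro h
    have hw := h.isDoublyHighest he hl
    have hs := (similar_iff he hl hv hw).2 ((isVertex_charge he hl hF' h).1 rfl)
    refine ⟨hs, ?_⟩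
    obtain ⟨ν, hν⟩ := exists_addsRows σ (parameter e v)
    rw [← funext hν, ← hw.root_eq he hl] at h
    rwa [parameter_eq he hl h]

theorem shiftRel_neg_iff (he : 2 ≤ e) (hl : 2 ≤ l) {v w : FockVertex l s} (hv : IsDoublyHighest e l s v)
    (σ : YoungDiagram) : ShiftRel e (fun μ ν => AddsRows σ ν μ) v w ↔
      w.1.charge = v.1.charge ∧ IsLeftShift e l s σ v w := by
  obtain ⟨F, hF⟩ := parameter_spec he hl v
  have hF' := hF
  rw [hv.root_eq he hl] at hF'
  rw [isLeftShift_iff he hl hF']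
  constructor
  · rintro ⟨h1, h2⟩
    have hw := parameter_vertex he hl hF h1.1
    rw [(h1.isDoublyHighest he hl hv).root_eq he hl] at hw
    exact ⟨_, fun k => (h2 k).symm, hw⟩
  · rintro ⟨ρ, hρ, h⟩
    have hw := h.isDoublyHighest he hl
    have hs := (similar_iff he hl hv hw).2 ((isVertex_charge he hl hF' h).1 rfl)
    refine ⟨hs, ?_⟩
    obtain ⟨ν, hν⟩ := h.2.1.exists_young
    rw [← funext hν, ← hw.root_eq he hl] at h
    rw [parameter_eq he hl h]
    exact fun k => by rw [hν, hρ]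

/-- The equality includes the value zero: both sides have the same possible results, so one is
undefined exactly when the other is. -/
theorem follow_comm_of_shiftRel (he : 2 ≤ e) (hl : 2 ≤ l) {P : YoungDiagram → YoungDiagram → Prop}
    {g : FockVertex l s → Option (FockVertex l s)}
    (hg : ∀ v w, g v = some w ↔ ShiftRel e P v w) {op : FockVertex l s → Option (FockVertex l s)}
    (hop : IsKashiwaraOperator e l s op) (v : FockVertex l s) : (op v).bind g = (g v).bind op := by
  obtain ⟨a, rfl⟩ := isKashiwaraOperator_iff.1 hop
  have hA : ∀ v w, follow (kashiwara e l s a) v = some w ↔ kashiwara e l s a v w := fun v w =>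
    follow_eq_some fun v w w' h h' => kashiwara_functional he hl a v w w' h h'
  refine Option.ext fun y => ?_
  rw [Option.bind_eq_some_iff, Option.bind_eq_some_iff]
  simp only [hA, hg]
  exact shiftRel_comm he hl P a v y

theorem isHeisenberg_of_shiftRel (he : 2 ≤ e) (hl : 2 ≤ l) {b : Operators l s}
    (hpos : ∀ σ v w, b.pos σ v = w ↔ ShiftRel e (AddsRows σ) v w)
    (hneg : ∀ σ v w, b.neg σ v = some w ↔ ShiftRel e (fun μ ν => AddsRows σ ν μ) v w) :
    IsHeisenberg e l s b where
  pos_charge σ v := (((hpos σ v _).1 rfl).1.charge he hl).symm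
  neg_charge σ v w h := (((hneg σ v w).1 h).1.charge he hl).symm
  pos_shift σ v hv := (shiftRel_pos_iff he hl hv σ).1 ((hpos σ v _).1 rfl)
  neg_shift σ v hv w := (hneg σ v w).trans (shiftRel_neg_iff he hl hv σ)
  pos_comm σ op hop v := by
    have := follow_comm_of_shiftRel he hl (g := fun v => some (b.pos σ v))
      (fun v w => by rw [Option.some_inj]; exact hpos σ v w) hop v
    rw [Option.bind_some] at this
    rw [← this, Option.map_eq_bind]
    rfl
  neg_comm σ op hop v := follow_comm_of_shiftRel he hl (hneg σ) hop v

theorem exists_isHeisenberg (he : 2 ≤ e) (hl : 2 ≤ l) : ∃ b : Operators l s, IsHeisenberg e l s b ∧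
    (∀ σ v w, b.pos σ v = w ↔ ShiftRel e (AddsRows σ) v w) ∧
    ∀ σ v w, b.neg σ v = some w ↔ ShiftRel e (fun μ ν => AddsRows σ ν μ) v w := by
  choose p hp using fun σ (v : FockVertex l s) => exists_pos he hl σ v
  have hpos : ∀ σ v w, p σ v = w ↔ ShiftRel e (AddsRows σ) v w := fun σ v w =>
    ⟨fun h => h ▸ hp σ v, fun h => (hp σ v).functional he hl (fun _ _ _ h h' => h.right_unique h') h⟩
  have hneg : ∀ σ (v w : FockVertex l s),
      follow (ShiftRel e fun μ ν => AddsRows σ ν μ) v = some w ↔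
        ShiftRel e (fun μ ν => AddsRows σ ν μ) v w := fun σ v w =>
    follow_eq_some fun v w w' h h' => h.functional he hl (fun _ _ _ h h' => h.left_unique h') h'
  exact ⟨⟨p, fun σ => follow (ShiftRel e fun μ ν => AddsRows σ ν μ)⟩,
    isHeisenberg_of_shiftRel he hl hpos hneg, hpos, hneg⟩

/-- Every vertex is reached from its root by crystal operators. This gives the uniqueness of the
Heisenberg operators and of `κ`, which are prescribed at roots and controlled along operators. -/
theorem root_induction (he : 2 ≤ e) (hl : 2 ≤ l) {p : FockVertex l s → Prop}
    (h0 : ∀ v, IsDoublyHighest e l s v → p v)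
    (h1 : ∀ op, IsKashiwaraOperator e l s op → ∀ v w, op v = some w → p v → p w)
    (v : FockVertex l s) : p v := by
  have key : ∀ w, Reach (kashiwara e l s) (root e v) w → p w := by
    intro w hw
    induction hw with
    | refl => exact h0 _ (root_spec he hl v).1
    | tail _ hs ih =>
      obtain ⟨a, ha⟩ := hs
      exact h1 _ (isKashiwaraOperator_iff.2 ⟨a, rfl⟩) _ _
        ((follow_eq_some fun v w w' h h' => kashiwara_functional he hl a v w w' h h').2 ha) ih
  exact key v (root_reach he hl v)

theorem IsHeisenberg.unique (he : 2 ≤ e) (hl : 2 ≤ l) {b b' : Operators l s}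
    (hb : IsHeisenberg e l s b) (hb' : IsHeisenberg e l s b') : b = b' := by
  have h1 : ∀ σ v, b.pos σ v = b'.pos σ v := fun σ => root_induction he hl
    (fun v hv => ((shiftRel_pos_iff he hl hv σ).2 (hb.pos_shift σ v hv)).functional he hl
      (fun _ _ _ h h' => h.right_unique h') ((shiftRel_pos_iff he hl hv σ).2 (hb'.pos_shift σ v hv)))
    (fun op hop v w h ih => by
      have h2 := hb.pos_comm σ op hop v
      have h3 := hb'.pos_comm σ op hop v
      rw [h, Option.map_some] at h2 h3
      exact Option.some_inj.1 (h2.trans (ih ▸ h3.symm)))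
  have h2 : ∀ σ v, b.neg σ v = b'.neg σ v := fun σ => root_induction he hl
    (fun v hv => Option.ext fun w => (hb.neg_shift σ v hv w).trans (hb'.neg_shift σ v hv w).symm)
    (fun op hop v w h ih => by
      have h2 := hb.neg_comm σ op hop v
      have h3 := hb'.neg_comm σ op hop v
      rw [h, Option.bind_some] at h2 h3
      rw [h2, h3, ih])
  cases b; cases b'
  simp only [Operators.mk.injEq]
  exact ⟨funext fun σ => funext (h1 σ), funext fun σ => funext (h2 σ)⟩

theorem isKappa_parameter (he : 2 ≤ e) (hl : 2 ≤ l) : IsKappa e l s (parameter e) where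
  doublyHighest v hv := by
    obtain ⟨F, hF⟩ := parameter_spec he hl v
    rw [hv.root_eq he hl] at hF
    exact (isKappa_doublyHighest_iff he hl hF _).2 fun _ => rfl
  invariant op hop v w h := by
    obtain ⟨a, rfl⟩ := isKashiwaraOperator_iff.1 hop
    rw [follow_eq_some fun v w w' h h' => kashiwara_functional he hl a v w w' h h'] at h
    exact (parameter_congr (root_congr he hl h)).symm

theorem IsKappa.eq_parameter (he : 2 ≤ e) (hl : 2 ≤ l) {κ : FockVertex l s → YoungDiagram}
    (h : IsKappa e l s κ) : κ = parameter e := by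
  refine funext (root_induction he hl (fun v hv => ?_) fun op hop v w hvw ih => ?_)
  · obtain ⟨F, hF⟩ := parameter_spec he hl v
    rw [hv.root_eq he hl] at hF
    exact rowLen_injective ((isKappa_doublyHighest_iff he hl hF _).1 (h.doublyHighest v hv))
  · rw [h.invariant op hop v w hvw, ih, (isKappa_parameter he hl).invariant op hop v w hvw]

theorem kappa_eq (he : 2 ≤ e) (hl : 2 ≤ l) : kappa e l s = parameter e :=
  IsKappa.eq_parameter he hl (Classical.epsilon_spec ⟨_, isKappa_parameter he hl⟩)

theorem heisenberg_spec (he : 2 ≤ e) (hl : 2 ≤ l) :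
    (∀ σ v w, (heisenberg e l s).pos σ v = w ↔ ShiftRel e (AddsRows σ) v w) ∧
    ∀ σ v w, (heisenberg e l s).neg σ v = some w ↔ ShiftRel e (fun μ ν => AddsRows σ ν μ) v w := by
  obtain ⟨b, hb, h⟩ := exists_isHeisenberg (s := s) he hl
  have h1 : IsHeisenberg e l s (heisenberg e l s) := Classical.epsilon_spec ⟨b, hb⟩
  rwa [h1.unique he hl hb]

theorem addsRows_self {μ ν : YoungDiagram} : AddsRows μ ν μ ↔ ν = ⊥ := by
  constructor
  · intro h
    exact rowLen_injective fun k => by have := h k; rw [rowLen_bot]; omega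
  · rintro rfl k
    rw [rowLen_bot, Nat.zero_add]

theorem addsRows_bot {μ ν : YoungDiagram} : AddsRows μ ⊥ ν ↔ ν = μ :=
  ⟨fun h => rowLen_injective fun k => by rw [h, rowLen_bot, Nat.zero_add], fun h => h ▸ addsRows_self.2 rfl⟩

/-- Subtracting the whole parameter leads to the similar vertex with empty parameter, and adding `η`
leads from there to the similar vertex with parameter `η`. -/
theorem heisenbergArrow_iff (he : 2 ≤ e) (hl : 2 ≤ l) (c : ℤ) (v w : FockVertex l s) :
    heisenbergArrow e l s c v w ↔ Similar e v w ∧ YoungArrow c (parameter e v) (parameter e w) := by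
  obtain ⟨hpos, hneg⟩ := heisenberg_spec (s := s) he hl
  rw [heisenbergArrow, kappa_eq he hl]
  simp only [Option.map_eq_some_iff, hpos, hneg]
  constructor
  · rintro ⟨η, h1, u, ⟨h2, h3⟩, h4, h5⟩
    rw [addsRows_self.1 h3, addsRows_bot] at h5
    exact ⟨h2.trans he hl h4, h5 ▸ h1⟩
  · rintro ⟨h1, h2⟩
    obtain ⟨u, h3, h4⟩ := exists_similar he hl v ⊥
    refine ⟨_, h2, u, ⟨h3, addsRows_self.2 h4⟩, h3.symm.trans he hl h1, ?_⟩
    rw [h4, addsRows_bot]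

theorem exists_heisenbergArrow (he : 2 ≤ e) (hl : 2 ≤ l) {v : FockVertex l s} (h : parameter e v ≠ ⊥) :
    ∃ c w, heisenbergArrow e l s c w v := by
  obtain ⟨c, μ, hμ⟩ := exists_youngArrow h
  obtain ⟨w, hw, rfl⟩ := exists_similar he hl v μ
  exact ⟨c, w, (heisenbergArrow_iff he hl c w v).2 ⟨hw.symm, hμ⟩⟩

theorem isSource_iff (he : 2 ≤ e) (hl : 2 ≤ l) (v : FockVertex l s) :
    IsSource e l s v ↔ parameter e v = ⊥ := by
  constructor
  · intro h
    by_contra hne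
    obtain ⟨c, w, hw⟩ := exists_heisenbergArrow he hl hne
    exact h c w hw
  · intro h c w hw
    have := ((heisenbergArrow_iff he hl c w v).1 hw).2.card
    rw [young_card_eq_zero.2 h] at this
    omega

/-- Subtracting the parameter itself is always possible, while nothing nonempty can be subtracted
from the empty partition. -/
theorem isHeisenbergHighest_iff (he : 2 ≤ e) (hl : 2 ≤ l) (v : FockVertex l s) :
    IsHeisenbergHighest e l s v ↔ parameter e v = ⊥ := by
  have hneg := (heisenberg_spec (s := s) he hl).2
  constructor
  · intro h
    by_contra hne
    obtain ⟨u, h3, h4⟩ := exists_similar he hl v ⊥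
    have := (hneg _ v u).2 ⟨h3, addsRows_self.2 h4⟩
    rw [h _ hne] at this
    cases this
  · intro h σ hσ
    refine Option.eq_none_iff_forall_ne_some.2 fun w hw => hσ ?_
    have h1 := ((hneg σ v w).1 hw).2
    refine rowLen_injective fun k => ?_
    have h2 := h1 k
    rw [h, rowLen_bot] at h2
    rw [rowLen_bot]
    omega

theorem similar_bot_connected (he : 2 ≤ e) (hl : 2 ≤ l) {n : ℕ} {u v : FockVertex l s}
    (hn : (parameter e v).card = n) (hu : parameter e u = ⊥) (h : Similar e u v) :
    Connected e l s u v := by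
  induction n generalizing v with
  | zero =>
    rw [young_card_eq_zero] at hn
    rw [h.eq he hl (hu.trans hn.symm)]
    exact .refl _
  | succ n ih =>
    obtain ⟨c, w, hw⟩ := exists_heisenbergArrow he hl (v := v) fun h0 => by
      rw [young_card_eq_zero.2 h0] at hn; omega
    obtain ⟨h1, h2⟩ := (heisenbergArrow_iff he hl c w v).1 hw
    have := h2.card
    exact (ih (by omega) (h.trans he hl h1.symm)).trans _ _ _ (.rel _ _ ⟨c, hw⟩)

/-- Arrows stay within a similarity class. Conversely, removing boxes from the parameter one at a
time connects every vertex to the member of its class with empty parameter. -/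
theorem connected_iff (he : 2 ≤ e) (hl : 2 ≤ l) (v w : FockVertex l s) :
    Connected e l s v w ↔ Similar e v w := by
  constructor
  · intro h
    induction h with
    | rel v w h =>
      obtain ⟨c, h⟩ := h
      exact ((heisenbergArrow_iff he hl c v w).1 h).1
    | refl v => exact .refl he hl v
    | symm _ _ _ ih => exact ih.symm
    | trans _ _ _ _ _ ih ih' => exact ih.trans he hl ih'
  · intro h
    obtain ⟨u, h3, h4⟩ := exists_similar he hl v ⊥
    exact ((similar_bot_connected he hl rfl h4 h3.symm).symm _ _).trans _ _ _
      (similar_bot_connected he hl rfl h4 (h3.symm.trans he hl h))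

theorem exists_component_equiv (he : 2 ≤ e) (hl : 2 ≤ l) (v : FockVertex l s) :
    ∃ φ : YoungDiagram ≃ {w // Connected e l s v w},
      ∀ c μ ν, YoungArrow c μ ν ↔ heisenbergArrow e l s c (φ μ).1 (φ ν).1 := by
  choose f hf hf' using exists_similar he hl v
  refine ⟨⟨fun μ => ⟨f μ, (connected_iff he hl _ _).2 (hf μ)⟩, fun w => parameter e w.1, hf',
    fun w => Subtype.ext ?_⟩, fun c μ ν => ?_⟩
  · exact ((hf _).symm.trans he hl ((connected_iff he hl _ _).1 w.2)).eq he hl (hf' _)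
  · rw [heisenbergArrow_iff he hl]
    simp only [Equiv.coe_fn_mk, hf']
    exact (and_iff_right ((hf μ).symm.trans he hl (hf ν))).symm

/-- Each arrow adds one box to the parameter, which is empty at a source; conversely boxes are
removed until a source is reached. -/
theorem exists_path_iff (he : 2 ≤ e) (hl : 2 ≤ l) (v : FockVertex l s) (n : ℕ) :
    (∃ u, IsSource e l s u ∧ HasPath e l s n u v) ↔ n = (parameter e v).card := by
  constructor
  · rintro ⟨u, hu, p, rfl, rfl, hp⟩
    have key : ∀ k ≤ n, (parameter e (p k)).card = k := by
      intro k
      induction k with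
      | zero => exact fun _ => young_card_eq_zero.2 ((isSource_iff he hl _).1 hu)
      | succ k ih =>
        intro hk
        obtain ⟨c, hc⟩ := hp k (by omega)
        rw [((heisenbergArrow_iff he hl _ _ _).1 hc).2.card, ih (by omega)]
    exact (key n le_rfl).symm
  · intro hn
    induction n generalizing v with
    | zero =>
      exact ⟨v, (isSource_iff he hl v).2 (young_card_eq_zero.1 hn.symm), fun _ => v, rfl, rfl,
        fun k hk => by omega⟩
    | succ n ih =>
      obtain ⟨c, w, hw⟩ := exists_heisenbergArrow he hl (v := v) fun h0 => by
        rw [young_card_eq_zero.2 h0] at hn; omega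
      have := ((heisenbergArrow_iff he hl c w v).1 hw).2.card
      obtain ⟨u, hu, p, h0, h1, hp⟩ := ih w (by omega)
      -- The path to `w` is kept up to the index `n` and extended by the arrow from `w` to `v`.
      refine ⟨u, hu, fun k => if k ≤ n then p k else v, by simp [h0], by simp, fun k hk => ?_⟩
      rcases Nat.lt_or_ge k n with h | h
      · simpa only [if_pos h.le, if_pos (show k + 1 ≤ n from h)] using hp k h
      · obtain rfl : k = n := by omega
        simp only [le_refl, if_true, if_neg (show ¬ k + 1 ≤ k by omega), h1]
        exact ⟨c, hw⟩

theorem fockSpace_eq_supported (t : {t : Fin l → ℤ // ∑ j, t j = s}) :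
    fockSpace l s t = Finsupp.supported (RatFunc ℚ) (RatFunc ℚ) {v : FockVertex l s | v.1.charge = t.1} :=
  (Finsupp.supported_eq_span_single _ _).symm

theorem ket_mem_iff (v : FockVertex l s) (t : {t : Fin l → ℤ // ∑ j, t j = s}) :
    ket l s v ∈ fockSpace l s t ↔ v.1.charge = t.1 := by
  rw [fockSpace_eq_supported, Finsupp.mem_supported, ket, Finsupp.support_single (hb := one_ne_zero)]
  simp

theorem fockSpace_isInternal : DirectSum.IsInternal (fockSpace l s) := by
  rw [show fockSpace l s = fun t => _ from funext fockSpace_eq_supported]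
  refine DirectSum.isInternal_submodule_of_iSupIndep_of_iSup_eq_top (iSupIndep_def.2 fun t => ?_) ?_
  · refine Disjoint.mono_right (iSup₂_le fun t' hne => Finsupp.supported_mono
      (t := {v : FockVertex l s | v.1.charge ≠ t.1}) fun v hv h => ?_)
      (Finsupp.disjoint_supported_supported (Set.disjoint_left.2 fun v hv hv' => hv' hv))
    exact hne (Subtype.ext (Eq.trans (Eq.symm hv) h))
  · rw [← Finsupp.supported_iUnion, ← Finsupp.supported_univ]
    congr 1
    exact Set.eq_univ_of_forall fun v => Set.mem_iUnion.2 ⟨⟨v.1.charge, v.2⟩, rfl⟩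

end Fock

end HeisenbergCrystal

theorem proposition3p9 (e l : ℕ) [NeZero e] [NeZero l] (he : 2 ≤ e) (hl : 2 ≤ l) (s : ℤ) :
    -- the Heisenberg crystal operators and the map `κ` are well defined
    (∃! b : Operators l s, IsHeisenberg e l s b) ∧
    (∃! κ : FockVertex l s → YoungDiagram, IsKappa e l s κ) ∧
    -- the wedge space is the direct sum of the Fock spaces, and the crystal decomposes accordingly
    (DirectSum.IsInternal (fockSpace l s) ∧
      (∀ v t, ket l s v ∈ fockSpace l s t ↔ v.1.charge = t.1) ∧
      ∀ t v w, Connected e l s v w →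
        (ket l s v ∈ fockSpace l s t ↔ ket l s w ∈ fockSpace l s t)) ∧
    -- each connected component is isomorphic to the Young graph, with its colours
    (∀ v : FockVertex l s, ∃ φ : YoungDiagram ≃ {w // Connected e l s v w},
      ∀ c μ ν, YoungArrow c μ ν ↔ heisenbergArrow e l s c (φ μ).1 (φ ν).1) ∧
    -- sources are the highest weight vertices
    (∀ v : FockVertex l s, IsSource e l s v ↔ IsHeisenbergHighest e l s v) ∧
    -- the depth of a vertex is the size of `κ`
    (∀ (v : FockVertex l s) (n : ℕ),
      (∃ u, IsSource e l s u ∧ HasPath e l s n u v) ↔ n = (kappa e l s v).card) := by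
  refine ⟨?_, ⟨parameter e, isKappa_parameter he hl, fun κ h => h.eq_parameter he hl⟩,
    ⟨fockSpace_isInternal, ket_mem_iff, fun t v w h => ?_⟩, exists_component_equiv he hl,
    fun v => (isSource_iff he hl v).trans (isHeisenbergHighest_iff he hl v).symm, fun v n => ?_⟩
  · obtain ⟨b, hb, -⟩ := exists_isHeisenberg (s := s) he hl
    exact ⟨b, hb, fun b' hb' => hb'.unique he hl hb⟩
  · rw [ket_mem_iff, ket_mem_iff, ((connected_iff he hl v w).1 h).charge he hl]
  · rw [kappa_eq he hl]
    exact exists_path_iff he hl v n
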